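/- Let $Y$ be a connected complex manifold, $\mathcal E$ a holomorphic vector bundle of rank $r$ on $Y$ (identified with its sheaf of sections), and $s\colon\mathcal E\to\mathcal O_Y$ an $\mathcal O_Y$-linear morphism (a cosection). Let $\mathcal I_T=s(\mathcal E)\subset\mathcal O_Y$ be the image of $s$, let $T$ be the vanishing locus of $s$, i.e. the support of $\mathcal O_Y/\mathcal I_T$ with structure sheaf $\mathcal O_T=j^{-1}(\mathcal O_Y/\mathcal I_T)$, where $j\colon T\to Y$ is the inclusion, and write $\mathcal M_{|T}=j^*\mathcal M$ for sheaves of $\mathcal O_Y$-modules. The Koszul complex $\mathcal K=\mathcal K(\mathcal E,s)$ is $\mathrm{Sym}(\mathcal E[1])$, i.e. $\wedge^p\mathcal E$ in cohomological degree $-p$ for $p\ge 0$, with differential $$e_1\wedge\dots\wedge e_p\longmapsto\sum_{i=1}^p(-1)^{i-1}s(e_i)\,e_1\wedge\dots\wedge\widehat{e_i}\wedge\dots\wedge e_p .$$ A cosection $\tilde s$ of a vector bundle is called regular if at each point of its vanishing locus the components of $\tilde s$ in some local frame form a regular sequence in the local ring of holomorphic germs. Assume that $s$ is weakly regular: $T$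 is smooth (near each of its points, $\mathcal I_T$ is generated by holomorphic functions whose differentials at that point are linearly independent), and every $t\in T$ has an open neighbourhood $U$ in $Y$ with a vector bundle $\widetilde{\mathcal E}$ on $U$ and a factorization of $s_{|U}$ as $$\mathcal E_{|U}\twoheadrightarrow\widetilde{\mathcal E}\xrightarrow{\ \tilde s\ }{\mathcal I_T}_{|U}$$ in which the first arrow is surjective and $\tilde s$ is regular. Let $N^\vee_{T/Y}=j^*\mathcal I_T=\mathcal I_T/\mathcal I_T^2$ be the conormal sheaf, and let $\mathcal N=\ker(\mathcal E_{|T}\to N^\vee_{T/Y})$ be the kernel of the morphism induced by $s$ (the excess bundle). Then: 1. The canonical isomorphisms $(\wedge^p\mathcal E)_{|T}\simeq\wedge^p(\mathcal E_{|T})$ form an isomorphism of complexes $\mathcal K_{|T}\simeq\mathrm{Sym}(\mathcal E_{|T}[1])$, where the right-hand side has zero differentials. 2. $\mathcal K$ is locally on $Y$ quasi-isomorphic to the complex $j_*\mathrm{Sym}(\mathcal N[1])$ with zero differentials: every point of $Y$ has an open neighbourhood $U$ for which there is a quasi-isomorphism $\mathcal K_{|U}\to\big(j_*\mathrm{Sym}(\mathcal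 N[1])\big)_{|U}$ of complexes of $\mathcal O_U$-modules. 3. For every $p\ge 0$ the canonical morphism $$c_p\colon\ \mathcal H^{-p}(\mathcal K)_{|T}\to\mathcal H^{-p}(\mathcal K_{|T})\simeq\wedge^p(\mathcal E_{|T}),$$ whose last isomorphism is induced by that of part 1, is injective. The morphism $\wedge^p\mathcal N\to\wedge^p(\mathcal E_{|T})$ induced by the inclusion $\mathcal N\subset\mathcal E_{|T}$ is injective too, and its image is that of $c_p$. In particular $\mathcal H^{-p}(\mathcal K)$ is canonically isomorphic to $j_*\wedge^p\mathcal N$: there is exactly one isomorphism $\mathcal H^{-p}(\mathcal K)\simeq j_*\wedge^p\mathcal N$ such that the adjoint morphism $\mathcal H^{-p}(\mathcal K)_{|T}\to\wedge^p\mathcal N$, followed by the inclusion $\wedge^p\mathcal N\subset\wedge^p(\mathcal E_{|T})$, is $c_p$. -/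

import Mathlib

open CategoryTheory TopologicalSpace Opposite Limits

noncomputable section

namespace Koszul

section Algebra

variable {A B C : Type*} [CommRing A] [CommRing B] [CommRing C] {φ : A →+* B} {ψ : B →+* C}
  {M N P : Type*} [AddCommGroup M] [Module A M] [AddCommGroup N] [Module B N]
  [AddCommGroup P] [Module C P]

/-- The map `⋀^p M → ⋀^p N`, `m₁ ∧ ⋯ ∧ m_p ↦ f m₁ ∧ ⋯ ∧ f m_p`, induced by a map `f : M → N` which
is semilinear along a ring homomorphism `φ : A → B`. -/
def extMap (p : ℕ) (f : M →ₛₗ[φ] N) : ⋀[A]^p M →ₛₗ[φ] ⋀[B]^p N :=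
  letI : Module A (⋀[B]^p N) := Module.compHom _ φ
  let a : M [⋀^Fin p]→ₗ[A] (⋀[B]^p N) :=
    { toFun := fun m => exteriorPower.ιMulti B p (f ∘ m)
      map_update_add' := fun m i x y => by
        simp only [Function.comp_update, map_add, AlternatingMap.map_update_add]
      map_update_smul' := fun m i r x => by
        simp only [Function.comp_update, map_smulₛₗ, AlternatingMap.map_update_smul]
        rfl
      map_eq_zero_of_eq' := fun m i k h hik =>
        (exteriorPower.ιMulti B p).map_eq_zero_of_eq _ (by simp [h]) hik }
  let l := exteriorPower.alternatingMapLinearEquiv a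
  { toFun := l
    map_add' := l.map_add
    map_smul' := fun r x => l.map_smul r x }

@[simp]
theorem extMap_ιMulti (p : ℕ) (f : M →ₛₗ[φ] N) (m : Fin p → M) :
    extMap p f (exteriorPower.ιMulti A p m) = exteriorPower.ιMulti B p (f ∘ m) := by
  let : Module A (⋀[B]^p N) := Module.compHom _ φ
  exact exteriorPower.alternatingMapLinearEquiv_apply_ιMulti _ _

theorem ext_semilinear {p : ℕ} {Q : Type*} [AddCommGroup Q] [Module B Q]
    {f g : ⋀[A]^p M →ₛₗ[φ] Q}
    (h : ∀ m : Fin p → M, f (exteriorPower.ιMulti A p m) = g (exteriorPower.ιMulti A p m)) :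
    f = g := by
  have hs : Submodule.span A (Set.range (exteriorPower.ιMulti A p (M := M))) = ⊤ :=
    exteriorPower.ιMulti_span A p M
  exact LinearMap.ext_on hs (by rintro _ ⟨m, rfl⟩; exact h m)

/-- The contraction `⋀^(p+1) M → ⋀^p M`,
`e₀ ∧ ⋯ ∧ e_p ↦ ∑ i, (-1)^i s(e_i) • e₀ ∧ ⋯ ∧ ê_i ∧ ⋯ ∧ e_p`, with a linear form `s`. -/
def contract (s : M →ₗ[A] A) (p : ℕ) : ⋀[A]^(p + 1) M →ₗ[A] ⋀[A]^p M :=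
  exteriorPower.alternatingMapLinearEquiv
    (AlternatingMap.alternatizeUncurryFin (s.smulRight (exteriorPower.ιMulti A p)))

theorem contract_ιMulti (s : M →ₗ[A] A) (p : ℕ) (e : Fin (p + 1) → M) :
    contract s p (exteriorPower.ιMulti A (p + 1) e) =
      ∑ i : Fin (p + 1), (-1) ^ (i : ℕ) • s (e i) • exteriorPower.ιMulti A p (i.removeNth e) := by
  simp [contract, AlternatingMap.alternatizeUncurryFin_apply]

theorem contract_contract (s : M →ₗ[A] A) (p : ℕ) (x : ⋀[A]^(p + 2) M) :
    contract s p (contract s (p + 1) x) = 0 := by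
  suffices h : contract s p ∘ₗ contract s (p + 1) = 0 from LinearMap.congr_fun h x
  refine ext_semilinear fun m => ?_
  let f : M →ₗ[A] M →ₗ[A] M [⋀^Fin p]→ₗ[A] ⋀[A]^p M :=
    s.smulRight (s.smulRight (exteriorPower.ιMulti A p))
  have hf := AlternatingMap.alternatizeUncurryFin_alternatizeUncurryFinLM_comp_of_symmetric
    (f := f) (fun x y => by
      ext m : 1
      simp only [f, LinearMap.smulRight_apply, LinearMap.smul_apply, AlternatingMap.smul_apply]
      rw [smul_comm])
  have := congrArg (fun a => a m) hf
  simp only [AlternatingMap.alternatizeUncurryFin_apply, LinearMap.comp_apply,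
    AlternatingMap.alternatizeUncurryFinLM_apply, AlternatingMap.zero_apply] at this
  rw [LinearMap.comp_apply, contract_ιMulti, map_sum, LinearMap.zero_apply, ← this]
  refine Finset.sum_congr rfl fun i _ => ?_
  rw [map_zsmul, map_smul, contract_ιMulti, Finset.smul_sum]
  refine congrArg _ (Finset.sum_congr rfl fun k _ => ?_)
  rw [smul_comm (s (m i))]
  simp [f]

theorem extMap_contract (s : M →ₗ[A] A) (t : N →ₗ[B] B) (f : M →ₛₗ[φ] N)
    (h : ∀ m, t (f m) = φ (s m)) (p : ℕ) (x : ⋀[A]^(p + 1) M) :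
    extMap p f (contract s p x) = contract t p (extMap (p + 1) f x) := by
  suffices h : (extMap p f).comp (contract s p) = (contract t p).comp (extMap (p + 1) f) from
    LinearMap.congr_fun h x
  refine ext_semilinear fun m => ?_
  simp only [LinearMap.comp_apply, contract_ιMulti, extMap_ιMulti, map_sum, map_zsmul,
    map_smulₛₗ, Function.comp_apply, h]
  rfl

theorem extMap_id (p : ℕ) {θ : A →+* A} (hθ : θ = RingHom.id A) (f : M →ₛₗ[θ] M)
    (h : ∀ m, f m = m) (x : ⋀[A]^p M) : extMap p f x = x := by
  subst hθ
  suffices h : extMap p f = LinearMap.id from LinearMap.congr_fun h x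
  refine ext_semilinear fun m => ?_
  rw [extMap_ιMulti, LinearMap.id_apply]
  exact congrArg _ (funext fun i => h (m i))

theorem extMap_comp (p : ℕ) {χ : A →+* C} (hχ : ψ.comp φ = χ) (k : M →ₛₗ[χ] P) (g : N →ₛₗ[ψ] P)
    (f : M →ₛₗ[φ] N) (h : ∀ m, k m = g (f m)) (x : ⋀[A]^p M) :
    extMap p k x = extMap p g (extMap p f x) := by
  let : RingHomCompTriple φ ψ χ := ⟨hχ⟩
  suffices h : extMap p k = (extMap p g).comp (extMap p f) from LinearMap.congr_fun h x
  refine ext_semilinear fun m => ?_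
  simp only [LinearMap.comp_apply, extMap_ιMulti]
  exact congrArg _ (funext fun i => h (m i))

end Algebra

section Presheaf

variable {D : Type*} [Category* D] {O : Dᵒᵖ ⥤ CommRingCat.{0}}

/-- The presheaf `U ↦ ⋀^p M(U)`. -/
def extPresheaf (p : ℕ) (M : PresheafOfModules.{0} (O ⋙ forget₂ CommRingCat RingCat)) :
    PresheafOfModules.{0} (O ⋙ forget₂ CommRingCat RingCat) where
  obj U := ModuleCat.of (O.obj U) (⋀[O.obj U]^p (M.obj U))
  map {U V} f := ModuleCat.semilinearMapAddEquiv _ _ _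
    (extMap (φ := (O.map f).hom) p (M.restrictₛₗ f))
  map_id U := by
    refine ModuleCat.hom_ext (LinearMap.ext fun x => ?_)
    exact extMap_id p (congrArg CommRingCat.Hom.hom (O.map_id U)) (M.restrictₛₗ (𝟙 U))
      (fun m => by rw [M.restrictₛₗ_apply, M.map_id]; rfl) x
  map_comp {U V W} f g := by
    refine ModuleCat.hom_ext (LinearMap.ext fun x => ?_)
    exact extMap_comp p (congrArg CommRingCat.Hom.hom (O.map_comp f g)).symm
      (M.restrictₛₗ (f ≫ g)) (M.restrictₛₗ g) (M.restrictₛₗ f) (fun m => M.map_comp_apply f g m) x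

/-- The morphism `⋀^p M → ⋀^p N` induced by a morphism `M → N` of presheaves of modules. -/
def extPresheafMap (p : ℕ) {M N : PresheafOfModules.{0} (O ⋙ forget₂ CommRingCat RingCat)}
    (f : M ⟶ N) : extPresheaf p M ⟶ extPresheaf p N where
  app U := ModuleCat.ofHom (R := O.obj U) (extMap (A := O.obj U) p (f.app U).hom)
  naturality {U V} g := by
    refine ModuleCat.hom_ext (LinearMap.ext fun x => ?_)
    let k : M.obj U →ₛₗ[(O.map g).hom] N.obj V :=
      { toFun := fun m => f.app V (M.map g m)
        map_add' := fun a b => by rw [map_add]; exact (f.app V).hom.map_add _ _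
        map_smul' := fun r m => by rw [M.map_smul]; exact (f.app V).hom.map_smul _ _ }
    have h₁ := extMap_comp (A := O.obj U) (B := O.obj V) (C := O.obj V) p
      (RingHom.id_comp (O.map g).hom) k (f.app V).hom (M.restrictₛₗ g) (fun m => rfl) x
    have h₂ := extMap_comp (A := O.obj U) (B := O.obj U) (C := O.obj V) p
      (RingHom.comp_id (O.map g).hom) k (N.restrictₛₗ g) (f.app U).hom
      (fun m => PresheafOfModules.naturality_apply f g m) x
    exact h₁.symm.trans h₂

/-- The functor `M ↦ (U ↦ ⋀^p M(U))` on presheaves of modules. -/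
def extPresheafFunctor (p : ℕ) : PresheafOfModules.{0} (O ⋙ forget₂ CommRingCat RingCat) ⥤
    PresheafOfModules.{0} (O ⋙ forget₂ CommRingCat RingCat) where
  obj M := extPresheaf p M
  map f := extPresheafMap p f
  map_id M := by
    refine PresheafOfModules.hom_ext fun U => ModuleCat.hom_ext (LinearMap.ext fun x => ?_)
    exact extMap_id (A := O.obj U) p rfl _ (fun m => rfl) x
  map_comp f g := by
    refine PresheafOfModules.hom_ext fun U => ModuleCat.hom_ext (LinearMap.ext fun x => ?_)
    exact extMap_comp (A := O.obj U) (B := O.obj U) (C := O.obj U) (φ := RingHom.id (O.obj U))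
      (ψ := RingHom.id (O.obj U)) (χ := RingHom.id (O.obj U)) p rfl
      ((f ≫ g).app U).hom (g.app U).hom (f.app U).hom (fun m => rfl) x

/-- The Koszul differential `⋀^(p+1) M(U) → ⋀^p M(U)` of a cosection, on presheaves. -/
def contractPresheaf {M : PresheafOfModules.{0} (O ⋙ forget₂ CommRingCat RingCat)}
    (s : M ⟶ PresheafOfModules.unit (O ⋙ forget₂ CommRingCat RingCat)) (p : ℕ) :
    extPresheaf (p + 1) M ⟶ extPresheaf p M where
  app U := ModuleCat.ofHom (R := O.obj U) (contract (A := O.obj U) (s.app U).hom p)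
  naturality {U V} g := by
    refine ModuleCat.hom_ext (LinearMap.ext fun x => ?_)
    exact (extMap_contract (A := O.obj U) (B := O.obj V) (s.app U).hom (s.app V).hom
      (M.restrictₛₗ g) (fun m => PresheafOfModules.naturality_apply s g m) p x).symm

theorem contractPresheaf_comp {M : PresheafOfModules.{0} (O ⋙ forget₂ CommRingCat RingCat)}
    (s : M ⟶ PresheafOfModules.unit (O ⋙ forget₂ CommRingCat RingCat)) (p : ℕ) :
    contractPresheaf s (p + 1) ≫ contractPresheaf s p = 0 := by
  refine PresheafOfModules.hom_ext fun U => ModuleCat.hom_ext (LinearMap.ext fun x => ?_)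
  exact contract_contract (A := O.obj U) (s.app U).hom p x

section Push

variable {D' : Type*} [Category* D'] {O' : D'ᵒᵖ ⥤ CommRingCat.{0}} {F : D ⥤ D'}
    (φ : O ⟶ F.op ⋙ O')
    {M : PresheafOfModules.{0} (O ⋙ forget₂ CommRingCat RingCat)}
    {N : PresheafOfModules.{0} (O' ⋙ forget₂ CommRingCat RingCat)}
    (u : M ⟶ (PresheafOfModules.pushforward (F := F) (R := O' ⋙ forget₂ CommRingCat RingCat)
      (Functor.whiskerRight φ (forget₂ CommRingCat RingCat))).obj N)

/-- The maps `M(U) → N(F U)`, semilinear along `O(U) → O'(F U)`, of a morphism `M → F_* N`. -/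
def semilin (U : Dᵒᵖ) : M.obj U →ₛₗ[(φ.app U).hom] N.obj (F.op.obj U) :=
  (ModuleCat.semilinearMapAddEquiv (φ.app U).hom _ _).symm (u.app U)

/-- The morphism of presheaves `⋀^p M → F_* (⋀^p N)`,
`m₁ ∧ ⋯ ∧ m_p ↦ u m₁ ∧ ⋯ ∧ u m_p`, induced by `u : M → F_* N`. -/
def extPush (p : ℕ) :
    extPresheaf p M ⟶ (PresheafOfModules.pushforward (F := F) (R := O' ⋙ forget₂ CommRingCat RingCat)
      (Functor.whiskerRight φ (forget₂ CommRingCat RingCat))).obj (extPresheaf p N) where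
  app U := ModuleCat.semilinearMapAddEquiv (φ.app U).hom _ _ (extMap p (semilin φ u U))
  naturality {U V} g := by
    refine ModuleCat.hom_ext (LinearMap.ext fun x => ?_)
    let k : M.obj U →ₛₗ[(φ.app V).hom.comp (O.map g).hom] N.obj (F.op.obj V) :=
      { toFun := fun m => semilin φ u V (M.map g m)
        map_add' := fun a b => by rw [map_add]; exact (semilin φ u V).map_add _ _
        map_smul' := fun r m => by rw [M.map_smul]; exact (semilin φ u V).map_smulₛₗ _ _ }
    have h₁ := extMap_comp (A := O.obj U) (B := O.obj V) (C := O'.obj (F.op.obj V)) p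
      rfl k (semilin φ u V) (M.restrictₛₗ g) (fun m => rfl) x
    have h₂ := extMap_comp (A := O.obj U) (B := O'.obj (F.op.obj U)) (C := O'.obj (F.op.obj V)) p
      (congrArg CommRingCat.Hom.hom (φ.naturality g)).symm k (N.restrictₛₗ (F.op.map g)) (semilin φ u U)
      (fun m => PresheafOfModules.naturality_apply u g m) x
    exact h₁.symm.trans h₂

end Push
end Presheaf

section Sheaf

variable {X Y : TopCat.{0}}

/-- The associated sheaf functor for modules over a sheaf of rings. -/
def sheafifyModules (R : Sheaf (Opens.grothendieckTopology X) RingCat.{0}) :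
    PresheafOfModules.{0} R.obj ⥤ SheafOfModules.{0} R :=
  PresheafOfModules.sheafification (𝟙 R.obj)

/-- Sheafification is left adjoint to the inclusion of sheaves of modules into presheaves of modules. -/
def sheafifyModulesAdj (R : Sheaf (Opens.grothendieckTopology X) RingCat.{0}) :
    sheafifyModules R ⊣ SheafOfModules.forget R :=
  PresheafOfModules.sheafificationAdjunction (𝟙 R.obj)

instance (R : Sheaf (Opens.grothendieckTopology X) RingCat.{0}) : (sheafifyModules R).Additive :=
  (sheafifyModulesAdj R).left_adjoint_additive

/-- A sheaf of commutative rings, viewed as a sheaf of rings. -/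
abbrev ringSheaf (O : Sheaf (Opens.grothendieckTopology X) CommRingCat.{0}) :
    Sheaf (Opens.grothendieckTopology X) RingCat.{0} :=
  (sheafCompose _ (forget₂ CommRingCat RingCat)).obj O

/-- The (abelian) category of sheaves of modules over the sheaf of commutative rings `O`. -/
abbrev ModuleSheaf (O : Sheaf (Opens.grothendieckTopology X) CommRingCat.{0}) := SheafOfModules.{0} (ringSheaf O)

variable {O : Sheaf (Opens.grothendieckTopology X) CommRingCat.{0}}
 {OY : Sheaf (Opens.grothendieckTopology Y) CommRingCat.{0}}

/-- The exterior power `⋀^p` of sheaves of `O`-modules: the sheaf associated with `U ↦ ⋀^p M(U)`. -/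
def extPow (p : ℕ) : ModuleSheaf O ⥤ ModuleSheaf O :=
  SheafOfModules.forget (ringSheaf O) ⋙ extPresheafFunctor (O := O.obj) p ⋙ sheafifyModules (ringSheaf O)

/-- The Koszul differential `⋀^(p+1) E → ⋀^p E` of a cosection `s : E → O`, given on sections by
`e₀ ∧ ⋯ ∧ e_p ↦ ∑ i, (-1)^i s(e_i) e₀ ∧ ⋯ ∧ ê_i ∧ ⋯ ∧ e_p`. -/
def koszulD {E : ModuleSheaf O} (s : E ⟶ SheafOfModules.unit (ringSheaf O)) (p : ℕ) :
   (extPow (p+1)).obj E ⟶ (extPow p).obj E :=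
  (sheafifyModules (ringSheaf O)).map (contractPresheaf (O := O.obj) s.val p)

/-- The Koszul complex `Sym(E[1])` of a cosection `s : E → O`. It is indexed homologically: `⋀^p E` sits
in homological degree `p`, that is, in cohomological degree `-p`. -/
def koszul {E : ModuleSheaf O} (s : E ⟶ SheafOfModules.unit (ringSheaf O)) : ChainComplex (ModuleSheaf O) ℕ :=
  ChainComplex.of (fun p => (extPow p).obj E) (koszulD s) fun p => by
    refine ((sheafifyModules (ringSheaf O)).map_comp _ _).symm.trans ?_
    exact (congrArg (sheafifyModules (ringSheaf O)).map (contractPresheaf_comp (O := O.obj) s.val p)).trans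
      ((sheafifyModules (ringSheaf O)).map_zero _ _)

theorem pushforward_isRightAdjoint {R : (Opens X)ᵒᵖ ⥤ RingCat.{0}} {S : (Opens Y)ᵒᵖ ⥤ RingCat.{0}}
    (f : X ⟶ Y)
   (φ : S ⟶ (Opens.map f).op ⋙ R) : (PresheafOfModules.pushforward.{0} φ).IsRightAdjoint := inferInstance

instance (f : X ⟶ Y) {R : Sheaf (Opens.grothendieckTopology X) RingCat.{0}} {S : Sheaf (Opens.grothendieckTopology Y) RingCat.{0}}
    (φ : S ⟶ ((Opens.map f).sheafPushforwardContinuous _ _ _).obj R) : (SheafOfModules.pushforward.{0} φ).IsRightAdjoint :=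
 have : (PresheafOfModules.pushforward.{0} φ.hom).IsRightAdjoint := pushforward_isRightAdjoint f φ.hom
 inferInstance

/-- The morphism of ringed spaces given by `f` and `φ : O_Y → f_* O`, with the rings viewed as
noncommutative ones. -/
def toRingHom (f : X ⟶ Y) (φ : OY ⟶ ((Opens.map f).sheafPushforwardContinuous _ _ _).obj O) :
  ringSheaf OY ⟶ ((Opens.map f).sheafPushforwardContinuous _ _ _).obj (ringSheaf O) :=
 ⟨Functor.whiskerRight φ.hom (forget₂ CommRingCat RingCat)⟩

/-- The direct image functor of sheaves of modules along a morphism `(f, φ)` of ringed spaces. -/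
def pushFunctor (f : X ⟶ Y) (φ : OY ⟶ ((Opens.map f).sheafPushforwardContinuous _ _ _).obj O) : ModuleSheaf O ⥤ ModuleSheaf OY :=
  SheafOfModules.pushforward (toRingHom f φ)

instance (f : X ⟶ Y) (φ : OY ⟶ ((Opens.map f).sheafPushforwardContinuous _ _ _).obj O) : (pushFunctor f φ).IsRightAdjoint :=
  inferInstanceAs (SheafOfModules.pushforward (toRingHom f φ)).IsRightAdjoint

/-- The inverse image functor of sheaves of modules along a morphism `(f, φ)` of ringed spaces. -/
def pullFunctor (f : X ⟶ Y) (φ : OY ⟶ ((Opens.map f).sheafPushforwardContinuous _ _ _).obj O) : ModuleSheaf OY ⥤ ModuleSheaf O :=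
  SheafOfModules.pullback (toRingHom f φ)

/-- The adjunction between inverse and direct image. -/
def pullPushAdj (f : X ⟶ Y) (φ : OY ⟶ ((Opens.map f).sheafPushforwardContinuous _ _ _).obj O) : pullFunctor f φ ⊣ pushFunctor f φ :=
  SheafOfModules.pullbackPushforwardAdjunction (toRingHom f φ)

instance  (f : X ⟶ Y) (φ : OY ⟶ ((Opens.map f).sheafPushforwardContinuous _ _ _).obj O) : (pushFunctor f φ).Additive where
  map_add := rfl
instance  (f : X ⟶ Y) (φ : OY ⟶ ((Opens.map f).sheafPushforwardContinuous _ _ _).obj O) : (pullFunctor f φ).Additive :=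
  (pullPushAdj f φ).left_adjoint_additive

variable (f : X ⟶ Y) (φ : OY ⟶ ((Opens.map f).sheafPushforwardContinuous _ _ _).obj O)

/-- The morphism `⋀^p E → f_* ⋀^p G`, `e₁ ∧ ⋯ ∧ e_p ↦ u e₁ ∧ ⋯ ∧ u e_p`, induced by `u : E → f_* G`. -/
def extPowPush {E : ModuleSheaf OY} {G : ModuleSheaf O} (u : E ⟶ (pushFunctor f φ).obj G) (p : ℕ) :
    (extPow p).obj E ⟶ (pushFunctor f φ).obj ((extPow p).obj G) :=
  ((sheafifyModulesAdj (ringSheaf OY)).homEquiv (extPresheaf (O := OY.obj) p E.val) _).symm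
    (extPush (O := OY.obj) (O' := O.obj) (F := Opens.map f) φ.hom u.val p ≫
      (PresheafOfModules.pushforward (toRingHom f φ).hom).map ((sheafifyModulesAdj (ringSheaf O)).unit.app (extPresheaf (O := O.obj) p G.val)))

/-- The canonical morphism `f^* ⋀^p E → ⋀^p f^* E`. -/
def pullExtPow (p : ℕ) (E : ModuleSheaf OY) :
   (pullFunctor f φ).obj ((extPow p).obj E) ⟶ (extPow p).obj ((pullFunctor f φ).obj E) :=
  ((pullPushAdj f φ).homEquiv _ _).symm (extPowPush f φ ((pullPushAdj f φ).unit.app E) p)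

end Sheaf

section Hom
variable {C D : Type*} [Category* C] [Category* D] [Abelian C] [Abelian D] {L : C ⥤ D} {R : D ⥤ C}
  (adj : L ⊣ R) [L.Additive] {ι : Type*} {c : ComplexShape ι} (K : HomologicalComplex C c) (p : ι)

/-- The morphism `L(Z_p(K)) → Z_p(L(K))`. -/
def cyclesComparison :
    L.obj (K.cycles p) ⟶ ((L.mapHomologicalComplex c).obj K).cycles p :=
  ((L.mapHomologicalComplex c).obj K).liftCycles (L.map (K.iCycles p)) (c.next p) rfl (by
    exact (L.map_comp _ _).symm.trans (by rw [K.iCycles_d, L.map_zero]; rfl))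

theorem toCycles_cyclesComparison :
    L.map (K.toCycles (c.prev p) p) ≫ cyclesComparison (L := L) K p =
      ((L.mapHomologicalComplex c).obj K).toCycles (c.prev p) p := by
  refine (cancel_mono (((L.mapHomologicalComplex c).obj K).iCycles p)).1 ?_
  refine (Category.assoc _ _ _).trans ?_
  refine (congrArg _ (HomologicalComplex.liftCycles_i _ _ _ _ _)).trans ?_
  refine (L.map_comp _ _).symm.trans ?_
  refine Eq.trans ?_ (HomologicalComplex.toCycles_i ((L.mapHomologicalComplex c).obj K) (c.prev p) p).symm
  exact congrArg L.map (K.toCycles_i _ _)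

/-- The canonical morphism `L(H_p(K)) → H_p(L(K))`, for a left adjoint functor `L`. It is induced by
`L(Z_p(K)) → Z_p(L(K))`, see `map_homologyπ_homologyComparison`. -/
def homologyComparison :
    L.obj (K.homology p) ⟶ ((L.mapHomologicalComplex c).obj K).homology p :=
  (adj.homEquiv _ _).symm ((K.homologyIsCokernel (c.prev p) p rfl).desc
    (CokernelCofork.ofπ (adj.homEquiv _ _
      (cyclesComparison K p ≫ ((L.mapHomologicalComplex c).obj K).homologyπ p)) (by
        rw [← adj.homEquiv_naturality_left, ← Category.assoc, toCycles_cyclesComparison]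
        refine (congrArg _ (HomologicalComplex.toCycles_comp_homologyπ _ _ _)).trans ?_
        have := adj.right_adjoint_additive
        exact (adj.homEquiv_unit (f := 0)).trans (by rw [Functor.map_zero, comp_zero]))))

theorem map_homologyπ_homologyComparison :
    L.map (K.homologyπ p) ≫ homologyComparison adj K p =
      cyclesComparison K p ≫ ((L.mapHomologicalComplex c).obj K).homologyπ p := by
  rw [homologyComparison, ← adj.homEquiv_naturality_left_symm, Equiv.symm_apply_eq]
  exact (K.homologyIsCokernel (c.prev p) p rfl).fac _ WalkingParallelPair.one

end Hom

section Cosection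
variable {X Y : TopCat.{0}} {O : Sheaf (Opens.grothendieckTopology X) CommRingCat.{0}}
variable (O) in
/-- The structure sheaf, as a module over itself. -/
abbrev structureModule : ModuleSheaf O := SheafOfModules.unit (ringSheaf O)

/-- The presheaf of rings underlying a sheaf of rings. -/
abbrev underlyingPresheaf (O : Sheaf (Opens.grothendieckTopology X) CommRingCat.{0}) :
  TopCat.Presheaf CommRingCat.{0} X := O.obj

/-- The stalk `O_x`. -/
abbrev stalkRing (O : Sheaf (Opens.grothendieckTopology X) CommRingCat.{0}) (x : X) : CommRingCat.{0} :=
  TopCat.Presheaf.stalk (underlyingPresheaf O) x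

/-- The restriction `O|_U` to an open subset `U`. -/
def restrictSheaf (O : Sheaf (Opens.grothendieckTopology X) CommRingCat.{0}) (U : Opens X) :
    Sheaf (Opens.grothendieckTopology ((Opens.toTopCat X).obj U)) CommRingCat.{0} :=
  haveI := U.isOpenEmbedding.functor_isContinuous
  (U.isOpenEmbedding.isOpenMap.functor.sheafPushforwardContinuous CommRingCat
     (Opens.grothendieckTopology ((Opens.toTopCat X).obj U)) (Opens.grothendieckTopology X)).obj O

/-- The restriction `M ↦ M|_U` of sheaves of modules to an open subset `U`. -/
def restr (U : Opens X) : ModuleSheaf O ⥤ ModuleSheaf (restrictSheaf O U) :=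
  haveI := U.isOpenEmbedding.functor_isContinuous
  SheafOfModules.pushforward (F := U.isOpenEmbedding.isOpenMap.functor) (R := ringSheaf O) (S := ringSheaf (restrictSheaf O U))
   ⟨𝟙 _⟩
instance (U : Opens X) : (restr (O := O) U).Additive where map_add := rfl

/-- The restriction of the structure sheaf is the structure sheaf. -/
def restrUnit (U : Opens X) : (restr U).obj (structureModule O) ≅ structureModule (restrictSheaf O U) := Iso.refl _

/-- The restriction `s|_U : E|_U → O|_U` of a cosection. -/
def restrCosection {E : ModuleSheaf O} (s : E ⟶ structureModule O) (U : Opens X) :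
    (restr U).obj E ⟶ structureModule (restrictSheaf O U) := (restr U).map s ≫ (restrUnit U).hom

/-- The sections `e₁, …, e_d` of `E` over `U` form a local frame: they induce `(O|_U)^d ≅ E|_U`. -/
def IsLocalFrame (E : ModuleSheaf O) (U : Opens X) {d : ℕ} (e : Fin d → E.val.obj (op U)) : Prop :=
  ∀ (V : Opens X) (h : V ≤ U), Function.Bijective
    (fun a : Fin d → (ringSheaf O).obj.obj (op V) => ∑ i, a i • E.val.map (homOfLE h).op (e i))

/-- `E` is (the sheaf of sections of) a vector bundle: it has local frames. -/
def IsVectorBundle (E : ModuleSheaf O) : Prop :=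
  ∀ x : X, ∃ (U : Opens X) (_ : x ∈ U) (d : ℕ) (e : Fin d → E.val.obj (op U)), IsLocalFrame E U e

/-- `E` is (the sheaf of sections of) a vector bundle of rank `r`. -/
def IsVectorBundleOfRank (E : ModuleSheaf O) (r : ℕ) : Prop :=
  ∀ x : X, ∃ (U : Opens X) (_ : x ∈ U) (e : Fin r → E.val.obj (op U)), IsLocalFrame E U e

/-- The function `s(e)` on `U`, for a section `e` of `E` over `U`. -/
def evalCosection {E : ModuleSheaf O} (s : E ⟶ structureModule O) {U : Opens X} (e : E.val.obj (op U)) : O.obj.obj (op U) :=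
  s.val.app (op U) e

/-- The stalk at `x` of the ideal sheaf `s(E)`. -/
def imageStalk {E : ModuleSheaf O} (s : E ⟶ structureModule O) (x : X) : Ideal (stalkRing O x) :=
  Ideal.span {a | ∃ (U : Opens X) (hx : x ∈ U) (e : E.val.obj (op U)),
    a = TopCat.Presheaf.germ (underlyingPresheaf O) U x hx (evalCosection s e)}

/-- The zero locus of `s`, i.e. the support of `O / s(E)`. -/
def zeroLocus {E : ModuleSheaf O} (s : E ⟶ structureModule O) : Set X := {x | imageStalk s x ≠ ⊤}

/-- `s` is a regular cosection: at each point `x` of its zero locus, the components of `s` in a local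
frame form a regular sequence in the local ring `O_x`. -/
def IsRegularCosection {E : ModuleSheaf O} (s : E ⟶ structureModule O) : Prop :=
  ∀ x ∈ zeroLocus s, ∃ (U : Opens X) (hx : x ∈ U) (d : ℕ) (e : Fin d → E.val.obj (op U)),
    IsLocalFrame E U e ∧ RingTheory.Sequence.IsRegular (stalkRing O x)
      (List.ofFn fun i => TopCat.Presheaf.germ (underlyingPresheaf O) U x hx (evalCosection s (e i)))

/-- Each point of the zero locus has a neighbourhood `U` on which `s` factors as `E|_U ↠ E' → O|_U`,
with `E'` a vector bundle and `E' → O|_U` regular. As the first map is surjective, the second one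
takes its values in the ideal sheaf `s(E)|_U` automatically. -/
def HasRegularFactorizations {E : ModuleSheaf O} (s : E ⟶ structureModule O) : Prop :=
  ∀ t ∈ zeroLocus s, ∃ (U : Opens X) (_ : t ∈ U) (E' : ModuleSheaf (restrictSheaf O U))
    (π : (restr U).obj E ⟶ E') (s' : E' ⟶ structureModule (restrictSheaf O U)),
    IsVectorBundle E' ∧ Epi π ∧ π ≫ s' = restrCosection s U ∧ IsRegularCosection s'

/-- The ideal `s(E(U))` of `O(U)`. -/
def sectIdeal {E : ModuleSheaf O} (s : E ⟶ structureModule O) (U : (Opens X)ᵒᵖ) : Ideal (O.obj.obj U) where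
  carrier := Set.range (evalCosection s (U := U.unop))
  zero_mem' := ⟨0, map_zero (s.val.app U).hom⟩
  add_mem' := by
    rintro _ _ ⟨a, rfl⟩ ⟨b, rfl⟩
    exact ⟨a + b, map_add (s.val.app U).hom a b⟩
  smul_mem' := by
    rintro r _ ⟨a, rfl⟩
    let r' : (ringSheaf O).obj.obj U := r
    exact ⟨r' • a, map_smul (s.val.app U).hom r' a⟩

theorem sectIdeal_le {E : ModuleSheaf O} (s : E ⟶ structureModule O) {U V : (Opens X)ᵒᵖ} (i : U ⟶ V) :
  sectIdeal s U ≤ (sectIdeal s V).comap (O.obj.map i).hom := by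
    rintro _ ⟨a, rfl⟩
    exact ⟨E.val.map i a, PresheafOfModules.naturality_apply s.val i a⟩

/-- The presheaf of rings `U ↦ O(U) / s(E(U))`, whose associated sheaf is `O / s(E)`. -/
def quotientPresheaf {E : ModuleSheaf O} (s : E ⟶ structureModule O) : (Opens X)ᵒᵖ ⥤ CommRingCat.{0} where
  obj U := CommRingCat.of (O.obj.obj U ⧸ sectIdeal s U)
  map i := CommRingCat.ofHom (Ideal.quotientMap _ (O.obj.map i).hom (sectIdeal_le s i))
  map_id U := by
    refine CommRingCat.hom_ext (Ideal.Quotient.ringHom_ext (RingHom.ext fun x => ?_))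
    simp
  map_comp i j := by
    refine CommRingCat.hom_ext (Ideal.Quotient.ringHom_ext (RingHom.ext fun x => ?_))
    simp

/-- The projections `O(U) → O(U) / s(E(U))`. -/
def toQuotient {E : ModuleSheaf O} (s : E ⟶ structureModule O) : O.obj ⟶ quotientPresheaf s where
  app U := CommRingCat.ofHom (Ideal.Quotient.mk (sectIdeal s U))

/-- The space `T` underlying the vanishing locus of `s`. -/
def VanishingLocus {E : ModuleSheaf O} (s : E ⟶ structureModule O) : TopCat.{0} := TopCat.of (zeroLocus s)

/-- The inclusion `j : T → X`. -/
def incl {E : ModuleSheaf O} (s : E ⟶ structureModule O) : VanishingLocus s ⟶ X := TopCat.ofHom ⟨Subtype.val, continuous_subtype_val⟩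

/-- The structure sheaf `O_T = j⁻¹(O / s(E))` of the vanishing locus. -/
def vanishingSheaf {E : ModuleSheaf O} (s : E ⟶ structureModule O) : Sheaf (Opens.grothendieckTopology (VanishingLocus s)) CommRingCat.{0} :=
  (presheafToSheaf _ CommRingCat.{0}).obj ((TopCat.Presheaf.pullback CommRingCat.{0} (incl s)).obj (quotientPresheaf s))

/-- The morphism `O → j_* O_T`, which makes `j` a morphism of ringed spaces. -/
def inclRingHom {E : ModuleSheaf O} (s : E ⟶ structureModule O) : O ⟶ ((Opens.map (incl s)).sheafPushforwardContinuous _ _ _).obj (vanishingSheaf s) :=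
  ⟨toQuotient s ≫ (TopCat.Presheaf.pullbackPushforwardAdjunction CommRingCat.{0} (incl s)).unit.app (quotientPresheaf s) ≫
    Functor.whiskerLeft (Opens.map (incl s)).op (toSheafify (Opens.grothendieckTopology (VanishingLocus s)) ((TopCat.Presheaf.pullback CommRingCat.{0} (incl s)).obj (quotientPresheaf s)))⟩
end Cosection

section ZeroDifferential
variable {C : Type*} [Category* C] [Abelian C]

/-- The complex with terms `A p` and with zero differentials. -/
def zeroDifferential (A : ℕ → C) : ChainComplex C ℕ where
  X := A
  d _ _ := 0

/-- The canonical identification `H_p = A p` for a complex with zero differentials. -/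
def zeroDifferentialHomology (A : ℕ → C) (p : ℕ) : (zeroDifferential A).homology p ≅ A p :=
  ((zeroDifferential A).isoHomologyπ _ p rfl rfl).symm ≪≫ (zeroDifferential A).iCyclesIso p _ rfl rfl
end ZeroDifferential

section Excess
variable {X : TopCat.{0}} {O : Sheaf (Opens.grothendieckTopology X) CommRingCat.{0}}

/-- The complex `Sym(F[1])` with zero differentials; `⋀^p F` sits in homological degree `p`. -/
def symShift (F : ModuleSheaf O) : ChainComplex (ModuleSheaf O) ℕ := zeroDifferential fun p => (extPow p).obj F

/-- Each point has a neighbourhood `U` with a quasi-isomorphism `K|_U → L|_U`. -/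
def LocallyQuasiIso (K L : ChainComplex (ModuleSheaf O) ℕ) : Prop :=
  ∀ x : X, ∃ (U : Opens X) (_ : x ∈ U)
    (f : ((restr U).mapHomologicalComplex _).obj K ⟶ ((restr U).mapHomologicalComplex _).obj L),
    QuasiIso f

variable {E : ModuleSheaf O} (s : E ⟶ structureModule O)

/-- The restriction `M ↦ M|_T = j^* M` to the vanishing locus of `s`. -/
abbrev restrictToT : ModuleSheaf O ⥤ ModuleSheaf (vanishingSheaf s) := pullFunctor (incl s) (inclRingHom s)

/-- The direct image `j_*` from the vanishing locus of `s`. -/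
abbrev pushFromT : ModuleSheaf (vanishingSheaf s) ⥤ ModuleSheaf O := pushFunctor (incl s) (inclRingHom s)
instance : (restrictToT s).Additive := inferInstanceAs (pullFunctor (incl s) (inclRingHom s)).Additive
instance : (pushFromT s).Additive := inferInstanceAs (pushFunctor (incl s) (inclRingHom s)).Additive

/-- The conormal sheaf `N^∨ = j^* I_T = I_T / I_T²` of the vanishing locus, where `I_T = s(E)`. -/
def conormal : ModuleSheaf (vanishingSheaf s) := (restrictToT s).obj (image s)

/-- The morphism `E|_T → N^∨` induced by `s : E → I_T`. -/
def toConormal : (restrictToT s).obj E ⟶ conormal s := (restrictToT s).map (factorThruImage s)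

/-- The excess bundle, i.e. the kernel of `E|_T → N^∨`. -/
def excess : ModuleSheaf (vanishingSheaf s) := kernel (toConormal s)

/-- The inclusion of the excess bundle in `E|_T`. -/
def excessInclusion : excess s ⟶ (restrictToT s).obj E := kernel.ι (toConormal s)

/-- The restriction to `T` of the Koszul complex of `s`. -/
def koszulOnT : ChainComplex (ModuleSheaf (vanishingSheaf s)) ℕ := ((restrictToT s).mapHomologicalComplex _).obj (koszul s)

/-- The complex `j_* Sym(N[1])` with zero differentials, where `N` is the excess bundle. -/
def pushSymExcess : ChainComplex (ModuleSheaf O) ℕ :=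
  ((pushFromT s).mapHomologicalComplex _).obj (symShift (excess s))

/-- The composite `H_p(K)|_T → H_p(K|_T) ≅ ⋀^p E|_T`, where `K` is the Koszul complex of `s` and the
isomorphism comes from an isomorphism `K|_T ≅ Sym(E|_T[1])` of complexes. -/
def homologyRestriction (Φ : koszulOnT s ≅ symShift ((restrictToT s).obj E)) (p : ℕ) :
    (restrictToT s).obj ((koszul s).homology p) ⟶ (extPow p).obj ((restrictToT s).obj E) :=
  homologyComparison (pullPushAdj (incl s) (inclRingHom s)) (koszul s) p ≫
    HomologicalComplex.homologyMap Φ.hom p ≫ (zeroDifferentialHomology _ p).hom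
end Excess

section Manifold
open scoped Manifold ContDiff

/-- The sheaf of holomorphic functions on a complex manifold. Over `ℂ`, being `C^∞` (or even `C^1`) is
being holomorphic. -/
def holomorphicSheaf (n : ℕ) (Y : Type) [TopologicalSpace Y] [ChartedSpace (EuclideanSpace ℂ (Fin n)) Y] :
    Sheaf (Opens.grothendieckTopology (TopCat.of Y)) CommRingCat.{0} :=
  smoothSheafCommRing 𝓘(ℂ, EuclideanSpace ℂ (Fin n)) 𝓘(ℂ) Y ℂ

variable {n : ℕ} {Y : Type} [TopologicalSpace Y] [ChartedSpace (EuclideanSpace ℂ (Fin n)) Y]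

/-- The differential at `t` of a holomorphic function on `U`. -/
def holomorphicDifferential {U : Opens Y} (f : (holomorphicSheaf n Y).obj.obj (op U)) (t : U) : EuclideanSpace ℂ (Fin n) →L[ℂ] ℂ :=
  let g : C^∞⟮𝓘(ℂ, EuclideanSpace ℂ (Fin n)), U; 𝓘(ℂ), ℂ⟯ := f
  mfderiv 𝓘(ℂ, EuclideanSpace ℂ (Fin n)) 𝓘(ℂ) g t

/-- The vanishing locus of `s`, with its analytic structure, is smooth: near each of its points, its
ideal is generated by functions whose differentials at that point are linearly independent. -/
def HasSmoothZeroLocus {E : ModuleSheaf (holomorphicSheaf n Y)} (s : E ⟶ structureModule (holomorphicSheaf n Y)) : Prop :=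
  ∀ t ∈ zeroLocus s, ∃ (U : Opens Y) (ht : t ∈ U) (c : ℕ) (f : Fin c → (holomorphicSheaf n Y).obj.obj (op U)),
    LinearIndependent ℂ (fun i => holomorphicDifferential (f i) ⟨t, ht⟩) ∧
    imageStalk s t = Ideal.span (Set.range fun i => TopCat.Presheaf.germ (underlyingPresheaf (holomorphicSheaf n Y)) U t ht (f i))

/-- A cosection is weakly regular if its vanishing locus is smooth and if it factors locally, near each
zero, as a surjection onto a vector bundle followed by a regular cosection. -/
def IsWeaklyRegular {E : ModuleSheaf (holomorphicSheaf n Y)} (s : E ⟶ structureModule (holomorphicSheaf n Y)) : Prop := HasSmoothZeroLocus s ∧ HasRegularFactorizations s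
end Manifold
end Koszul

end

open Koszul
open scoped Manifold ContDiff

/-! Near a zero of `s`, a frame of the bundle on which the cosection is regular is lifted to
sections `x i` of `E`. The coordinates of the surjection give dual linear forms `θ i`, with `s = ∑
s(x i) θ i`. So `E` is the sum of a free part spanned by the `x i` and the common kernel `G` of the
`θ i`, and the Koszul complex is that of the sequence `s(x i)` tensored with the exterior algebra of
`G`. As the sequence is regular, every cycle is a boundary plus an element of `⋀^p G`
(`exists_sub_inner`), and an element of `I ⋀^p G` is a boundary (`exists_contract_eq`). Hence `H_p`
is locally `⋀^p G / I ⋀^p G`.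

Regularity also says that the relations between the `s(x i)` have coefficients in `I`
(`apply_mem_span_of_eq_zero`), so that the `s(x i)` are independent in `I / I²`. The kernel of `E|_T
→ I / I²` is therefore the restriction of `G` to `T`: this is the excess bundle (`exists_toExcess`).

The canonical statements follow by comparing everything inside `⋀^p E|_T`. Restricting a cycle to
`T` gives a monomorphism from `H_p` to `j_* ⋀^p E|_T` (`mono_homologyToPush`). The inclusion of the
excess bundle gives another one, from `j_* ⋀^p N` (`mono_extPow_excessInclusion`). Both have locally
the same sections as image, so the sources are isomorphic over the target (`exists_homology_iso`).
The local quasi-isomorphism is `⋀^p` of the projection `E → N` with kernel direction `x i`; on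
cycles it agrees with restriction to `T` (`toExt_toTrace_eq`). Away from `T`, `s` takes the value
`1`, which contracts the Koszul complex, and `j_*` of any sheaf is zero.

The arguments are made with local sections. The inverse image `j^*` is known only as a left adjoint:
its sections come locally from sections on `Y` (`exists_eta`), and their vanishing is tested by
morphisms to skyscraper sheaves (`exists_extension`). Regularity is an assumption on stalks; the
resulting identities in exterior powers of free modules have finitely many coordinates and spread to
neighbourhoods. -/

noncomputable section

namespace Koszul

/-! ### Sheaves of modules through their sections. -/

section Sections

variable {X : TopCat.{0}} {O : Sheaf (Opens.grothendieckTopology X) CommRingCat.{0}}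

variable (O) in
/-- The ring of functions `O(V)`. -/
abbrev Fn (V : Opens X) : Type := O.obj.obj (op V)

/-- The group of sections `M(V)`. -/
def Sec (M : ModuleSheaf O) (V : Opens X) : Type := M.val.obj (op V)

instance (M : ModuleSheaf O) (V : Opens X) : AddCommGroup (Sec M V) :=
  inferInstanceAs (AddCommGroup (M.val.obj (op V)))

instance (M : ModuleSheaf O) (V : Opens X) : Module (Fn O V) (Sec M V) :=
  (M.val.obj (op V)).isModule

variable (O) in
/-- The restriction of functions. -/
def fres {V W : Opens X} (h : W ≤ V) : Fn O V →+* Fn O W := (O.obj.map (homOfLE h).op).hom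

/-- The restriction of sections. -/
def res (M : ModuleSheaf O) {V W : Opens X} (h : W ≤ V) : Sec M V →ₛₗ[fres O h] Sec M W :=
  M.val.restrictₛₗ (homOfLE h).op

theorem fres_self {V : Opens X} (h : V ≤ V) (a : Fn O V) : fres O h a = a := by
  simp [fres]

theorem fres_fres {U V W : Opens X} (h : V ≤ U) (k : W ≤ V) (a : Fn O U) :
    fres O k (fres O h a) = fres O (k.trans h) a := by
  have : (homOfLE (k.trans h)).op = (homOfLE h).op ≫ (homOfLE k).op := rfl
  simp [fres, this]

theorem res_self {M : ModuleSheaf O} {V : Opens X} (h : V ≤ V) (a : Sec M V) : res M h a = a := by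
  have key : ∀ a : M.val.obj (op V), M.val.map (𝟙 (op V)) a = a := fun a => by
    rw [M.val.map_id]
    rfl
  exact key a

theorem res_res {M : ModuleSheaf O} {U V W : Opens X} (h : V ≤ U) (k : W ≤ V) (a : Sec M U) :
    res M k (res M h a) = res M (k.trans h) a :=
  (M.val.map_comp_apply (homOfLE h).op (homOfLE k).op a).symm

/-- The map on sections of a morphism. -/
def app {M N : ModuleSheaf O} (f : M ⟶ N) (V : Opens X) : Sec M V →ₗ[Fn O V] Sec N V :=
  (f.val.app (op V)).hom

theorem app_res {M N : ModuleSheaf O} (f : M ⟶ N) {V W : Opens X} (h : W ≤ V) (a : Sec M V) :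
    app f W (res M h a) = res N h (app f V a) :=
  PresheafOfModules.naturality_apply f.val (homOfLE h).op a

theorem app_comp {M N P : ModuleSheaf O} (f : M ⟶ N) (g : N ⟶ P) (V : Opens X) (a : Sec M V) :
    app (f ≫ g) V a = app g V (app f V a) := rfl

theorem app_zero {M N : ModuleSheaf O} (V : Opens X) (a : Sec M V) :
    app (0 : M ⟶ N) V a = 0 := rfl

theorem hom_ext_sections {M N : ModuleSheaf O} {f g : M ⟶ N}
    (h : ∀ V (a : Sec M V), app f V a = app g V a) : f = g :=
  SheafOfModules.hom_ext (PresheafOfModules.hom_ext fun V =>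
    ModuleCat.hom_ext (LinearMap.ext (h V.unop)))

/-- A morphism given by its maps on sections. -/
def homOfSections {M N : ModuleSheaf O} (f : ∀ V, Sec M V →ₗ[Fn O V] Sec N V)
    (hf : ∀ {V W : Opens X} (h : W ≤ V) (a : Sec M V), f W (res M h a) = res N h (f V a)) :
    M ⟶ N :=
  ⟨{ app := fun V => ModuleCat.ofHom (R := (ringSheaf O).obj.obj V) (X := M.val.obj V)
      (Y := N.val.obj V) (f V.unop)
     naturality := fun {_ _} g => ModuleCat.hom_ext (LinearMap.ext fun a => hf g.unop.le a) }⟩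

/-- Sections which agree locally are equal. -/
theorem sec_ext {M : ModuleSheaf O} {V : Opens X} {a b : Sec M V}
    (H : ∀ x ∈ V, ∃ (W : Opens X) (h : W ≤ V), x ∈ W ∧ res M h a = res M h b) : a = b := by
  choose W h hx hab using H
  refine TopCat.Sheaf.eq_of_locally_eq' ⟨M.val.presheaf, M.isSheaf⟩ (fun x : V => W x.1 x.2) V
    (fun x => homOfLE (h x.1 x.2)) (fun x hxV => ?_) a b (fun x => hab x.1 x.2)
  exact Opens.mem_iSup.2 ⟨⟨x, hxV⟩, hx x hxV⟩

theorem sec_eq_zero {M : ModuleSheaf O} {V : Opens X} {a : Sec M V}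
    (H : ∀ x ∈ V, ∃ (W : Opens X) (h : W ≤ V), x ∈ W ∧ res M h a = 0) : a = 0 :=
  sec_ext fun x hx => by
    obtain ⟨W, h, hW, e⟩ := H x hx
    exact ⟨W, h, hW, by rw [e, map_zero]⟩

/-- Locally surjective. -/
def LocSurj {M N : ModuleSheaf O} (f : M ⟶ N) : Prop :=
  ∀ (V : Opens X) (b : Sec N V), ∀ x ∈ V, ∃ (W : Opens X) (h : W ≤ V) (a : Sec M W),
    x ∈ W ∧ app f W a = res N h b

theorem mono_of_injective {M N : ModuleSheaf O} (f : M ⟶ N)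
    (H : ∀ V (a : Sec M V), app f V a = 0 → a = 0) : Mono f := by
  refine Preadditive.mono_of_cancel_zero f fun g hg => hom_ext_sections fun V a => ?_
  exact H V _ ((app_comp g f V a).symm.trans (by rw [hg]; rfl))

theorem epi_of_locSurj {M N : ModuleSheaf O} {f : M ⟶ N} (H : LocSurj f) : Epi f := by
  refine Preadditive.epi_of_cancel_zero f fun g hg => hom_ext_sections fun V b => ?_
  refine sec_eq_zero fun x hx => ?_
  obtain ⟨W, h, a, hW, e⟩ := H V b x hx
  refine ⟨W, h, hW, ?_⟩
  rw [← app_res, ← e, ← app_comp, hg]; rfl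

end Sections

/-! ### Exactness in terms of local sections. -/

section Exactness

variable {X : TopCat.{0}} {O : Sheaf (Opens.grothendieckTopology X) CommRingCat.{0}}

theorem sheafify_locally_zero (P : PresheafOfModules.{0} (ringSheaf O).obj) {V : Opens X}
    (a : P.obj (op V))
    (h : ((sheafifyModulesAdj (ringSheaf O)).unit.app P).app (op V) a = 0) {x : X} (hx : x ∈ V) :
    ∃ (W : Opens X) (k : W ≤ V), x ∈ W ∧ P.map (homOfLE k).op a = 0 := by
  let T := toSheafify (Opens.grothendieckTopology X) P.presheaf
  have : Presheaf.IsLocallyInjective (Opens.grothendieckTopology X) T :=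
    Presheaf.isLocallyInjective_toSheafify' _ P.presheaf
  have h0 : T.app (op V) a = T.app (op V) 0 := by
    rw [map_zero]
    exact h
  obtain ⟨W, k, hk, hW⟩ := Presheaf.equalizerSieve_mem (Opens.grothendieckTopology X) T a 0 h0 x hx
  refine ⟨W, k.le, hW, ?_⟩
  exact Eq.trans (b := P.presheaf.map k.op a) rfl (hk.trans (map_zero _))

theorem sheafify_locally_surjective (P : PresheafOfModules.{0} (ringSheaf O).obj) {V : Opens X}
    (b : Sec ((sheafifyModules (ringSheaf O)).obj P) V) {x : X} (hx : x ∈ V) :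
    ∃ (W : Opens X) (k : W ≤ V) (a : P.obj (op W)), x ∈ W ∧
      ((sheafifyModulesAdj (ringSheaf O)).unit.app P).app (op W) a = res _ k b := by
  let T := toSheafify (Opens.grothendieckTopology X) P.presheaf
  have : Presheaf.IsLocallySurjective (Opens.grothendieckTopology X) T :=
    Presheaf.isLocallySurjective_toSheafify' _ P.presheaf
  obtain ⟨W, k, ⟨a, ha⟩, hW⟩ := Presheaf.imageSieve_mem (Opens.grothendieckTopology X) T b x hx
  exact ⟨W, k.le, a, hW, ha⟩

/-- The presheaf of modules given by its modules of sections and its restriction maps. -/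
def presheafOfSections (Q : Opens X → Type) [∀ V, AddCommGroup (Q V)] [i : ∀ V, Module (Fn O V) (Q V)]
    (r : ∀ {V W : Opens X} (h : W ≤ V), Q V →ₛₗ[fres O h] Q W)
    (r_self : ∀ {V : Opens X} (a : Q V), r le_rfl a = a)
    (r_comp : ∀ {U V W : Opens X} (h : V ≤ U) (k : W ≤ V) (a : Q U),
      r (k.trans h) a = r k (r h a)) : PresheafOfModules.{0} (ringSheaf O).obj :=
  letI (V : (Opens X)ᵒᵖ) : Module ((ringSheaf O).obj.obj V) (Q V.unop) := i V.unop
  { obj := fun V => ModuleCat.of ((ringSheaf O).obj.obj V) (Q V.unop)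
    map := fun {V W} f => ModuleCat.semilinearMapAddEquiv ((ringSheaf O).obj.map f).hom
      (ModuleCat.of ((ringSheaf O).obj.obj V) (Q V.unop))
      (ModuleCat.of ((ringSheaf O).obj.obj W) (Q W.unop)) (r f.unop.le)
    map_id := fun _ => ModuleCat.hom_ext (LinearMap.ext fun a => r_self a)
    map_comp := fun f g => ModuleCat.hom_ext
      (LinearMap.ext fun a => r_comp f.unop.le g.unop.le a) }

/-- A family of submodules of the modules of sections which is stable under restriction is, up to
localization, the kernel of a morphism. -/
theorem exists_quotient (M : ModuleSheaf O) (G : ∀ V, Submodule (Fn O V) (Sec M V))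
    (hG : ∀ {V W : Opens X} (h : W ≤ V) (a : Sec M V), a ∈ G V → res M h a ∈ G W) :
    ∃ (C : ModuleSheaf O) (q : M ⟶ C), (∀ V, ∀ a ∈ G V, app q V a = 0) ∧
      ∀ V (a : Sec M V), app q V a = 0 → ∀ x ∈ V,
        ∃ (W : Opens X) (k : W ≤ V), x ∈ W ∧ res M k a ∈ G W := by
  let r {V W : Opens X} (h : W ≤ V) : (Sec M V ⧸ G V) →ₛₗ[fres O h] (Sec M W ⧸ G W) :=
    Submodule.mapQ (G V) (G W) (res M h) fun a ha => hG h a ha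
  let P : PresheafOfModules.{0} (ringSheaf O).obj :=
    presheafOfSections (fun V => Sec M V ⧸ G V) r
      (fun a => by
        obtain ⟨a, rfl⟩ := Submodule.Quotient.mk_surjective _ a
        exact congrArg (Submodule.Quotient.mk (p := G _)) (res_self le_rfl a))
      (fun h k a => by
        obtain ⟨a, rfl⟩ := Submodule.Quotient.mk_surjective _ a
        exact congrArg (Submodule.Quotient.mk (p := G _)) (res_res h k a).symm)
  let π : M.val ⟶ P :=
    { app := fun V => ModuleCat.ofHom (R := (ringSheaf O).obj.obj V) (X := M.val.obj V)
        (Y := P.obj V) (G V.unop).mkQ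
      naturality := fun {_ _} g => ModuleCat.hom_ext (LinearMap.ext fun a => rfl) }
  let η := (sheafifyModulesAdj (ringSheaf O)).unit.app P
  refine ⟨(sheafifyModules (ringSheaf O)).obj P, ⟨π ≫ η⟩, fun V a ha => ?_, fun V a ha x hx => ?_⟩
  · have h : (G V).mkQ a = 0 := (Submodule.Quotient.mk_eq_zero _).2 ha
    exact (congrArg (η.app (op V)) h).trans (map_zero (η.app (op V)).hom)
  · obtain ⟨W, k, hW, e⟩ := sheafify_locally_zero P ((G V).mkQ a) ha hx
    exact ⟨W, k, hW, (Submodule.Quotient.mk_eq_zero _).1 e⟩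

/-- The projection from `N` to its quotient by the presheaf image of `f` vanishes after `f`, so it
is zero because `f` is epi. A section killed by it lies locally in the image. -/
theorem locSurj_of_epi {M N : ModuleSheaf O} (f : M ⟶ N) [Epi f] : LocSurj f := by
  intro V b x hx
  obtain ⟨C, q, h0, h1⟩ := exists_quotient N (fun V => LinearMap.range (app f V)) (by
    rintro V W h _ ⟨a, rfl⟩
    exact ⟨res M h a, app_res f h a⟩)
  have hq : q = 0 := by
    refine (cancel_epi f).1 (hom_ext_sections fun V a => ?_)
    rw [app_comp, h0 V _ ⟨a, rfl⟩, comp_zero, app_zero]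
  obtain ⟨W, k, hW, a, ha⟩ := h1 V b (by rw [hq]; rfl) x hx
  exact ⟨W, k, a, hW, ha⟩

instance (V : (Opens X)ᵒᵖ) : (SheafOfModules.evaluation (ringSheaf O) V).Additive where
  map_add := rfl

theorem injective_of_mono {M N : ModuleSheaf O} (f : M ⟶ N) [Mono f] (V : Opens X) :
    Function.Injective (app f V) := by
  have : Mono ((SheafOfModules.evaluation (ringSheaf O) (op V)).map f) := inferInstance
  exact (ModuleCat.mono_iff_injective _).1 this

theorem exists_of_exact_of_mono {S : ShortComplex (ModuleSheaf O)} (hS : S.Exact) [Mono S.f]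
    {V : Opens X} (a : Sec S.X₂ V) (h : app S.g V a = 0) : ∃ b, app S.f V b = a := by
  have := hS.map_of_mono_of_preservesKernel (SheafOfModules.evaluation (ringSheaf O) (op V))
    inferInstance inferInstance
  exact (ShortComplex.moduleCat_exact_iff _).1 this a h

theorem exists_kernel_section {M N : ModuleSheaf O} (f : M ⟶ N) {V : Opens X} (a : Sec M V)
    (h : app f V a = 0) : ∃ b, app (kernel.ι f) V b = a :=
  exists_of_exact_of_mono (S := ShortComplex.mk (kernel.ι f) f (kernel.condition f))
    (ShortComplex.exact_of_f_is_kernel _ (kernelIsKernel f)) a h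

theorem locally_exists_of_exact {S : ShortComplex (ModuleSheaf O)} (hS : S.Exact)
    {V : Opens X} (a : Sec S.X₂ V) (h : app S.g V a = 0) {x : X} (hx : x ∈ V) :
    ∃ (W : Opens X) (k : W ≤ V) (b : Sec S.X₁ W), x ∈ W ∧ app S.f W b = res S.X₂ k a := by
  have : Epi S.toCycles := S.exact_iff_epi_toCycles.1 hS
  have hex : (ShortComplex.mk S.iCycles S.g S.iCycles_g).Exact :=
    ShortComplex.exact_of_f_is_kernel _ S.cyclesIsKernel
  obtain ⟨z, hz⟩ := exists_of_exact_of_mono hex a h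
  obtain ⟨W, k, b, hW, hb⟩ := locSurj_of_epi S.toCycles V z x hx
  refine ⟨W, k, b, hW, ?_⟩
  rw [← S.toCycles_i, app_comp, hb, app_res]
  exact congrArg _ hz

/-- A morphism whose values locally lie in the image of a monomorphism lifts. -/
theorem exists_lift_of_locally_mem {A B W : ModuleSheaf O} (f : A ⟶ W) (i : B ⟶ W) [Mono i]
    (H : ∀ V (a : Sec A V), ∀ x ∈ V, ∃ (V' : Opens X) (k : V' ≤ V) (b : Sec B V'),
      x ∈ V' ∧ app i V' b = app f V' (res A k a)) : ∃ l : A ⟶ B, l ≫ i = f := by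
  -- A monomorphism is the kernel of its cokernel, so it is enough that `f` dies in the cokernel of
  -- `i`, and this can be checked locally.
  have h0 : f ≫ cokernel.π i = 0 := by
    refine hom_ext_sections fun V a => sec_eq_zero fun x hx => ?_
    obtain ⟨V', k, b, hV', e⟩ := H V a x hx
    refine ⟨V', k, hV', ?_⟩
    rw [← app_res, app_comp, ← e, ← app_comp, cokernel.condition, app_zero]
  have hex : (ShortComplex.mk i (cokernel.π i) (cokernel.condition i)).Exact :=
    ShortComplex.exact_of_g_is_cokernel _ (cokernelIsCokernel i)
  have : Mono (ShortComplex.mk i (cokernel.π i) (cokernel.condition i)).f := ‹Mono i›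
  exact ⟨hex.lift f h0, hex.lift_f f h0⟩

end Exactness

/-! ### Cycles and boundaries as local sections. -/

section Homology

variable {X : TopCat.{0}} {O : Sheaf (Opens.grothendieckTopology X) CommRingCat.{0}}
  (K : ChainComplex (ModuleSheaf O) ℕ) (p : ℕ)

/-- A section of a complex is a cycle. -/
def IsCycle {V : Opens X} (z : Sec (K.X p) V) : Prop := ∀ q, app (K.d p q) V z = 0

theorem isCycle_iCycles {V : Opens X} (z : Sec (K.cycles p) V) :
    IsCycle K p (app (K.iCycles p) V z) := fun q => by
  rw [← app_comp, K.iCycles_d, app_zero]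

theorem exists_cycle {V : Opens X} (z : Sec (K.X p) V) (hz : IsCycle K p z) :
    ∃ z', app (K.iCycles p) V z' = z := by
  have hex : (ShortComplex.mk (K.iCycles p) (K.d p _) (K.iCycles_d p _)).Exact :=
    ShortComplex.exact_of_f_is_kernel _ (K.cyclesIsKernel p _ rfl)
  have : Mono (ShortComplex.mk (K.iCycles p) (K.d p _)
      (K.iCycles_d p ((ComplexShape.down ℕ).next p))).f :=
    inferInstanceAs (Mono (K.iCycles p))
  exact exists_of_exact_of_mono hex z (hz _)

theorem homologyπ_eq_zero_of_boundary {V : Opens X} (z : Sec (K.cycles p) V)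
    (h : ∀ x ∈ V, ∃ (W : Opens X) (k : W ≤ V) (w : Sec (K.X (p + 1)) W), x ∈ W ∧
      app (K.d (p + 1) p) W w = res _ k (app (K.iCycles p) V z)) :
    app (K.homologyπ p) V z = 0 := by
  refine sec_eq_zero fun x hx => ?_
  obtain ⟨W, k, w, hW, e⟩ := h x hx
  refine ⟨W, k, hW, ?_⟩
  have : res _ k z = app (K.toCycles (p + 1) p) W w := by
    refine injective_of_mono (K.iCycles p) W ?_
    rw [app_res, ← e, ← app_comp, K.toCycles_i]
  rw [← app_res, this, ← app_comp, K.toCycles_comp_homologyπ, app_zero]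

theorem boundary_of_homologyπ_eq_zero {V : Opens X} (z : Sec (K.cycles p) V)
    (h : app (K.homologyπ p) V z = 0) {x : X} (hx : x ∈ V) :
    ∃ (W : Opens X) (k : W ≤ V) (w : Sec (K.X (p + 1)) W), x ∈ W ∧
      app (K.d (p + 1) p) W w = res _ k (app (K.iCycles p) V z) := by
  have hex : (ShortComplex.mk (K.toCycles (p + 1) p) (K.homologyπ p)
      (K.toCycles_comp_homologyπ _ _)).Exact :=
    ShortComplex.exact_of_g_is_cokernel _ (K.homologyIsCokernel (p + 1) p (by simp))
  obtain ⟨W, k, w, hW, e⟩ := locally_exists_of_exact hex z h hx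
  refine ⟨W, k, w, hW, ?_⟩
  rw [← app_res, ← K.toCycles_i (p + 1) p, app_comp]
  exact congrArg (app (K.iCycles p) W) e

end Homology

/-! ### Koszul cycles of a regular sequence in the exterior algebra. -/

section ExteriorAlgebra

open ExteriorAlgebra

variable {R M : Type*} [CommRing R] [AddCommGroup M] [Module R M]

/-- Contraction of the exterior algebra with a linear form. -/
abbrev inner (φ : Module.Dual R M) : ExteriorAlgebra R M →ₗ[R] ExteriorAlgebra R M :=
  CliffordAlgebra.contractLeft (Q := (0 : QuadraticForm R M)) φ

theorem inner_ι_mul (φ : Module.Dual R M) (m : M) (y : ExteriorAlgebra R M) :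
    inner φ (ι R m * y) = φ m • y - ι R m * inner φ y :=
  CliffordAlgebra.contractLeft_ι_mul φ m y

theorem inner_inner (φ : Module.Dual R M) (y : ExteriorAlgebra R M) :
    inner φ (inner φ y) = 0 :=
  CliffordAlgebra.contractLeft_contractLeft φ y

theorem inner_comm (φ ψ : Module.Dual R M) (y : ExteriorAlgebra R M) :
    inner φ (inner ψ y) = -inner ψ (inner φ y) :=
  CliffordAlgebra.contractLeft_comm φ ψ y

theorem inner_add (φ ψ : Module.Dual R M) (y : ExteriorAlgebra R M) :
    inner (φ + ψ) y = inner φ y + inner ψ y := by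
  simp [inner]

theorem inner_smul (a : R) (φ : Module.Dual R M) (y : ExteriorAlgebra R M) :
    inner (a • φ) y = a • inner φ y := by
  simp [inner]

theorem inner_sum_eq_zero {ι' : Type*} (t : Finset ι') (f : ι' → R) (θ : ι' → Module.Dual R M)
    (y : ExteriorAlgebra R M) (h : ∀ i ∈ t, inner (θ i) y = 0) :
    inner (∑ i ∈ t, f i • θ i) y = 0 := by
  rw [inner, map_sum, LinearMap.sum_apply]
  refine Finset.sum_eq_zero fun i hi => ?_
  rw [map_smul, LinearMap.smul_apply]
  exact (congrArg _ (h i hi)).trans (smul_zero _)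

/-- Naturality of contraction. It is used mostly when `φ ∘ₗ g = 0`, to see that `φ` kills the image
of `map g`. -/
theorem inner_map (g : M →ₗ[R] M) (φ : Module.Dual R M) (y : ExteriorAlgebra R M) :
    inner φ (map g y) = map g (inner (φ ∘ₗ g) y) := by
  induction y using CliffordAlgebra.left_induction with
  | algebraMap r =>
    simp only [inner, AlgHom.commutes, CliffordAlgebra.contractLeft_algebraMap, map_zero]
  | add x y hx hy => simp only [map_add, hx, hy]
  | ι_mul y m h =>
    have e : inner (φ ∘ₗ g) (ι R m * y) = φ (g m) • y - ι R m * inner (φ ∘ₗ g) y :=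
      inner_ι_mul _ _ _
    have e' : inner φ (ι R (g m) * map g y) = φ (g m) • map g y - ι R (g m) * inner φ (map g y) :=
      inner_ι_mul _ _ _
    change inner φ (map g (ι R m * y)) = map g (inner (φ ∘ₗ g) (ι R m * y))
    rw [e, map_mul, map_apply_ι, e', map_sub, map_smul, map_mul, map_apply_ι, h]

theorem ι_mul_ι_mul (x y : M) (a : ExteriorAlgebra R M) :
    ι R x * (ι R y * a) = -(ι R y * (ι R x * a)) := by
  rw [← mul_assoc, ← mul_assoc, ← neg_mul, eq_neg_of_add_eq_zero_left (ι_add_mul_swap x y)]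

theorem ι_mul_ι_mul_self (x : M) (a : ExteriorAlgebra R M) : ι R x * (ι R x * a) = 0 := by
  rw [← mul_assoc, ι_sq_zero, zero_mul]

/-- The endomorphism `m ↦ m - θ(m) x`. -/
def elimination (θ : Module.Dual R M) (x : M) : M →ₗ[R] M := LinearMap.id - θ.smulRight x

/-- When a product of vectors `m - θ(m) x` is expanded, the terms with two factors `x` vanish, and
those with one factor add up to the contraction term. In particular an element killed by `θ` is
fixed. -/
theorem map_elimination (θ : Module.Dual R M) (x : M) (y : ExteriorAlgebra R M) :
    map (elimination θ x) y = y - ι R x * inner θ y := by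
  induction y using CliffordAlgebra.left_induction with
  | algebraMap r =>
    simp only [inner, AlgHom.commutes, CliffordAlgebra.contractLeft_algebraMap, mul_zero, sub_zero]
  | add x y hx hy => simp only [map_add, hx, hy, mul_add]; abel
  | ι_mul y m h =>
    have e : inner θ (ι R m * y) = θ m • y - ι R m * inner θ y := inner_ι_mul _ _ _
    change map (elimination θ x) (ι R m * y) = ι R m * y - ι R x * inner θ (ι R m * y)
    rw [e, map_mul, map_apply_ι, h]
    simp only [elimination, LinearMap.sub_apply, LinearMap.id_apply, LinearMap.smulRight_apply,
      map_sub, map_smul, sub_mul, mul_sub, smul_mul_assoc, mul_smul_comm, ι_mul_ι_mul_self,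
      smul_zero, sub_zero]
    rw [ι_mul_ι_mul m x]
    abel

/-- The projection `m ↦ m - ∑ θᵢ(m) xᵢ`. -/
def complement {ι' : Type*} (t : Finset ι') (θ : ι' → Module.Dual R M) (x : ι' → M) : M →ₗ[R] M :=
  LinearMap.id - ∑ i ∈ t, (θ i).smulRight (x i)

theorem complement_apply {ι' : Type*} (t : Finset ι') (θ : ι' → Module.Dual R M) (x : ι' → M)
    (m : M) : complement t θ x m = m - ∑ i ∈ t, θ i m • x i := by
  simp [complement]

/-- By duality of the `θ i` and the `x i`, the projection is a composite of eliminations of one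
vector at a time, each of which fixes what its form kills. -/
theorem map_complement_eq_self {k : ℕ} {θ : ℕ → Module.Dual R M} {x : ℕ → M}
    (hθ : ∀ i < k, ∀ j < k, θ i (x j) = if i = j then 1 else 0) {y : ExteriorAlgebra R M}
    (hy : ∀ i < k, inner (θ i) y = 0) : map (complement (Finset.range k) θ x) y = y := by
  induction k with
  | zero => simp [complement, map_id]
  | succ k ih =>
    have h : complement (Finset.range (k + 1)) θ x =
        elimination (θ k) (x k) ∘ₗ complement (Finset.range k) θ x := by
      refine LinearMap.ext fun m => ?_
      have h0 : θ k (∑ i ∈ Finset.range k, θ i m • x i) = 0 := by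
        rw [map_sum]
        refine Finset.sum_eq_zero fun i hi => ?_
        have hi' := Finset.mem_range.1 hi
        rw [map_smul, hθ k (by omega) i (by omega), if_neg (by omega), smul_zero]
      simp only [complement_apply, elimination, LinearMap.comp_apply, LinearMap.sub_apply,
        LinearMap.id_apply, LinearMap.smulRight_apply, map_sub (θ k), h0, sub_zero,
        Finset.sum_range_succ]
      abel
    rw [h, ← map_comp_map, AlgHom.comp_apply,
      ih (fun i hi j hj => hθ i (by omega) j (by omega)) fun i hi => hy i (by omega),
      map_elimination, hy k (by omega), mul_zero, sub_zero]

theorem inner_map_complement {k : ℕ} {θ : ℕ → Module.Dual R M} {x : ℕ → M}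
    (hθ : ∀ i < k, ∀ j < k, θ i (x j) = if i = j then 1 else 0) (y : ExteriorAlgebra R M)
    {i : ℕ} (hi : i < k) : inner (θ i) (map (complement (Finset.range k) θ x) y) = 0 := by
  have h : θ i ∘ₗ complement (Finset.range k) θ x = 0 := by
    refine LinearMap.ext fun m => ?_
    rw [LinearMap.comp_apply, complement_apply, map_sub, map_sum, LinearMap.zero_apply,
      Finset.sum_eq_single_of_mem i (Finset.mem_range.2 hi)]
    · simp [hθ i hi i hi]
    · intro j hj hji
      rw [map_smul, hθ i hi j (Finset.mem_range.1 hj), if_neg (Ne.symm hji), smul_zero]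
  rw [inner_map, h]
  simp [inner]

/-- `f` is weakly regular on `F`, in terms of elements. -/
def RegularOn (F : Type*) [AddCommGroup F] [Module R F] (f : ℕ → R) (d : ℕ) : Prop :=
  ∀ k < d, ∀ (n : F) (m : ℕ → F), f k • n = ∑ j ∈ Finset.range k, f j • m j →
    ∃ m' : ℕ → F, n = ∑ j ∈ Finset.range k, f j • m' j

/-- Modulo boundaries, each cycle of the Koszul complex is killed by the `θᵢ`. -/
theorem exists_sub_inner {d : ℕ} {f : ℕ → R} {θ : ℕ → Module.Dual R M} {x : ℕ → M}
    (hθ : ∀ i < d, ∀ j < d, θ i (x j) = if i = j then 1 else 0)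
    (hf : RegularOn (ExteriorAlgebra R M) f d) (z : ExteriorAlgebra R M)
    (hz : inner (∑ i ∈ Finset.range d, f i • θ i) z = 0) :
    ∃ w, ∀ i < d, inner (θ i) (z - inner (∑ i ∈ Finset.range d, f i • θ i) w) = 0 := by
  -- Induction on the number of forms. With `D = s' + f k • θ k`, boundaries are added to `z` until
  -- `θ k` kills it. The result `z₂` is then a cycle for `s'`, to which the induction hypothesis
  -- applies.
  induction d generalizing z with
  | zero => exact ⟨0, fun i hi => absurd hi (by omega)⟩
  | succ k ih =>
    replace ih := ih (fun i hi j hj => hθ i (by omega) j (by omega))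
      fun i hi => hf i (by omega)
    set s' : Module.Dual R M := ∑ i ∈ Finset.range k, f i • θ i with hs'
    have hs : ∑ i ∈ Finset.range (k + 1), f i • θ i = s' + f k • θ k := Finset.sum_range_succ _ _
    rw [hs] at hz ⊢
    have hθx : θ k (x k) = 1 := by rw [hθ k (by omega) k (by omega), if_pos rfl]
    have hs'x : s' (x k) = 0 := by
      rw [hs', LinearMap.sum_apply]
      refine Finset.sum_eq_zero fun i hi => ?_
      have := Finset.mem_range.1 hi
      rw [LinearMap.smul_apply, hθ i (by omega) k (by omega), if_neg (by omega), smul_zero]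
    have hθs' (y : ExteriorAlgebra R M) (hy : inner (θ k) y = 0) :
        inner (θ k) (inner s' y) = 0 := by rw [inner_comm, hy, map_zero, neg_zero]
    have hD (y : ExteriorAlgebra R M) (hy : inner (θ k) y = 0) :
        inner (s' + f k • θ k) (ι R (x k) * y) = f k • y - ι R (x k) * inner s' y := by
      rw [inner_ι_mul, inner_add, inner_smul, hy, smul_zero, add_zero, LinearMap.add_apply, hs'x,
        LinearMap.smul_apply, hθx, smul_eq_mul, mul_one, zero_add]
    have hE (y : ExteriorAlgebra R M) (hy : inner (θ k) y = 0) :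
        inner (θ k) (ι R (x k) * y) = y := by
      rw [inner_ι_mul, hy, mul_zero, sub_zero, hθx, one_smul]
    -- the projection to the kernel of `θ k`
    let P (y : ExteriorAlgebra R M) := y - ι R (x k) * inner (θ k) y
    have hPk (y) : inner (θ k) (P y) = 0 := by
      simp only [P, map_sub]
      rw [hE _ (inner_inner _ _), sub_self]
    have hPs (y) : inner s' (P y) = P (inner s' y) := by
      simp only [P, map_sub]
      rw [inner_ι_mul, hs'x, zero_smul, zero_sub, inner_comm s', mul_neg, neg_neg]
    have hPsub (a b) : P (a - b) = P a - P b := by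
      simp only [P, map_sub, mul_sub]; abel
    have hPeq (y) (hy : inner (θ k) y = 0) : P y = y := by simp only [P, hy, mul_zero, sub_zero]
    have hPi (y) (i : ℕ) (hi : i < k) (hy : inner (θ i) y = 0) : inner (θ i) (P y) = 0 := by
      simp only [P, map_sub, hy]
      rw [inner_ι_mul, hθ i (by omega) k (by omega), if_neg (by omega), inner_comm, hy]
      simp
    -- first step: the contraction with `θ k` becomes a cycle `n₀` killed by all forms
    have hb : inner s' (inner (θ k) z) = 0 := by
      have : inner s' z = -(f k • inner (θ k) z) := by
        rw [inner_add, inner_smul] at hz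
        exact eq_neg_of_add_eq_zero_left hz
      rw [inner_comm, this, map_neg, map_smul, inner_inner]
      simp
    obtain ⟨c, hc⟩ := ih _ hb
    -- Taking `P c` instead of `c` makes `n₀` killed by `θ k` as well as by the earlier forms.
    set n₀ := inner (θ k) z - inner s' (P c) with hn₀
    have hn₀' : n₀ = P (inner (θ k) z - inner s' c) := by
      rw [hPsub, hPeq _ (inner_inner _ _), hn₀, hPs]
    have hn₀i : ∀ i < k, inner (θ i) n₀ = 0 := fun i hi => by
      rw [hn₀']
      exact hPi _ i hi (hc i hi)
    have hn₀k : inner (θ k) n₀ = 0 := by rw [hn₀', hPk]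
    -- For `y` killed by `θ k`, one has `D (x k ∧ y) = f k • y - x k ∧ s' y`, and `θ k` sends this
    -- to `-s' y`. So adding this boundary changes `θ k z` into `n₀`.
    set z₁ := z + inner (s' + f k • θ k) (ι R (x k) * P c) with hz₁
    have hz₁0 : inner (s' + f k • θ k) z₁ = 0 := by rw [hz₁, map_add, hz, inner_inner, add_zero]
    have hz₁k : inner (θ k) z₁ = n₀ := by
      rw [hz₁, hD _ (hPk c), map_add, map_sub, map_smul, hPk, smul_zero, zero_sub,
        hE _ (hθs' _ (hPk c)), ← sub_eq_add_neg]
    -- second step: `n₀` is a boundary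
    obtain ⟨m, hm⟩ : ∃ m : ℕ → ExteriorAlgebra R M, n₀ = ∑ j ∈ Finset.range k, f j • m j := by
      -- As `D z₁ = 0`, `f k • n₀ = -s' z₁` is a combination of the `f j` with `j < k`, and
      -- regularity allows division by `f k`.
      have e : inner s' z₁ + f k • n₀ = 0 := by rw [← hz₁k, ← inner_smul, ← inner_add, hz₁0]
      refine hf k (by omega) n₀ (fun j => -inner (θ j) z₁) ?_
      rw [eq_neg_of_add_eq_zero_right e, hs', inner, map_sum, LinearMap.sum_apply,
        ← Finset.sum_neg_distrib]
      refine Finset.sum_congr rfl fun j _ => ?_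
      rw [map_smul, LinearMap.smul_apply, smul_neg]
    -- Since `κ` fixes `n₀`, the coefficients `m j` may be replaced by `κ (m j)`, which all the
    -- forms kill. Then `s' (x j ∧ κ (m j)) = f j • κ (m j)`, so `n₀ = s' c'`.
    let κ := complement (Finset.range (k + 1)) θ x
    set c' := ∑ j ∈ Finset.range k, ι R (x j) * map κ (m j) with hc'
    have hκ (y) (i : ℕ) (hi : i < k + 1) : inner (θ i) (map κ y) = 0 :=
      inner_map_complement hθ y hi
    have hκs (y) : inner s' (map κ y) = 0 :=
      inner_sum_eq_zero _ _ _ _ fun i hi => hκ y i (by have := Finset.mem_range.1 hi; omega)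
    have hc'k : inner (θ k) c' = 0 := by
      rw [hc', map_sum]
      refine Finset.sum_eq_zero fun j hj => ?_
      have := Finset.mem_range.1 hj
      rw [inner_ι_mul, hκ _ k (by omega), hθ k (by omega) j (by omega), if_neg (by omega)]
      simp
    have hc's : inner s' c' = n₀ := by
      have hκn : map κ n₀ = n₀ := map_complement_eq_self hθ fun i hi => by
        rcases Nat.lt_succ_iff_lt_or_eq.1 hi with h | rfl
        exacts [hn₀i i h, hn₀k]
      rw [← hκn, hm, map_sum, map_sum]
      refine Finset.sum_congr rfl fun j hj => ?_
      have hj' := Finset.mem_range.1 hj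
      have : s' (x j) = f j := by
        rw [hs', LinearMap.sum_apply, Finset.sum_eq_single_of_mem j hj]
        · simp [hθ j (by omega) j (by omega)]
        · intro i hi hij
          have := Finset.mem_range.1 hi
          rw [LinearMap.smul_apply, hθ i (by omega) j (by omega), if_neg hij, smul_zero]
      rw [inner_ι_mul, hκs, mul_zero, sub_zero, this, map_smul]
    -- The same correction as for `z₁`: `θ k` of the added boundary is `-s' c' = -n₀`.
    set z₂ := z₁ + inner (s' + f k • θ k) (ι R (x k) * c') with hz₂
    have hz₂k : inner (θ k) z₂ = 0 := by
      rw [hz₂, map_add, hz₁k, hD _ hc'k, map_sub, map_smul, hc'k, smul_zero, zero_sub,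
        hc's, hE _ hn₀k, add_neg_cancel]
    have hz₂s : inner s' z₂ = 0 := by
      have : inner (s' + f k • θ k) z₂ = 0 := by rw [hz₂, map_add, hz₁0, inner_inner, add_zero]
      rwa [inner_add, inner_smul, hz₂k, smul_zero, add_zero] at this
    obtain ⟨w, hw⟩ := ih z₂ hz₂s
    -- `P` makes the primitive `w` killed by `θ k`, so that its `s'`-boundary is a `D`-boundary; `P`
    -- commutes with `s'` and fixes `z₂`.
    have hPw : inner (s' + f k • θ k) (P w) = inner s' (P w) := by
      rw [inner_add, inner_smul, hPk, smul_zero, add_zero]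
    have hfin : z - inner (s' + f k • θ k) (P w - ι R (x k) * P c - ι R (x k) * c') =
        P (z₂ - inner s' w) := by
      rw [hPsub, hPeq _ hz₂k, ← hPs, hz₂, hz₁, map_sub, map_sub, hPw]
      abel
    refine ⟨P w - ι R (x k) * P c - ι R (x k) * c', fun i hi => ?_⟩
    rw [hfin]
    rcases Nat.lt_succ_iff_lt_or_eq.1 hi with h | rfl
    exacts [hPi _ i h (hw i h), hPk _]

end ExteriorAlgebra

/-! ### The same results degree by degree, for the Koszul differential. -/

section ExteriorPower

open ExteriorAlgebra

variable {R M N : Type*} [CommRing R] [AddCommGroup M] [Module R M] [AddCommGroup N] [Module R N]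

/-- The alternating sum is the Leibniz rule unrolled from the first factor. This moves the Koszul
differential to the exterior algebra, where contractions anticommute. -/
theorem coe_contract (s : M →ₗ[R] R) (p : ℕ) (x : ⋀[R]^(p + 1) M) :
    (contract s p x : ExteriorAlgebra R M) = inner s x := by
  suffices h : (⋀[R]^p M).subtype ∘ₗ contract s p = inner s ∘ₗ (⋀[R]^(p + 1) M).subtype from
    LinearMap.congr_fun h x
  refine ext_semilinear fun m => ?_
  simp only [LinearMap.comp_apply, contract_ιMulti, Submodule.subtype_apply,
    exteriorPower.ιMulti_apply_coe, map_sum]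
  clear x
  induction p with
  | zero =>
    rw [Fin.sum_univ_one, ιMulti_succ_apply, inner_ι_mul]
    simp [inner]
  | succ p ih =>
    rw [ιMulti_succ_apply, inner_ι_mul, ← ih (Matrix.vecTail m), Fin.sum_univ_succ, sub_eq_add_neg,
      Finset.mul_sum, ← Finset.sum_neg_distrib]
    congr 1
    · simp only [Fin.val_zero, pow_zero, one_smul, Fin.removeNth_zero]
      rfl
    · refine Finset.sum_congr rfl fun i _ => ?_
      have e : ιMulti R (p + 1) (i.succ.removeNth m) =
          ι R (m 0) * ιMulti R p (i.removeNth (Matrix.vecTail m)) := by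
        have h0 : i.succ.removeNth m 0 = m 0 := by simp [Fin.removeNth]
        have h1 : Matrix.vecTail (i.succ.removeNth m) = i.removeNth (Matrix.vecTail m) :=
          funext fun j => by simp [Fin.removeNth, Matrix.vecTail]
        rw [ιMulti_succ_apply, h0, h1]
      have e' : s (Matrix.vecTail m i) = s (m i.succ) := rfl
      rw [Fin.val_succ, pow_succ, mul_neg_one, neg_smul, e']
      rcases neg_one_pow_eq_or ℤ i with h | h <;> simp [h, e]

theorem coe_extMap (f : M →ₗ[R] N) (p : ℕ) (x : ⋀[R]^p M) :
    (extMap p f x : ExteriorAlgebra R N) = map f x := by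
  suffices h : (⋀[R]^p N).subtype ∘ₗ extMap p f = (map f).toLinearMap ∘ₗ (⋀[R]^p M).subtype from
    LinearMap.congr_fun h x
  refine ext_semilinear fun m => ?_
  simp only [LinearMap.comp_apply, extMap_ιMulti, Submodule.subtype_apply,
    exteriorPower.ιMulti_apply_coe, AlgHom.toLinearMap_apply, map_apply_ιMulti]

theorem ι_mul_mem {p : ℕ} (m : M) {x : ExteriorAlgebra R M} (hx : x ∈ ⋀[R]^p M) :
    ι R m * x ∈ ⋀[R]^(p + 1) M := by
  have h : ι R m ∈ ⋀[R]^1 M := by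
    rw [exteriorPower, pow_one]
    exact LinearMap.mem_range_self _ m
  have := SetLike.GradedMul.mul_mem (A := fun i : ℕ => ⋀[R]^i M) h hx
  rwa [add_comm] at this

/-- `x ↦ m ∧ x`. -/
def wedge (p : ℕ) (m : M) (x : ⋀[R]^p M) : ⋀[R]^(p + 1) M := ⟨ι R m * x, ι_mul_mem m x.2⟩

/-- `x` is killed by the contraction with `s`. -/
def IsKilled (s : M →ₗ[R] R) {p : ℕ} (x : ⋀[R]^p M) : Prop :=
  inner s (x : ExteriorAlgebra R M) = 0

/-- Contraction kills scalars. Cycles are described by `inner` and not by `contract` so that degree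
`0` is not a separate case. -/
theorem isKilled_zero (s : M →ₗ[R] R) (x : ⋀[R]^0 M) : IsKilled s x := by
  obtain ⟨x, hx⟩ := x
  rw [exteriorPower, pow_zero] at hx
  obtain ⟨r, rfl⟩ := Submodule.mem_one.1 hx
  exact CliffordAlgebra.contractLeft_algebraMap (Q := (0 : QuadraticForm R M)) s r

theorem isKilled_succ (s : M →ₗ[R] R) {p : ℕ} (x : ⋀[R]^(p + 1) M) :
    IsKilled s x ↔ contract s p x = 0 := by
  rw [IsKilled, ← coe_contract, Submodule.coe_eq_zero]

/-- On cycles, wedging with `m` is a homotopy for multiplication by `s m`. It serves with `s m = 1`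
off the zero locus, and with `m = x i` on it. -/
theorem contract_wedge (s : M →ₗ[R] R) {p : ℕ} (m : M) (x : ⋀[R]^p M) (hx : IsKilled s x) :
    contract s p (wedge p m x) = s m • x := by
  refine Subtype.ext ?_
  rw [coe_contract, wedge, inner_ι_mul, hx, mul_zero, sub_zero]
  rfl

/-- An operator of degree `-1` commutes with taking homogeneous components. This allows an
inhomogeneous primitive to be replaced by one of its components. -/
theorem decompose_apply_of_degree {T : ExteriorAlgebra R M →ₗ[R] ExteriorAlgebra R M}
    (h0 : ∀ x ∈ ⋀[R]^0 M, T x = 0) (hT : ∀ i, ∀ x ∈ ⋀[R]^(i + 1) M, T x ∈ ⋀[R]^i M)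
    (p : ℕ) (w : ExteriorAlgebra R M) :
    (DirectSum.decompose (fun n => ⋀[R]^n M) (T w) p : ExteriorAlgebra R M) =
      T (DirectSum.decompose (fun n => ⋀[R]^n M) w (p + 1)) := by
  induction w using DirectSum.Decomposition.inductionOn (fun n => ⋀[R]^n M) with
  | zero => simp
  | @homogeneous i m =>
    rcases i with _ | i
    · rw [h0 _ m.2, DirectSum.decompose_of_mem_ne (fun n => ⋀[R]^n M) m.2 (by omega)]
      simp
    · rcases eq_or_ne i p with rfl | h
      · rw [DirectSum.decompose_of_mem_same (fun n => ⋀[R]^n M) (hT _ _ m.2),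
          DirectSum.decompose_of_mem_same (fun n => ⋀[R]^n M) m.2]
      · rw [DirectSum.decompose_of_mem_ne (fun n => ⋀[R]^n M) (hT _ _ m.2) h,
          DirectSum.decompose_of_mem_ne (fun n => ⋀[R]^n M) m.2 (by omega), map_zero]
  | add x y hx hy => simp [hx, hy]

open Module in
-- Regularity is applied to each coordinate; the finite support of `n` makes the new coefficients
-- finite sums.
theorem regularOn_of_basis {F I : Type*} [AddCommGroup F] [Module R F] (b : Basis I R F)
    {f : ℕ → R} {d : ℕ} (h : RegularOn R f d) : RegularOn F f d := by
  intro k hk n m hm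
  have key (i : I) : ∃ a : ℕ → R, b.repr n i = ∑ j ∈ Finset.range k, f j * a j := by
    refine h k hk (b.repr n i) (fun j => b.repr (m j) i) ?_
    have := congrArg (fun v => b.repr v i) hm
    simpa using this
  choose a ha using key
  refine ⟨fun j => ∑ i ∈ (b.repr n).support, a i j • b i, ?_⟩
  conv_lhs => rw [← b.linearCombination_repr n, Finsupp.linearCombination_apply, Finsupp.sum]
  simp_rw [Finset.smul_sum]
  rw [Finset.sum_comm]
  refine Finset.sum_congr rfl fun i _ => ?_
  rw [ha, Finset.sum_smul]
  simp only [mul_smul]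

theorem regularOn_of_isWeaklyRegular {d : ℕ} (f : Fin d → R)
    (h : RingTheory.Sequence.IsWeaklyRegular R (List.ofFn f)) :
    RegularOn R (fun i => if h : i < d then f ⟨i, h⟩ else 0) d := by
  intro k hk n m hm
  -- Since `k < d`, the default value `0` outside `Fin d` never enters the sums over `j < k`.
  have hI : ∀ a : R, a ∈ Ideal.ofList ((List.ofFn f).take k) ↔
      ∃ m : ℕ → R, a = ∑ j ∈ Finset.range k, (if h : j < d then f ⟨j, h⟩ else 0) • m j := by
    intro a
    have e : Ideal.ofList ((List.ofFn f).take k) =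
        Ideal.span (Set.range fun i : Fin k => f ⟨i, i.2.trans hk⟩) := by
      rw [Ideal.ofList]
      congr 1
      ext a
      simp only [Set.mem_ofPred_eq, List.mem_take_iff_getElem, List.getElem_ofFn, List.length_ofFn,
        Set.mem_range]
      constructor
      · rintro ⟨i, hi, rfl⟩
        exact ⟨⟨i, by omega⟩, rfl⟩
      · rintro ⟨i, rfl⟩
        exact ⟨i, by omega, rfl⟩
    rw [e, Ideal.mem_span_range_iff_exists_fun]
    constructor
    · rintro ⟨c, rfl⟩
      refine ⟨fun j => if h : j < k then c ⟨j, h⟩ else 0, ?_⟩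
      rw [Finset.sum_range]
      refine Finset.sum_congr rfl fun i _ => ?_
      simp only [dif_pos (i.2.trans hk), dif_pos i.2, smul_eq_mul, mul_comm]
    · rintro ⟨c, rfl⟩
      refine ⟨fun i => c i, ?_⟩
      rw [Finset.sum_range]
      refine Finset.sum_congr rfl fun i _ => ?_
      rw [dif_pos (i.2.trans hk), smul_eq_mul, mul_comm]
  have hreg := h.regular_mod_prev k (by simpa using hk)
  rw [← hI]
  have hmem : f ⟨k, hk⟩ * n ∈ Ideal.ofList ((List.ofFn f).take k) := by
    rw [hI]
    refine ⟨m, ?_⟩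
    rw [← hm]
    simp [hk]
  have htop : (Ideal.ofList ((List.ofFn f).take k) • ⊤ : Submodule R R) =
      Ideal.ofList ((List.ofFn f).take k) := by
    rw [smul_eq_mul, Ideal.mul_top]
  have h0 : (Submodule.Quotient.mk n : R ⧸ (Ideal.ofList ((List.ofFn f).take k) • ⊤ :
      Submodule R R)) = 0 := by
    refine hreg ?_
    simp only [List.getElem_ofFn, smul_zero]
    rw [← Submodule.Quotient.mk_smul, Submodule.Quotient.mk_eq_zero, htop, smul_eq_mul]
    exact hmem
  rwa [Submodule.Quotient.mk_eq_zero, htop] at h0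

/-- The projection `m ↦ m - ∑ θᵢ(m) xᵢ`. -/
def projection {d : ℕ} (θ : Fin d → M →ₗ[R] R) (x : Fin d → M) : M →ₗ[R] M :=
  LinearMap.id - ∑ i, (θ i).smulRight (x i)

theorem projection_apply {d : ℕ} (θ : Fin d → M →ₗ[R] R) (x : Fin d → M) (m : M) :
    projection θ x m = m - ∑ i, θ i m • x i := by
  simp [projection]

open Module in
-- This is `exists_sub_inner` in the exterior algebra, which is free because `M` is, followed by
-- `map_complement_eq_self`: what all the `θ i` kill is fixed by the projection.
theorem exists_extMap_projection_eq {I : Type*} [LinearOrder I] (b : Basis I R M) {d : ℕ}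
    {θ : Fin d → M →ₗ[R] R} {x : Fin d → M} (hθ : ∀ i j, θ i (x j) = if i = j then 1 else 0)
    {s : M →ₗ[R] R} (hs : ∀ m, s m = ∑ i, θ i m * s (x i))
    (hreg : RingTheory.Sequence.IsWeaklyRegular R (List.ofFn fun i => s (x i)))
    {p : ℕ} (z : ⋀[R]^p M) (hz : IsKilled s z) :
    ∃ w, extMap p (projection θ x) (z - contract s p w) = z - contract s p w := by
  let f : ℕ → R := fun i => if h : i < d then s (x ⟨i, h⟩) else 0
  let θ' : ℕ → Module.Dual R M := fun i => if h : i < d then θ ⟨i, h⟩ else 0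
  let x' : ℕ → M := fun i => if h : i < d then x ⟨i, h⟩ else 0
  have hθ' : ∀ i < d, ∀ j < d, θ' i (x' j) = if i = j then 1 else 0 := fun i hi j hj => by
    simp only [θ', x', dif_pos hi, dif_pos hj, hθ, Fin.mk.injEq]
  have hf : RegularOn (ExteriorAlgebra R M) f d :=
    regularOn_of_basis b.ExteriorAlgebra (regularOn_of_isWeaklyRegular _ hreg)
  have hs' : ∑ i ∈ Finset.range d, f i • θ' i = s := by
    refine LinearMap.ext fun m => ?_
    rw [hs, LinearMap.sum_apply, Finset.sum_range]
    refine Finset.sum_congr rfl fun i _ => ?_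
    simp [f, θ', mul_comm]
  have hκ : complement (Finset.range d) θ' x' = projection θ x := by
    rw [complement, projection, Finset.sum_range]
    simp [θ', x']
  obtain ⟨w, hw⟩ := exists_sub_inner hθ' hf (z : ExteriorAlgebra R M) (by rw [hs']; exact hz)
  have hw' := map_complement_eq_self hθ' hw
  rw [hs', hκ] at hw'
  -- The primitive `w` is inhomogeneous. The fixed point equation says that `T w` is the projection
  -- of `z` minus `z`, of degree `p`; since `T` has degree `-1`, only the component of `w` in degree
  -- `p + 1` matters.
  let T : ExteriorAlgebra R M →ₗ[R] ExteriorAlgebra R M :=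
    (map (projection θ x)).toLinearMap ∘ₗ inner s - inner s
  have hmem (i : ℕ) (y) (hy : y ∈ ⋀[R]^i M) : map (projection θ x) y ∈ ⋀[R]^i M := by
    rw [← coe_extMap _ i ⟨y, hy⟩]
    exact Subtype.property _
  have hTp : T w = map (projection θ x) z - z := by
    simp only [T, LinearMap.sub_apply, LinearMap.comp_apply, AlgHom.toLinearMap_apply]
    rw [map_sub] at hw'
    rw [← sub_eq_zero, ← neg_eq_zero]
    refine Eq.trans ?_ (sub_eq_zero.2 hw')
    abel
  have hdeg := decompose_apply_of_degree (T := T)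
    (fun y hy => by
      have : inner s y = 0 := isKilled_zero s ⟨y, hy⟩
      simp only [T, LinearMap.sub_apply, LinearMap.comp_apply, this, map_zero, sub_zero])
    (fun i y hy => by
      have : inner s y ∈ ⋀[R]^i M := by
        rw [← coe_contract s i ⟨y, hy⟩]
        exact Subtype.property _
      exact Submodule.sub_mem _ (hmem i _ this) this) p w
  rw [hTp, DirectSum.decompose_of_mem_same (fun n => ⋀[R]^n M)
    (Submodule.sub_mem _ (hmem p _ z.2) z.2)] at hdeg
  refine ⟨DirectSum.decompose (fun n => ⋀[R]^n M) w (p + 1), Subtype.ext ?_⟩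
  rw [coe_extMap, Submodule.coe_sub, coe_contract, map_sub]
  simp only [T, LinearMap.sub_apply, LinearMap.comp_apply, AlgHom.toLinearMap_apply] at hdeg
  rw [← sub_eq_zero]
  refine Eq.trans ?_ (sub_eq_zero.2 hdeg)
  abel

/-- An element of `I ⋀^p M` which comes from the complement is a boundary. -/
theorem exists_contract_eq {d : ℕ} {θ : Fin d → M →ₗ[R] R} {x : Fin d → M}
    {s : M →ₗ[R] R} (hs : ∀ m, s m = ∑ i, θ i m * s (x i)) {p : ℕ} {z : ⋀[R]^p M}
    (hz : extMap p (projection θ x) z = z) (y : Fin d → ⋀[R]^p M)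
    (hy : z = ∑ i, s (x i) • y i) : ∃ w, contract s p w = z := by
  have hs0 : s ∘ₗ projection θ x = 0 := by
    refine LinearMap.ext fun m => ?_
    rw [LinearMap.comp_apply, projection_apply, map_sub, map_sum, hs m]
    simp
  have hk (y : ⋀[R]^p M) : IsKilled s (extMap p (projection θ x) y) := by
    rw [IsKilled, coe_extMap, inner_map, hs0]
    simp [inner]
  -- Applying the projection to `z = ∑ s(x i) y i` replaces each `y i` by a cycle; then wedging with
  -- `x i` is a homotopy for multiplication by `s(x i)`.
  refine ⟨∑ i, wedge p (x i) (extMap p (projection θ x) (y i)), ?_⟩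
  rw [map_sum, ← hz, hy, map_sum]
  refine Finset.sum_congr rfl fun i _ => ?_
  rw [contract_wedge _ _ _ (hk _), map_smul]

open Module in
-- The relations of a regular sequence have coefficients in its ideal. This is the case `p = 1` of
-- the preceding result: up to a boundary `inner s w`, `θ i` kills `m`, and `θ i` of that boundary
-- is `-s` of the contraction of `w` with `θ i`.
theorem apply_mem_span_of_eq_zero {I : Type*} [LinearOrder I] (b : Basis I R M) {d : ℕ}
    {θ : Fin d → M →ₗ[R] R} {x : Fin d → M} (hθ : ∀ i j, θ i (x j) = if i = j then 1 else 0)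
    {s : M →ₗ[R] R} (hs : ∀ m, s m = ∑ i, θ i m * s (x i))
    (hreg : RingTheory.Sequence.IsWeaklyRegular R (List.ofFn fun i => s (x i)))
    {m : M} (hm : s m = 0) (i : Fin d) : θ i m ∈ LinearMap.range s := by
  let z : ⋀[R]^1 M := exteriorPower.ιMulti R 1 fun _ => m
  have hz : IsKilled s z := by
    rw [isKilled_succ, contract_ιMulti]
    simp [hm]
  obtain ⟨w, hw⟩ := exists_extMap_projection_eq b hθ hs hreg z hz
  have hθ0 : θ i ∘ₗ projection θ x = 0 := by
    refine LinearMap.ext fun m => ?_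
    rw [LinearMap.comp_apply, projection_apply, map_sub, map_sum]
    simp [hθ]
  have h1 : inner (θ i) (ι R m) = inner (θ i) (inner s w) := by
    have h2 : inner (θ i) ((z - contract s 1 w : ⋀[R]^1 M) : ExteriorAlgebra R M) = 0 := by
      rw [← hw, coe_extMap, inner_map, hθ0]
      simp [inner]
    rw [Submodule.coe_sub, coe_contract, map_sub, sub_eq_zero] at h2
    rw [← h2]
    simp [z, ιMulti_succ_apply]
  obtain ⟨m', hm'⟩ : ∃ m', ι R m' = inner (θ i) (w : ExteriorAlgebra R M) := by
    have := (contract (θ i) 1 w).2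
    rw [coe_contract, exteriorPower, pow_one] at this
    exact this
  have hι (φ : M →ₗ[R] R) (m : M) : inner φ (ι R m) = algebraMap R _ (φ m) :=
    CliffordAlgebra.contractLeft_ι (Q := (0 : QuadraticForm R M)) φ m
  rw [inner_comm, ← hm', hι, hι, ← map_neg] at h1
  exact ⟨-m', by rw [map_neg, (algebraMap_leftInverse M).injective h1]⟩

end ExteriorPower

/-! ### Sections of exterior powers of sheaves. -/

section ExtPow

variable {X : TopCat.{0}} {O : Sheaf (Opens.grothendieckTopology X) CommRingCat.{0}}

/-- The map `⋀^p M(V) → (⋀^p M)(V)`. -/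
def toExt (p : ℕ) (M : ModuleSheaf O) (V : Opens X) :
    ⋀[Fn O V]^p (Sec M V) →ₗ[Fn O V] Sec ((extPow p).obj M) V :=
  (((sheafifyModulesAdj (ringSheaf O)).unit.app (extPresheaf (O := O.obj) p M.val)).app (op V)).hom

theorem res_toExt {p : ℕ} {M : ModuleSheaf O} {V W : Opens X} (h : W ≤ V)
    (x : ⋀[Fn O V]^p (Sec M V)) :
    res _ h (toExt p M V x) = toExt p M W (extMap p (res M h) x) :=
  (PresheafOfModules.naturality_apply ((sheafifyModulesAdj (ringSheaf O)).unit.app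
    (extPresheaf (O := O.obj) p M.val)) (homOfLE h).op x).symm

theorem extMap_res_res {p : ℕ} {M : ModuleSheaf O} {U V W : Opens X} (h : V ≤ U) (k : W ≤ V)
    (x : ⋀[Fn O U]^p (Sec M U)) :
    extMap p (res M k) (extMap p (res M h) x) = extMap p (res M (k.trans h)) x :=
  (extMap_comp (A := Fn O U) (B := Fn O V) (C := Fn O W) (φ := fres O h) (ψ := fres O k)
    (χ := fres O (k.trans h)) (M := Sec M U) (N := Sec M V) (P := Sec M W)
    p (RingHom.ext fun a => fres_fres h k a) (res M (k.trans h)) (res M k) (res M h)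
    (fun m => (res_res h k m).symm) x).symm

theorem app_sheafify_map {P Q : PresheafOfModules.{0} (ringSheaf O).obj} (g : P ⟶ Q) (V : Opens X)
    (x : P.obj (op V)) :
    app ((sheafifyModules (ringSheaf O)).map g) V
      (((sheafifyModulesAdj (ringSheaf O)).unit.app P).app (op V) x) =
    ((sheafifyModulesAdj (ringSheaf O)).unit.app Q).app (op V) (g.app (op V) x) := by
  have h := (sheafifyModulesAdj (ringSheaf O)).unit.naturality g
  have h2 := congrArg (fun f => PresheafOfModules.Hom.app f (op V)) h
  exact (LinearMap.congr_fun (congrArg ModuleCat.Hom.hom h2) x).symm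

theorem app_sheafify_homEquiv_symm {P : PresheafOfModules.{0} (ringSheaf O).obj} {F : ModuleSheaf O}
    (g : P ⟶ (SheafOfModules.forget (ringSheaf O)).obj F) (V : Opens X) (x : P.obj (op V)) :
    app (((sheafifyModulesAdj (ringSheaf O)).homEquiv P F).symm g) V
      (((sheafifyModulesAdj (ringSheaf O)).unit.app P).app (op V) x) = g.app (op V) x := by
  have h := (sheafifyModulesAdj (ringSheaf O)).homEquiv_unit
    (f := ((sheafifyModulesAdj (ringSheaf O)).homEquiv P F).symm g)
  rw [Equiv.apply_symm_apply] at h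
  have h2 := congrArg (fun f => PresheafOfModules.Hom.app f (op V)) h
  exact (LinearMap.congr_fun (congrArg ModuleCat.Hom.hom h2) x).symm

set_option maxHeartbeats 1000000 in
theorem toExt_eq_zero {p : ℕ} {M : ModuleSheaf O} {V : Opens X} (x : ⋀[Fn O V]^p (Sec M V))
    (h : toExt p M V x = 0) {t : X} (ht : t ∈ V) :
    ∃ (W : Opens X) (k : W ≤ V), t ∈ W ∧ extMap p (res M k) x = 0 := by
  obtain ⟨W, k, hW, e⟩ := sheafify_locally_zero (extPresheaf (O := O.obj) p M.val) x h ht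
  exact ⟨W, k, hW, e⟩

theorem exists_toExt {p : ℕ} {M : ModuleSheaf O} {V : Opens X}
    (b : Sec ((extPow p).obj M) V) {t : X} (ht : t ∈ V) :
    ∃ (W : Opens X) (k : W ≤ V) (x : ⋀[Fn O W]^p (Sec M W)), t ∈ W ∧
      toExt p M W x = res _ k b :=
  sheafify_locally_surjective (extPresheaf (O := O.obj) p M.val) b ht

/-- A cosection, on sections. -/
def cosec {E : ModuleSheaf O} (s : E ⟶ structureModule O) (V : Opens X) :
    Sec E V →ₗ[Fn O V] Fn O V := app s V

theorem cosec_res {E : ModuleSheaf O} (s : E ⟶ structureModule O) {V W : Opens X} (h : W ≤ V)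
    (m : Sec E V) : cosec s W (res E h m) = fres O h (cosec s V m) :=
  app_res s h m

set_option maxHeartbeats 2000000 in
theorem app_koszulD {E : ModuleSheaf O} (s : E ⟶ structureModule O) (p : ℕ) (V : Opens X)
    (x : ⋀[Fn O V]^(p + 1) (Sec E V)) :
    app (koszulD s p) V (toExt (p + 1) E V x) = toExt p E V (contract (cosec s V) p x) := by
  exact app_sheafify_map (contractPresheaf (O := O.obj) s.val p) V x

theorem app_extPow_map {M N : ModuleSheaf O} (f : M ⟶ N) (p : ℕ) (V : Opens X)
    (x : ⋀[Fn O V]^p (Sec M V)) :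
    app ((extPow p).map f) V (toExt p M V x) = toExt p N V (extMap p (app f V) x) :=
  app_sheafify_map ((extPresheafFunctor (O := O.obj) p).map f.val) V x

end ExtPow

/-! ### Inverse and direct images on sections. -/

section Push

variable {X Y : TopCat.{0}} {O : Sheaf (Opens.grothendieckTopology X) CommRingCat.{0}}
  {OY : Sheaf (Opens.grothendieckTopology Y) CommRingCat.{0}} (f : X ⟶ Y)
  (φ : OY ⟶ ((Opens.map f).sheafPushforwardContinuous _ _ _).obj O)

/-- The ring homomorphism `O_Y(V) → O_X(f⁻¹V)`. -/
def pullFn (V : Opens Y) : Fn OY V →+* Fn O ((Opens.map f).obj V) := (φ.hom.app (op V)).hom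

theorem pullFn_res {V W : Opens Y} (h : W ≤ V) (h' : (Opens.map f).obj W ≤ (Opens.map f).obj V)
    (a : Fn OY V) : pullFn f φ W (fres OY h a) = fres O h' (pullFn f φ V a) :=
  congrArg (fun g => g.hom a) (φ.hom.naturality (homOfLE h).op)

/-- A morphism to a direct image, on sections. -/
def appPush {E : ModuleSheaf OY} {G : ModuleSheaf O} (u : E ⟶ (pushFunctor f φ).obj G)
    (V : Opens Y) : Sec E V →ₛₗ[pullFn f φ V] Sec G ((Opens.map f).obj V) :=
  semilin (O := OY.obj) (O' := O.obj) (F := Opens.map f) φ.hom (M := E.val) (N := G.val) u.val (op V)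

theorem appPush_res {E : ModuleSheaf OY} {G : ModuleSheaf O} (u : E ⟶ (pushFunctor f φ).obj G)
    {V W : Opens Y} (h : W ≤ V) (h' : (Opens.map f).obj W ≤ (Opens.map f).obj V) (m : Sec E V) :
    appPush f φ u W (res E h m) = res G h' (appPush f φ u V m) :=
  app_res u h m

set_option maxHeartbeats 1000000 in
theorem app_extPowPush {E : ModuleSheaf OY} {G : ModuleSheaf O} (u : E ⟶ (pushFunctor f φ).obj G)
    (p : ℕ) (V : Opens Y) (x : ⋀[Fn OY V]^p (Sec E V)) :
    appPush f φ (extPowPush f φ u p) V (toExt p E V x) =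
      toExt p G ((Opens.map f).obj V) (extMap p (appPush f φ u V) x) :=
  app_sheafify_homEquiv_symm (P := extPresheaf (O := OY.obj) p E.val)
    (F := (pushFunctor f φ).obj ((extPow p).obj G)) _ V x

/-- The unit `M → f_* f^* M`. -/
def eta (M : ModuleSheaf OY) (V : Opens Y) :
    Sec M V →ₛₗ[pullFn f φ V] Sec ((pullFunctor f φ).obj M) ((Opens.map f).obj V) :=
  appPush f φ ((pullPushAdj f φ).unit.app M) V

theorem eta_res {M : ModuleSheaf OY} {V W : Opens Y} (h : W ≤ V)
    (h' : (Opens.map f).obj W ≤ (Opens.map f).obj V) (m : Sec M V) :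
    eta f φ M W (res M h m) = res _ h' (eta f φ M V m) :=
  appPush_res f φ _ h h' m

theorem app_pull_map {M N : ModuleSheaf OY} (g : M ⟶ N) (V : Opens Y) (m : Sec M V) :
    app ((pullFunctor f φ).map g) _ (eta f φ M V m) = eta f φ N V (app g V m) :=
  congrArg (fun h => app h V m) ((pullPushAdj f φ).unit.naturality g).symm

theorem app_homEquiv {M : ModuleSheaf OY} {G : ModuleSheaf O} (g : (pullFunctor f φ).obj M ⟶ G)
    (V : Opens Y) (m : Sec M V) :
    appPush f φ ((pullPushAdj f φ).homEquiv _ _ g) V m = app g _ (eta f φ M V m) :=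
  congrArg (fun h => app h V m) ((pullPushAdj f φ).homEquiv_unit (f := g))

theorem app_homEquiv_symm {M : ModuleSheaf OY} {G : ModuleSheaf O} (u : M ⟶ (pushFunctor f φ).obj G)
    (V : Opens Y) (m : Sec M V) :
    app (((pullPushAdj f φ).homEquiv _ _).symm u) _ (eta f φ M V m) = appPush f φ u V m := by
  rw [← app_homEquiv, Equiv.apply_symm_apply]

end Push

/-! ### Germs and skyscraper sheaves of modules. -/

section Skyscraper

variable {X : TopCat.{0}} {O : Sheaf (Opens.grothendieckTopology X) CommRingCat.{0}}

variable (O) in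
/-- The germ at `x` of a function. -/
def germAt {V : Opens X} {x : X} (hx : x ∈ V) : Fn O V →+* stalkRing O x :=
  (TopCat.Presheaf.germ (underlyingPresheaf O) V x hx).hom

theorem germAt_fres {V W : Opens X} {x : X} (h : W ≤ V) (hx : x ∈ W) (a : Fn O V) :
    germAt O hx (fres O h a) = germAt O (h hx) a :=
  TopCat.Presheaf.germ_res_apply (underlyingPresheaf O) (homOfLE h) x hx a

theorem exists_germAt {x : X} (c : stalkRing O x) :
    ∃ (V : Opens X) (hx : x ∈ V) (a : Fn O V), germAt O hx a = c :=
  TopCat.Presheaf.exists_germ_eq (underlyingPresheaf O) c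

theorem exists_fres_eq_zero {V : Opens X} {x : X} (hx : x ∈ V) (a : Fn O V)
    (h : germAt O hx a = 0) : ∃ (W : Opens X) (k : W ≤ V), x ∈ W ∧ fres O k a = 0 := by
  obtain ⟨W, hW, i, k, e⟩ := TopCat.Presheaf.germ_eq (underlyingPresheaf O) x hx hx a 0
    (h.trans (map_zero (germAt O hx)).symm)
  exact ⟨W, i.le, hW, e.trans (map_zero (fres O k.le))⟩

theorem exists_fres_eq {V V' : Opens X} {x : X} (hx : x ∈ V) (hx' : x ∈ V') (a : Fn O V)
    (b : Fn O V') (h : germAt O hx a = germAt O hx' b) :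
    ∃ (W : Opens X) (k : W ≤ V) (k' : W ≤ V'), x ∈ W ∧ fres O k a = fres O k' b := by
  obtain ⟨W, hW, i, k, e⟩ := TopCat.Presheaf.germ_eq (underlyingPresheaf O) x hx hx' a b h
  exact ⟨W, i.le, k.le, hW, e⟩

/-- The sections over `V` of the skyscraper at `x` with value `Q`. -/
def SkySec (x : X) (Q : Type) (V : Opens X) : Type := PLift (x ∈ V) → Q

variable (x : X) (Q : Type) [AddCommGroup Q] [Module (stalkRing O x) Q]

instance (V : Opens X) : AddCommGroup (SkySec x Q V) := inferInstanceAs (AddCommGroup (PLift (x ∈ V) → Q))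

instance skyModule (V : Opens X) : Module (Fn O V) (SkySec x Q V) where
  smul a g := fun hx => germAt O hx.down a • g hx
  one_smul g := funext fun hx => by
    change germAt O hx.down 1 • g hx = g hx
    rw [map_one, one_smul]
  mul_smul a b g := funext fun hx => by
    change germAt O hx.down (a * b) • g hx = germAt O hx.down a • germAt O hx.down b • g hx
    rw [map_mul, mul_smul]
  smul_zero a := funext fun hx => smul_zero _
  smul_add a g g' := funext fun hx => smul_add _ _ _
  add_smul a b g := funext fun hx => by
    change germAt O hx.down (a + b) • g hx = germAt O hx.down a • g hx + germAt O hx.down b • g hx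
    rw [map_add, add_smul]
  zero_smul g := funext fun hx => by
    change germAt O hx.down 0 • g hx = 0
    rw [map_zero, zero_smul]

/-- The skyscraper at `x` with value `Q`, as a presheaf of modules. -/
def skyPresheaf : PresheafOfModules.{0} (ringSheaf O).obj :=
  presheafOfSections (SkySec x Q)
    (fun h =>
      { toFun := fun g hx => g ⟨h hx.down⟩
        map_add' := fun _ _ => rfl
        map_smul' := fun a g => funext fun hx => by
          change germAt O (h hx.down) a • g ⟨h hx.down⟩ = germAt O hx.down (fres O h a) • g ⟨h hx.down⟩
          rw [germAt_fres] })
    (fun _ => rfl) (fun _ _ _ => rfl)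

/-- The skyscraper at `x` with value `Q`. -/
def skyscraper : ModuleSheaf O where
  val := skyPresheaf x Q
  isSheaf := by
    refine (TopCat.Presheaf.isSheaf_iff_isSheafUniqueGluing (C := Ab) (skyPresheaf (O := O) x Q).presheaf).2 ?_
    intro ι U sf hsf
    -- Any member of the cover that contains `x` determines the value of the glued section.
    have key : ∀ (i k : ι) (hi : x ∈ U i) (hk : x ∈ U k), (sf i : SkySec x Q (U i)) ⟨hi⟩ = (sf k : SkySec x Q (U k)) ⟨hk⟩ := fun i k hi hk =>
      congrFun (hsf i k) ⟨⟨hi, hk⟩⟩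
    refine ⟨fun hx => (sf (Opens.mem_iSup.1 hx.down).choose : SkySec x Q _) ⟨(Opens.mem_iSup.1 hx.down).choose_spec⟩, ?_, ?_⟩
    · intro i
      exact funext fun hx => key _ _ _ _
    · intro g hg
      exact funext fun hx => congrFun (hg _) ⟨(Opens.mem_iSup.1 hx.down).choose_spec⟩

end Skyscraper

/-! ### Local description of the inverse image. -/

section Pull

variable {X Y : TopCat.{0}} {O : Sheaf (Opens.grothendieckTopology X) CommRingCat.{0}}
  {OY : Sheaf (Opens.grothendieckTopology Y) CommRingCat.{0}} (f : X ⟶ Y)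
  (φ : OY ⟶ ((Opens.map f).sheafPushforwardContinuous _ _ _).obj O)

/-- A compatible family of semilinear maps from the sections of `M` near `f x` to a module over the
stalk at `x` extends to the sections of `f^* M`. -/
theorem exists_extension (M : ModuleSheaf OY) (x : X) (Q : Type) [AddCommGroup Q]
    [Module (stalkRing O x) Q]
    (l : ∀ (V : Opens Y) (hV : x ∈ (Opens.map f).obj V),
      Sec M V →ₛₗ[(germAt O hV).comp (pullFn f φ V)] Q)
    (hl : ∀ {V W : Opens Y} (h : W ≤ V) (hW : x ∈ (Opens.map f).obj W) (m : Sec M V),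
      l W hW (res M h m) = l V (h hW) m) :
    ∃ L : ∀ (V : Opens X) (hV : x ∈ V), Sec ((pullFunctor f φ).obj M) V →ₛₗ[germAt O hV] Q,
      (∀ {V W : Opens X} (h : W ≤ V) (hW : x ∈ W) m, L W hW (res _ h m) = L V (h hW) m) ∧
      ∀ (V : Opens Y) (hV : x ∈ (Opens.map f).obj V) (m : Sec M V),
        L _ hV (eta f φ M V m) = l V hV m := by
  -- The family is a morphism from `M` to the direct image of a skyscraper; its adjoint is the
  -- extension. Such functionals detect the nonzero sections of `f^* M`.
  let u : M ⟶ (pushFunctor f φ).obj (skyscraper x Q) := homOfSections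
    (fun V =>
      { toFun := fun m hV => l V hV.down m
        map_add' := fun a b => funext fun hV => map_add _ _ _
        map_smul' := fun a m => funext fun hV => (l V hV.down).map_smulₛₗ a m })
    (fun h m => funext fun hW => hl h hW.down m)
  let g := ((pullPushAdj f φ).homEquiv _ _).symm u
  refine ⟨fun V hV =>
    { toFun := fun m => (app g V m : SkySec x Q V) ⟨hV⟩
      map_add' := fun a b => by rw [map_add]; rfl
      map_smul' := fun a b => by rw [map_smul]; rfl }, fun h hW m => ?_, fun V hV m => ?_⟩
  · exact congrFun (app_res g h m) ⟨hW⟩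
  · exact congrFun (app_homEquiv_symm f φ u V m) ⟨hV⟩

/-- If functions on `X` come locally from functions on `Y`, then the sections of `f^* M` come locally
from sections of `M`. -/
theorem exists_eta
    (hf : ∀ (W : Opens X) (x : X), x ∈ W → ∃ V : Opens Y, x ∈ (Opens.map f).obj V ∧ (Opens.map f).obj V ≤ W)
    (hφ : ∀ (W : Opens X) (a : Fn O W) (x : X), x ∈ W → ∃ (V : Opens Y) (h : (Opens.map f).obj V ≤ W)
      (b : Fn OY V), x ∈ (Opens.map f).obj V ∧ pullFn f φ V b = fres O h a)
    (M : ModuleSheaf OY) {W : Opens X} (m : Sec ((pullFunctor f φ).obj M) W) {x : X} (hx : x ∈ W) :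
    ∃ (V : Opens Y) (h : (Opens.map f).obj V ≤ W) (b : Sec M V), x ∈ (Opens.map f).obj V ∧
      eta f φ M V b = res _ h m := by
  let P (W : Opens X) (m : Sec ((pullFunctor f φ).obj M) W) : Prop :=
    ∀ x ∈ W, ∃ (V : Opens Y) (h : (Opens.map f).obj V ≤ W) (b : Sec M V), x ∈ (Opens.map f).obj V ∧
      eta f φ M V b = res _ h m
  let G (W : Opens X) : Submodule (Fn O W) (Sec ((pullFunctor f φ).obj M) W) :=
    { carrier := {m | P W m}
      zero_mem' := fun x hx => by
        obtain ⟨V, hV, h⟩ := hf W x hx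
        exact ⟨V, h, 0, hV, by rw [map_zero, map_zero]⟩
      add_mem' := fun {a b} ha hb x hx => by
        obtain ⟨V, h, m, hV, e⟩ := ha x hx
        obtain ⟨V', h', m', hV', e'⟩ := hb x hx
        have k : (Opens.map f).obj (V ⊓ V') ≤ (Opens.map f).obj V := fun _ h => h.1
        have k' : (Opens.map f).obj (V ⊓ V') ≤ (Opens.map f).obj V' := fun _ h => h.2
        refine ⟨V ⊓ V', k.trans h, res M inf_le_left m + res M inf_le_right m', ⟨hV, hV'⟩, ?_⟩
        rw [map_add, map_add, eta_res f φ _ k, eta_res f φ _ k', e, e', res_res, res_res]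
      smul_mem' := fun c a ha x hx => by
        obtain ⟨V, h, m, hV, e⟩ := ha x hx
        obtain ⟨V', h', m', hV', e'⟩ := hφ W c x hx
        have k : (Opens.map f).obj (V ⊓ V') ≤ (Opens.map f).obj V := fun _ h => h.1
        have k' : (Opens.map f).obj (V ⊓ V') ≤ (Opens.map f).obj V' := fun _ h => h.2
        refine ⟨V ⊓ V', k.trans h, (fres OY (inf_le_right : V ⊓ V' ≤ V') m' : Fn OY (V ⊓ V')) • res M (inf_le_left : V ⊓ V' ≤ V) m, ⟨hV, hV'⟩, ?_⟩
        rw [map_smulₛₗ, map_smulₛₗ, eta_res f φ _ k, pullFn_res f φ _ k', e, e', res_res, fres_fres] }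
  obtain ⟨C, q, h0, h1⟩ := exists_quotient _ G (fun {V W} h a ha x hx => by
    obtain ⟨V', k, m, hV', e⟩ := ha x (h hx)
    obtain ⟨V'', hV'', h''⟩ := hf W x hx
    have k' : (Opens.map f).obj (V' ⊓ V'') ≤ (Opens.map f).obj V' := fun _ h => h.1
    have k'' : (Opens.map f).obj (V' ⊓ V'') ≤ (Opens.map f).obj V'' := fun _ h => h.2
    refine ⟨V' ⊓ V'', k''.trans h'', res M inf_le_left m, ⟨hV', hV''⟩, ?_⟩
    rw [eta_res f φ _ k', e, res_res, res_res])
  -- The quotient of `f^* M` by the sections coming locally from `M` kills the unit, hence is zero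
  -- by adjunction.
  have hq : q = 0 := by
    refine ((pullPushAdj f φ).homEquiv _ _).injective (hom_ext_sections fun V m => ?_)
    refine (app_homEquiv f φ q V m).trans (Eq.trans ?_ (app_homEquiv f φ 0 V m).symm)
    rw [app_zero]
    exact h0 _ _ fun x hx => ⟨V, le_rfl, m, hx, (res_self _ _).symm⟩
  obtain ⟨W', k, hW', e⟩ := h1 W m (by rw [hq, app_zero]) x hx
  obtain ⟨V, h, b, hV, e'⟩ := e x hW'
  exact ⟨V, h.trans k, b, hV, e'.trans (res_res _ _ _)⟩

end Pull

/-! ### Functions on the vanishing locus. -/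

section VanishingLocus

variable {X : TopCat.{0}} {O : Sheaf (Opens.grothendieckTopology X) CommRingCat.{0}}
  {E : ModuleSheaf O} (s : E ⟶ structureModule O)

theorem pullFn_cosec {V : Opens X} (m : Sec E V) :
    pullFn (incl s) (inclRingHom s) V (cosec s V m) = 0 := by
  have h : (toQuotient s).app (op V) (cosec s V m) = 0 :=
    Ideal.Quotient.eq_zero_iff_mem.2 ⟨m, rfl⟩
  let u := (TopCat.Presheaf.pullbackPushforwardAdjunction CommRingCat.{0} (incl s)).unit.app (quotientPresheaf s) ≫
    Functor.whiskerLeft (Opens.map (incl s)).op (toSheafify (Opens.grothendieckTopology (VanishingLocus s)) ((TopCat.Presheaf.pullback CommRingCat.{0} (incl s)).obj (quotientPresheaf s)))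
  change (u.app (op V)) ((toQuotient s).app (op V) (cosec s V m)) = 0
  rw [h, map_zero]

theorem exists_open_of_vanishingLocus (W : Opens (VanishingLocus s)) :
    ∃ V : Opens X, (Opens.map (incl s)).obj V = W := by
  obtain ⟨V, hV, h⟩ := isOpen_induced_iff.1 W.2
  exact ⟨⟨V, hV⟩, Opens.ext h⟩

/-- A function on `X` whose restriction to the vanishing locus is zero is locally in the ideal. -/
theorem exists_cosec_of_pullFn_eq_zero {V : Opens X} (a : Fn O V)
    (h : pullFn (incl s) (inclRingHom s) V a = 0) (t : VanishingLocus s)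
    (ht : t ∈ (Opens.map (incl s)).obj V) :
    ∃ (W : Opens X) (k : W ≤ V) (m : Sec E W), t ∈ (Opens.map (incl s)).obj W ∧
      cosec s W m = fres O k a := by
  let Q := quotientPresheaf s
  let P := (TopCat.Presheaf.pullback CommRingCat.{0} (incl s)).obj Q
  let T := toSheafify (Opens.grothendieckTopology (VanishingLocus s)) P
  let u := (TopCat.Presheaf.pullbackPushforwardAdjunction CommRingCat.{0} (incl s)).unit.app Q
  have : Presheaf.IsLocallyInjective (Opens.grothendieckTopology (VanishingLocus s)) T :=
    Presheaf.isLocallyInjective_toSheafify' _ P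
  let b : P.obj (op ((Opens.map (incl s)).obj V)) := u.app (op V) ((toQuotient s).app (op V) a)
  have hb : T.app _ b = T.app _ 0 := Eq.trans h (map_zero (T.app _).hom).symm
  obtain ⟨W, k, hk, hW⟩ := Presheaf.equalizerSieve_mem (Opens.grothendieckTopology (VanishingLocus s)) T b 0 hb t ht
  have h0 : TopCat.Presheaf.germ P _ t ht b = 0 := by
    rw [← TopCat.Presheaf.germ_res_apply P k t hW b]
    have : P.map k.op b = 0 := Eq.trans (b := P.map k.op 0) hk (map_zero (P.map k.op).hom)
    rw [this]
    exact map_zero (TopCat.Presheaf.germ P _ t hW).hom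
  -- Stalks of the inverse image presheaf are stalks of `O / s(E)`, so the vanishing is transferred
  -- to germs on the ambient space.
  have h1 : TopCat.Presheaf.germ Q V (incl s t) ht ((toQuotient s).app (op V) a) = 0 := by
    have e : (TopCat.Presheaf.stalkPullbackHom CommRingCat.{0} (incl s) Q t)
       (TopCat.Presheaf.germ Q V (incl s t) ht ((toQuotient s).app (op V) a)) = 0 := by
      have := congrArg (fun g => g.hom ((toQuotient s).app (op V) a))
        (TopCat.Presheaf.germ_stalkPullbackHom CommRingCat.{0} (incl s) Q t V ht)
      exact this.trans h0
    have : Function.Injective (TopCat.Presheaf.stalkPullbackIso CommRingCat.{0} (incl s) Q t).hom :=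
      ConcreteCategory.injective_of_mono_of_preservesPullback _
    exact this (Eq.trans e (map_zero (TopCat.Presheaf.stalkPullbackIso CommRingCat.{0} (incl s) Q t).hom.hom).symm)
  obtain ⟨W, hW, i, i', e⟩ := TopCat.Presheaf.germ_eq Q (incl s t) ht ht _ 0
    (h1.trans (map_zero (TopCat.Presheaf.germ Q V (incl s t) ht).hom).symm)
  have e' : (Ideal.Quotient.mk (sectIdeal s (op W))) (fres O i.le a) = 0 := e.trans (map_zero (Q.map i'.op).hom)
  obtain ⟨m, hm⟩ := Ideal.Quotient.eq_zero_iff_mem.1 e'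
  exact ⟨W, i.le, m, hW, hm⟩

/-- Functions on the vanishing locus come locally from functions on `X`. -/
theorem exists_pullFn (W : Opens (VanishingLocus s)) (a : Fn (vanishingSheaf s) W)
    (t : VanishingLocus s) (ht : t ∈ W) :
    ∃ (V : Opens X) (h : (Opens.map (incl s)).obj V ≤ W) (b : Fn O V),
      t ∈ (Opens.map (incl s)).obj V ∧
      pullFn (incl s) (inclRingHom s) V b = fres (vanishingSheaf s) h a := by
  let Q := quotientPresheaf s
  let P := (TopCat.Presheaf.pullback CommRingCat.{0} (incl s)).obj Q
  let T := toSheafify (Opens.grothendieckTopology (VanishingLocus s)) P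
  let u := (TopCat.Presheaf.pullbackPushforwardAdjunction CommRingCat.{0} (incl s)).unit.app Q
  have : Presheaf.IsLocallySurjective (Opens.grothendieckTopology (VanishingLocus s)) T :=
    Presheaf.isLocallySurjective_toSheafify' _ P
  obtain ⟨W', k, ⟨a', ha'⟩, hW'⟩ := Presheaf.imageSieve_mem (Opens.grothendieckTopology (VanishingLocus s)) T a t ht
  have hsurj : Function.Surjective (TopCat.Presheaf.stalkPullbackIso CommRingCat.{0} (incl s) Q t).hom :=
    fun c => ⟨(TopCat.Presheaf.stalkPullbackIso CommRingCat.{0} (incl s) Q t).inv c, by simp⟩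
  -- By the same comparison of stalks, the germ of a function on the locus is the germ of a class in
  -- some `O(V) / s(E(V))`, which is then lifted to `O(V)`.
  obtain ⟨c, hc⟩ := hsurj (TopCat.Presheaf.germ P W' t hW' a')
  obtain ⟨V, hV, q, rfl⟩ := TopCat.Presheaf.exists_germ_eq Q c
  have e : TopCat.Presheaf.germ P ((Opens.map (incl s)).obj V) t hV (u.app (op V) q) =
      TopCat.Presheaf.germ P W' t hW' a' := by
    have := congrArg (fun g => g.hom q)
        (TopCat.Presheaf.germ_stalkPullbackHom CommRingCat.{0} (incl s) Q t V hV)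
    exact this.symm.trans hc
  obtain ⟨W'', hW'', i, i', e'⟩ := TopCat.Presheaf.germ_eq P t hV hW' _ _ e
  obtain ⟨V', rfl⟩ := exists_open_of_vanishingLocus s W''
  obtain ⟨b, hb⟩ := Ideal.Quotient.mk_surjective q
  have k₁ : (Opens.map (incl s)).obj (V ⊓ V') ≤ (Opens.map (incl s)).obj V' := fun _ h => h.2
  have k₂ : (Opens.map (incl s)).obj (V ⊓ V') ≤ (Opens.map (incl s)).obj V := fun _ h => h.1
  refine ⟨V ⊓ V', k₁.trans (i'.le.trans k.le), fres O inf_le_left b, ⟨hV, hW''⟩, ?_⟩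
  rw [pullFn_res _ _ _ k₂]
  have e₁ : pullFn (incl s) (inclRingHom s) V b = T.app _ (u.app (op V) q) := by
    subst hb
    rfl
  have e₂ : fres (vanishingSheaf s) i.le (T.app _ (u.app (op V) q)) =
      fres (vanishingSheaf s) i'.le (T.app _ a') := by
    have n₁ := congrArg (fun g => g.hom (u.app (op V) q)) (T.naturality i.op)
    have n₂ := congrArg (fun g => g.hom a') (T.naturality i'.op)
    exact n₁.symm.trans ((congrArg (T.app _) e').trans n₂)
  have e₃ : T.app _ a' = fres (vanishingSheaf s) k.le a := ha'
  rw [e₃, fres_fres] at e₂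
  have e₄ := fres_fres (O := vanishingSheaf s) i.le k₁ (pullFn (incl s) (inclRingHom s) V b)
  rw [← e₄, e₁]
  exact (congrArg (fres (vanishingSheaf s) k₁) e₂).trans (fres_fres _ _ _)

end VanishingLocus

/-! ### Coordinates on exterior powers of free modules. -/

section Algebra

open Module

variable {A B : Type*} [CommRing A] [CommRing B] {φ : A →+* B}
  {M N : Type*} [AddCommGroup M] [Module A M] [AddCommGroup N] [Module B N]

/-- A semilinear map carrying one basis to the other carries the induced bases of `⋀^p` to each
other, so it acts on coordinates through `φ`. -/
theorem extMap_repr {I : Type*} [LinearOrder I] {b : Basis I A M} {b' : Basis I B N}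
    {l : M →ₛₗ[φ] N} (hl : ∀ i, l (b i) = b' i) (p : ℕ) (z : ⋀[A]^p M)
    (K : Set.powersetCard I p) :
    (b'.exteriorPower p).repr (extMap p l z) K = φ ((b.exteriorPower p).repr z K) := by
  classical
  have hK (K : Set.powersetCard I p) : extMap p l (b.exteriorPower p K) = b'.exteriorPower p K := by
    rw [exteriorPower.basis_apply, exteriorPower.basis_apply, exteriorPower.ιMulti_family,
      extMap_ιMulti, exteriorPower.ιMulti_family]
    exact congrArg _ (funext fun i => hl _)
  induction (b.exteriorPower p).mem_span z using Submodule.span_induction with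
  | zero => simp
  | mem x hx =>
    obtain ⟨K', rfl⟩ := hx
    rw [hK, Basis.repr_self, Basis.repr_self, Finsupp.single_apply, Finsupp.single_apply]
    split_ifs <;> simp
  | add x y _ _ hx hy => simp [hx, hy]
  | smul a x _ hx => simp [hx]

end Algebra

/-! ### Coordinates in local frames. -/

section Frame

open Module

variable {X : TopCat.{0}} {O : Sheaf (Opens.grothendieckTopology X) CommRingCat.{0}}
  {E : ModuleSheaf O} {U : Opens X} {d : ℕ}

/-- The basis of `E(V)` given by a local frame of `E` over `U`, for `V ⊆ U`. -/
def frameBasis {e : Fin d → Sec E U} (he : IsLocalFrame E U e) {V : Opens X} (h : V ≤ U) :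
    Basis (Fin d) (Fn O V) (Sec E V) :=
  Basis.mk (v := fun i => res E h (e i))
    (by
      rw [Fintype.linearIndependent_iff]
      intro g hg i
      exact congrFun ((he V h).1 (hg.trans (Eq.symm (by simp : ∑ i, (0 : Fin d → Fn O V) i • res E h (e i) = 0)))) i)
    (by
      intro m _
      obtain ⟨a, rfl⟩ := (he V h).2 m
      exact Submodule.sum_mem _ fun i _ => Submodule.smul_mem _ _ (Submodule.subset_span ⟨i, rfl⟩))

theorem frameBasis_apply {e : Fin d → Sec E U} (he : IsLocalFrame E U e) {V : Opens X} (h : V ≤ U)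
    (i : Fin d) : frameBasis he h i = res E h (e i) :=
  Basis.mk_apply _ _ _

theorem frameBasis_res {e : Fin d → Sec E U} (he : IsLocalFrame E U e) {V W : Opens X} (h : V ≤ U)
    (k : W ≤ V) (i : Fin d) : res E k (frameBasis he h i) = frameBasis he (k.trans h) i := by
  rw [frameBasis_apply, frameBasis_apply, res_res]

theorem frameBasis_repr_res {e : Fin d → Sec E U} (he : IsLocalFrame E U e) {V W : Opens X}
    (h : V ≤ U) (k : W ≤ V) (m : Sec E V) (i : Fin d) :
    (frameBasis he (k.trans h)).repr (res E k m) i = fres O k ((frameBasis he h).repr m i) := by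
  have h1 : res E k m = ∑ i, fres O k ((frameBasis he h).repr m i) • frameBasis he (k.trans h) i := by
    conv_lhs => rw [← (frameBasis he h).sum_repr m]
    rw [map_sum]
    refine Finset.sum_congr rfl fun i _ => ?_
    rw [map_smulₛₗ, frameBasis_res]
  rw [h1, Basis.repr_sum_self]

/-- The coordinates of sections in a local frame, as elements of a ring `S`. -/
def frameCoord {e : Fin d → Sec E U} (he : IsLocalFrame E U e) {S : Type*} [CommRing S]
    {V : Opens X} (h : V ≤ U) (ρ : Fn O V →+* S) : Sec E V →ₛₗ[ρ] (Fin d → S) where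
  toFun m i := ρ ((frameBasis he h).repr m i)
  map_add' a b := funext fun i => by simp
  map_smul' a b := funext fun i => by simp

theorem frameCoord_basis {e : Fin d → Sec E U} (he : IsLocalFrame E U e) {S : Type*} [CommRing S]
    {V : Opens X} (h : V ≤ U) (ρ : Fn O V →+* S) (i : Fin d) :
    frameCoord he h ρ (frameBasis he h i) = Pi.basisFun S (Fin d) i := by
  ext k
  simp [frameCoord, Finsupp.single_apply, Pi.single_apply, eq_comm]

end Frame

/-! ### Stalks of the vanishing locus, and the kernel of restriction to it. -/

section VanishingLocus

variable {X : TopCat.{0}} {O : Sheaf (Opens.grothendieckTopology X) CommRingCat.{0}}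
  {E : ModuleSheaf O} (s : E ⟶ structureModule O)

/-- The trace on the vanishing locus of an open subset. -/
abbrev trace (V : Opens X) : Opens (VanishingLocus s) := (Opens.map (incl s)).obj V

theorem trace_mono {V W : Opens X} (h : V ≤ W) : trace s V ≤ trace s W := fun _ hx => h hx

/-- The value in the stalk of the vanishing locus of a function. -/
def traceGerm {t : VanishingLocus s} {V : Opens X} (hV : t ∈ trace s V) :
    Fn O V →+* stalkRing (vanishingSheaf s) t :=
  (germAt (vanishingSheaf s) hV).comp (pullFn (incl s) (inclRingHom s) V)

theorem traceGerm_fres {t : VanishingLocus s} {V W : Opens X} (h : W ≤ V) (hW : t ∈ trace s W)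
    (a : Fn O V) : traceGerm s hW (fres O h a) = traceGerm s (trace_mono s h hW) a := by
  rw [traceGerm, RingHom.comp_apply, pullFn_res _ _ h (trace_mono s h), germAt_fres]
  rfl

theorem traceGerm_cosec {t : VanishingLocus s} {V : Opens X} (hV : t ∈ trace s V) (m : Sec E V) :
    traceGerm s hV (cosec s V m) = 0 := by
  rw [traceGerm, RingHom.comp_apply, pullFn_cosec, map_zero]

theorem exists_cosec_of_traceGerm_eq_zero {t : VanishingLocus s} {V : Opens X} (hV : t ∈ trace s V)
    (a : Fn O V) (h : traceGerm s hV a = 0) :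
    ∃ (W : Opens X) (k : W ≤ V) (m : Sec E W), t ∈ trace s W ∧ cosec s W m = fres O k a := by
  obtain ⟨W, k, hW, e⟩ := exists_fres_eq_zero hV _ h
  obtain ⟨W, rfl⟩ := exists_open_of_vanishingLocus s W
  have e' : pullFn (incl s) (inclRingHom s) (W ⊓ V) (fres O inf_le_right a) = 0 := by
    rw [pullFn_res _ _ _ (trace_mono s inf_le_right),
      ← fres_fres k (trace_mono s (inf_le_left : W ⊓ V ≤ W)), e, map_zero]
  obtain ⟨W', k', m, hW', hm⟩ := exists_cosec_of_pullFn_eq_zero s _ e' t ⟨hW, hV⟩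
  exact ⟨W', k'.trans inf_le_right, m, hW', by rw [hm, fres_fres]⟩

theorem exists_traceGerm {t : VanishingLocus s} (c : stalkRing (vanishingSheaf s) t) :
    ∃ (V : Opens X) (hV : t ∈ trace s V) (a : Fn O V), traceGerm s hV a = c := by
  obtain ⟨W, hW, a, rfl⟩ := exists_germAt c
  obtain ⟨V, k, b, hV, e⟩ := exists_pullFn s W a t hW
  refine ⟨V, hV, b, ?_⟩
  rw [traceGerm, RingHom.comp_apply, e, germAt_fres]

theorem germAt_cosec_mem {t : X} {V : Opens X} (ht : t ∈ V) (m : Sec E V) :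
    germAt O ht (cosec s V m) ∈ imageStalk s t :=
  Ideal.subset_span ⟨V, ht, m, rfl⟩

theorem exists_of_mem_imageStalk {t : X} {c : stalkRing O t} (hc : c ∈ imageStalk s t) :
    ∃ (V : Opens X) (ht : t ∈ V) (m : Sec E V), germAt O ht (cosec s V m) = c := by
  induction hc using Submodule.span_induction with
  | mem x hx =>
    obtain ⟨V, ht, m, e⟩ := hx
    exact ⟨V, ht, m, e.symm⟩
  | zero => exact ⟨⊤, trivial, 0, by rw [map_zero, map_zero]⟩
  | add x y _ _ hx hy =>
    obtain ⟨V, ht, m, rfl⟩ := hx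
    obtain ⟨V', ht', m', rfl⟩ := hy
    have hm : t ∈ V ⊓ V' := ⟨ht, ht'⟩
    refine ⟨V ⊓ V', hm, res E inf_le_left m + res E inf_le_right m', ?_⟩
    rw [map_add, map_add, cosec_res, cosec_res, germAt_fres, germAt_fres]
  | smul a x _ hx =>
    obtain ⟨V, ht, m, rfl⟩ := hx
    obtain ⟨V', ht', a, rfl⟩ := exists_germAt a
    have hm : t ∈ V ⊓ V' := ⟨ht, ht'⟩
    refine ⟨V ⊓ V', hm, fres O (inf_le_right : V ⊓ V' ≤ V') a • res E inf_le_left m, ?_⟩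
    rw [map_smul, cosec_res, smul_eq_mul, smul_eq_mul, map_mul, germAt_fres, germAt_fres]

/-- The map `O_t → O_{T, t}`. -/
def stalkMap (t : VanishingLocus s) :
    stalkRing O (incl s t) →+* stalkRing (vanishingSheaf s) t :=
  let φ : underlyingPresheaf O ⟶
    (TopCat.Presheaf.pushforward CommRingCat.{0} (incl s)).obj (underlyingPresheaf (vanishingSheaf s)) :=
    (inclRingHom s).hom
  ((TopCat.Presheaf.stalkFunctor CommRingCat (incl s t)).map φ ≫
    TopCat.Presheaf.stalkPushforward CommRingCat (incl s) (underlyingPresheaf (vanishingSheaf s)) t).hom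

theorem stalkMap_germAt {t : VanishingLocus s} {V : Opens X} (hV : t ∈ trace s V) (a : Fn O V) :
    stalkMap s t (germAt O (x := incl s t) hV a) = traceGerm s hV a := by
  let φ : underlyingPresheaf O ⟶
    (TopCat.Presheaf.pushforward CommRingCat.{0} (incl s)).obj (underlyingPresheaf (vanishingSheaf s)) :=
    (inclRingHom s).hom
  have hV' : incl s t ∈ V := hV
  have h : TopCat.Presheaf.germ (underlyingPresheaf O) V (incl s t) hV' ≫
      (TopCat.Presheaf.stalkFunctor CommRingCat (incl s t)).map φ ≫
      TopCat.Presheaf.stalkPushforward CommRingCat (incl s) (underlyingPresheaf (vanishingSheaf s)) t =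
      φ.app (op V) ≫ TopCat.Presheaf.germ (underlyingPresheaf (vanishingSheaf s)) _ t hV := by
    refine (TopCat.Presheaf.stalkFunctor_map_germ_assoc V (incl s t) hV' φ _).trans ?_
    exact congrArg _ (TopCat.Presheaf.stalkPushforward_germ CommRingCat (incl s)
      (underlyingPresheaf (vanishingSheaf s)) V t hV')
  exact congrArg (fun g => g.hom a) h

theorem ker_stalkMap (t : VanishingLocus s) :
    RingHom.ker (stalkMap s t) = imageStalk s (incl s t) := by
  ext c
  rw [RingHom.mem_ker]
  constructor
  · intro h
    obtain ⟨V, hV, a, rfl⟩ := exists_germAt c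
    obtain ⟨W, k, m, hW, e⟩ := exists_cosec_of_traceGerm_eq_zero s (t := t) hV a
      ((stalkMap_germAt s hV a).symm.trans h)
    rw [← germAt_fres k hW, ← e]
    exact germAt_cosec_mem s _ _
  · intro h
    obtain ⟨V, hV, m, rfl⟩ := exists_of_mem_imageStalk s h
    exact (stalkMap_germAt s hV _).trans (traceGerm_cosec s _ _)

theorem stalkMap_surjective (t : VanishingLocus s) : Function.Surjective (stalkMap s t) := by
  intro c
  obtain ⟨V, hV, a, rfl⟩ := exists_traceGerm s c
  exact ⟨_, stalkMap_germAt s hV a⟩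

/-- The map `O_{T,t} → O_t / I_t`, inverse to the one induced by `O_t → O_{T,t}`. -/
def stalkEval (t : VanishingLocus s) : stalkRing (vanishingSheaf s) t →+*
    stalkRing O (incl s t) ⧸ imageStalk s (incl s t) :=
  (Ideal.quotEquivOfEq (ker_stalkMap s t)).toRingHom.comp
    (RingHom.quotientKerEquivOfSurjective (stalkMap_surjective s t)).symm.toRingHom

theorem stalkEval_traceGerm {t : VanishingLocus s} {V : Opens X} (hV : t ∈ trace s V) (a : Fn O V) :
    stalkEval s t (traceGerm s hV a) = Ideal.Quotient.mk _ (germAt O (x := incl s t) hV a) := by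
  rw [← stalkMap_germAt]
  have : (RingHom.quotientKerEquivOfSurjective (stalkMap_surjective s t)).symm
      (stalkMap s t (germAt O (x := incl s t) hV a)) =
      Ideal.Quotient.mk _ (germAt O (x := incl s t) hV a) := by
    rw [RingEquiv.symm_apply_eq]
    rfl
  exact congrArg (Ideal.quotEquivOfEq (ker_stalkMap s t)) this

/-- The unit `M → j_* j^* M`. -/
abbrev toTrace (M : ModuleSheaf O) (V : Opens X) :
    Sec M V →ₛₗ[pullFn (incl s) (inclRingHom s) V] Sec ((restrictToT s).obj M) (trace s V) :=
  eta (incl s) (inclRingHom s) M V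

theorem exists_toTrace (M : ModuleSheaf O) {W : Opens (VanishingLocus s)}
    (m : Sec ((restrictToT s).obj M) W) {t : VanishingLocus s} (ht : t ∈ W) :
    ∃ (V : Opens X) (h : trace s V ≤ W) (b : Sec M V), t ∈ trace s V ∧
      toTrace s M V b = res _ h m :=
  exists_eta (incl s) (inclRingHom s)
    (fun W x hx => by
      obtain ⟨V, rfl⟩ := exists_open_of_vanishingLocus s W
      exact ⟨V, hx, le_rfl⟩)
    (fun W a x hx => exists_pullFn s W a x hx) M m ht

/-- The submodule `I M(V)`, where `I = s(E(V))`. -/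
def idealMul {M : Type*} [AddCommGroup M] (V : Opens X) [Module (Fn O V) M] :
    Submodule (Fn O V) M := (LinearMap.range (cosec s V) : Ideal (Fn O V)) • ⊤

theorem smul_mem_idealMul {M : Type*} [AddCommGroup M] {V : Opens X} [Module (Fn O V) M]
    (m : Sec E V) (x : M) : cosec s V m • x ∈ idealMul s (M := M) V :=
  Submodule.smul_mem_smul ⟨m, rfl⟩ trivial

theorem map_mem_idealMul {M N : Type*} [AddCommGroup M] [AddCommGroup N] {V W : Opens X}
    [Module (Fn O V) M] [Module (Fn O W) N] (h : W ≤ V) (f : M →ₛₗ[fres O h] N) {x : M}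
    (hx : x ∈ idealMul s (M := M) V) : f x ∈ idealMul s (M := N) W := by
  refine Submodule.smul_induction_on hx ?_ ?_
  · rintro _ ⟨m, rfl⟩ n -
    rw [map_smulₛₗ, ← cosec_res]
    exact smul_mem_idealMul s _ _
  · intro x y hx hy
    rw [map_add]
    exact add_mem hx hy

/-- Finitely many functions which vanish on the vanishing locus near `t` are in the ideal, on a common
neighbourhood. -/
theorem exists_cosec_of_finite {ι : Type*} [Finite ι] {t : VanishingLocus s} {V : Opens X}
    (hV : t ∈ trace s V) (a : ι → Fn O V) (h : ∀ i, traceGerm s hV (a i) = 0) :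
    ∃ (W : Opens X) (k : W ≤ V), t ∈ trace s W ∧
      ∀ i, fres O k (a i) ∈ LinearMap.range (cosec s W) := by
  choose W k m hW hm using fun i => exists_cosec_of_traceGerm_eq_zero s hV (a i) (h i)
  have hfin : IsOpen (⋂ i, (W i : Set X)) := isOpen_iInter_of_finite fun i => (W i).2
  let W' : Opens X := V ⊓ ⟨_, hfin⟩
  have hW' (i) : W' ≤ W i := fun x hx => Set.mem_iInter.1 hx.2 i
  refine ⟨W', inf_le_left, ⟨hV, Set.mem_iInter.2 hW⟩, fun i => ⟨res E (hW' i) (m i), ?_⟩⟩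
  rw [cosec_res, hm, fres_fres]

/-- The kernel of `⋀^p E(V) → ⋀^p (j^* E)(V ∩ T)` is locally `I ⋀^p E`. -/
theorem exists_mem_idealMul_of_extMap_toTrace_eq_zero (hE : IsVectorBundle E) {p : ℕ}
    {V : Opens X} (z : ⋀[Fn O V]^p (Sec E V)) (hz : extMap p (toTrace s E V) z = 0)
    {t : VanishingLocus s} (ht : t ∈ trace s V) :
    ∃ (W : Opens X) (k : W ≤ V), t ∈ trace s W ∧
      extMap p (res E k) z ∈ idealMul s (M := ⋀[Fn O W]^p (Sec E W)) W := by
  obtain ⟨U, hU, d, (e : Fin d → Sec E U), he⟩ := hE (incl s t)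
  have hVU {V : Opens X} (hV : t ∈ trace s V) : t ∈ trace s (V ⊓ U) := ⟨hV, hU⟩
  -- Coordinates in a frame, read in `O_{T,t}`, extend to the sections of `j^* E`. So the
  -- coordinates of `z` vanish in `O_{T,t}`, and these finitely many functions lie in the ideal near
  -- `t`.
  let l (V : Opens X) (hV : t ∈ trace s V) :
      Sec E V →ₛₗ[traceGerm s hV] (Fin d → stalkRing (vanishingSheaf s) t) :=
    { toFun := fun m => frameCoord he (inf_le_right : V ⊓ U ≤ U) (traceGerm s (hVU hV))
        (res E inf_le_left m)
      map_add' := fun a b => by rw [map_add, map_add]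
      map_smul' := fun a b => by rw [map_smulₛₗ, map_smulₛₗ, traceGerm_fres] }
  obtain ⟨L, hL, hL'⟩ := exists_extension (incl s) (inclRingHom s) E t
    (Fin d → stalkRing (vanishingSheaf s) t) l
    (fun {V W} h hW m => by
      funext i
      change traceGerm s _ ((frameBasis he _).repr _ i) = traceGerm s _ ((frameBasis he _).repr _ i)
      rw [← traceGerm_fres s (inf_le_inf_right U h) (hVU hW), ← frameBasis_repr_res, res_res, res_res])
  have h1 : extMap p (frameCoord he (inf_le_right : V ⊓ U ≤ U) (traceGerm s (hVU ht)))
      (extMap p (res E inf_le_left) z) = 0 := by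
    have h2 : extMap p (l V ht) z = 0 :=
      (extMap_comp p rfl (l V ht) (L _ ht) (toTrace s E V) (fun m => (hL' V ht m).symm) z).trans
        ((congrArg _ hz).trans (map_zero _))
    rw [← h2]
    exact (extMap_comp p (RingHom.ext fun a => traceGerm_fres s inf_le_left (hVU ht) a)
      (l V ht) (frameCoord he (inf_le_right : V ⊓ U ≤ U) (traceGerm s (hVU ht)))
      (res E inf_le_left) (fun m => rfl) z).symm
  set z' := extMap p (res E (inf_le_left : V ⊓ U ≤ V)) z with hz'
  let B := (frameBasis he (inf_le_right : V ⊓ U ≤ U)).exteriorPower p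
  obtain ⟨W, k, hW, H⟩ := exists_cosec_of_finite s (hVU ht) (fun K => B.repr z' K) (fun K => by
    rw [← extMap_repr (fun i => frameCoord_basis he _ (traceGerm s (hVU ht)) i), h1]
    simp)
  refine ⟨W, k.trans inf_le_left, hW, ?_⟩
  rw [← extMap_res_res inf_le_left k, ← hz', ← B.sum_repr z', map_sum]
  refine Submodule.sum_mem _ fun K _ => ?_
  rw [map_smulₛₗ]
  exact Submodule.smul_mem_smul (H K) trivial

end VanishingLocus

/-! ### The conormal sheaf. -/

section Conormal

variable {X : TopCat.{0}} {O : Sheaf (Opens.grothendieckTopology X) CommRingCat.{0}}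
  {E : ModuleSheaf O} (s : E ⟶ structureModule O)

/-- The inclusion of the ideal sheaf `s(E)`, on sections. -/
def idealInclusion (V : Opens X) : Sec (Limits.image s) V →ₗ[Fn O V] Fn O V := app (image.ι s) V

theorem idealInclusion_res {V W : Opens X} (h : W ≤ V) (a : Sec (Limits.image s) V) :
    idealInclusion s W (res _ h a) = fres O h (idealInclusion s V a) :=
  app_res (image.ι s) h a

theorem idealInclusion_factorThruImage {V : Opens X} (m : Sec E V) :
    idealInclusion s V (app (factorThruImage s) V m) = cosec s V m :=
  congrArg (fun f => app f V m) (image.fac s)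

theorem germAt_idealInclusion_mem {V : Opens X} {t : X} (ht : t ∈ V) (a : Sec (Limits.image s) V) :
    germAt O ht (idealInclusion s V a) ∈ imageStalk s t := by
  obtain ⟨W, h, m, hW, e⟩ := locSurj_of_epi (factorThruImage s) V a t ht
  rw [← germAt_fres h hW, ← idealInclusion_res, ← e, idealInclusion_factorThruImage]
  exact germAt_cosec_mem s hW m

/-- A product `s(m) s(m')` is the value of `s` on `s(m) m'`, which lies in `I E`. -/
theorem exists_of_mem_imageStalk_sq {t : X} {c : stalkRing O t} (hc : c ∈ imageStalk s t ^ 2) :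
    ∃ (V : Opens X) (ht : t ∈ V) (m : Sec E V), m ∈ idealMul s (M := Sec E V) V ∧
      germAt O ht (cosec s V m) = c := by
  rw [pow_two] at hc
  induction hc using Submodule.mul_induction_on' with
  | mem_mul_mem a ha b hb =>
    obtain ⟨V, ht, m, rfl⟩ := exists_of_mem_imageStalk s ha
    obtain ⟨V', ht', m', rfl⟩ := exists_of_mem_imageStalk s hb
    have hm : t ∈ V ⊓ V' := ⟨ht, ht'⟩
    refine ⟨V ⊓ V', hm, cosec s (V ⊓ V') (res E inf_le_left m) • res E inf_le_right m',
      smul_mem_idealMul s _ _, ?_⟩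
    rw [map_smul, cosec_res, cosec_res, smul_eq_mul, map_mul, germAt_fres, germAt_fres]
  | add a _ b _ ha hb =>
    obtain ⟨V, ht, m, hm, rfl⟩ := ha
    obtain ⟨V', ht', m', hm', rfl⟩ := hb
    have hx : t ∈ V ⊓ V' := ⟨ht, ht'⟩
    refine ⟨V ⊓ V', hx, res E inf_le_left m + res E inf_le_right m',
      add_mem (map_mem_idealMul s _ _ hm) (map_mem_idealMul s _ _ hm'), ?_⟩
    rw [map_add, map_add, cosec_res, cosec_res, germAt_fres, germAt_fres]

/-- The stalk `I_t / I_t²` of the conormal sheaf. -/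
def ConormalStalk (t : VanishingLocus s) : Type := (imageStalk s (incl s t)).Cotangent

instance (t : VanishingLocus s) : AddCommGroup (ConormalStalk s t) :=
  inferInstanceAs (AddCommGroup (imageStalk s (incl s t)).Cotangent)

instance (t : VanishingLocus s) : Module (stalkRing (vanishingSheaf s) t) (ConormalStalk s t) :=
  Module.compHom (imageStalk s (incl s t)).Cotangent (stalkEval s t)

/-- The class in `I_t / I_t²` of an element of `I_t`. -/
def toConormalStalk (t : VanishingLocus s) (c : imageStalk s (incl s t)) : ConormalStalk s t :=
  (imageStalk s (incl s t)).toCotangent c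

theorem smul_toConormalStalk (t : VanishingLocus s) (c : imageStalk s (incl s t))
    (r : stalkRing (vanishingSheaf s) t) (a : stalkRing O (incl s t))
    (h : stalkEval s t r = Ideal.Quotient.mk _ a) :
    r • toConormalStalk s t c = toConormalStalk s t (a • c) :=
  (congrArg (fun r => (r • (imageStalk s (incl s t)).toCotangent c :
    (imageStalk s (incl s t)).Cotangent)) h).trans rfl

/-- The class of a section of the ideal sheaf in the stalk of the conormal sheaf. -/
def conormalGerm (t : VanishingLocus s) (V : Opens X) (hV : t ∈ trace s V) :
    Sec (Limits.image s) V →ₛₗ[traceGerm s hV] ConormalStalk s t where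
  toFun a := toConormalStalk s t
    ⟨germAt O (x := incl s t) hV (idealInclusion s V a), germAt_idealInclusion_mem s hV a⟩
  map_add' a b := by
    refine Eq.trans ?_ (map_add (imageStalk s (incl s t)).toCotangent _ _)
    refine congrArg (toConormalStalk s t) (Subtype.ext ?_)
    exact (congrArg _ (map_add (idealInclusion s V) a b)).trans (map_add (germAt O hV) _ _)
  map_smul' a b := by
    rw [smul_toConormalStalk s t _ _ _ (stalkEval_traceGerm s hV a)]
    refine congrArg (toConormalStalk s t) (Subtype.ext ?_)
    exact (congrArg _ (map_smul (idealInclusion s V) a b)).trans (map_mul (germAt O hV) _ _)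

/-- If `s m` is zero in the conormal sheaf, then locally `s m = s m'` with `m' ∈ I E`. -/
theorem exists_of_toConormal_eq_zero {V : Opens X} (m : Sec E V)
    (hm : app (toConormal s) _ (toTrace s E V m) = 0) {t : VanishingLocus s} (ht : t ∈ trace s V) :
    ∃ (W : Opens X) (k : W ≤ V) (m' : Sec E W), t ∈ trace s W ∧
      m' ∈ idealMul s (M := Sec E W) W ∧ cosec s W (res E k m) = cosec s W m' := by
  -- The class in `I_t / I_t²` extends to the sections of the conormal sheaf. Vanishing there thus
  -- puts the germ of `s m` in `I_t²`.
  obtain ⟨L, -, hL⟩ := exists_extension (incl s) (inclRingHom s) (Limits.image s) t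
    (ConormalStalk s t) (conormalGerm s t)
    (fun {V W} h hW m => congrArg (imageStalk s (incl s t)).toCotangent (Subtype.ext (by
      change germAt O _ (idealInclusion s W _) = germAt O _ (idealInclusion s V _)
      rw [idealInclusion_res]
      exact germAt_fres h hW _)))
  have h0 : conormalGerm s t V ht (app (factorThruImage s) V m) = 0 := by
    have : eta (incl s) (inclRingHom s) _ V (app (factorThruImage s) V m) = 0 :=
      (app_pull_map (incl s) (inclRingHom s) (factorThruImage s) V m).symm.trans hm
    exact (hL V ht _).symm.trans ((congrArg _ this).trans (map_zero _))
  have h1 : germAt O (x := incl s t) ht (idealInclusion s V (app (factorThruImage s) V m)) ∈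
      imageStalk s (incl s t) ^ 2 := (Ideal.toCotangent_eq_zero _ _).1 h0
  rw [idealInclusion_factorThruImage] at h1
  obtain ⟨V', ht', m', hm', e⟩ := exists_of_mem_imageStalk_sq s h1
  obtain ⟨W, k, k', hW, e'⟩ := exists_fres_eq ht' ht _ _ e
  exact ⟨W, k', res E k m', hW, map_mem_idealMul s _ _ hm', by
    rw [cosec_res, cosec_res, e']⟩

end Conormal

/-! ### Splittings of a cosection obtained from regular factorizations. -/

section Splitting

variable {X : TopCat.{0}} {O : Sheaf (Opens.grothendieckTopology X) CommRingCat.{0}}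
  {E : ModuleSheaf O}

/-- A splitting of a cosection over `U`: sections `x i` of `E` and dual linear forms `θ i` such that
`s = ∑ i, s (x i) θ i`. -/
structure Splitting (s : E ⟶ structureModule O) (U : Opens X) (d : ℕ) where
  /-- The sections. -/
  x : Fin d → Sec E U
  /-- The linear forms. -/
  θ : ∀ {V : Opens X}, V ≤ U → Fin d → Sec E V →ₗ[Fn O V] Fn O V
  θ_res : ∀ {V W : Opens X} (h : V ≤ U) (k : W ≤ V) (i : Fin d) (m : Sec E V),
    θ (k.trans h) i (res E k m) = fres O k (θ h i m)
  θ_x : ∀ {V : Opens X} (h : V ≤ U) (i k : Fin d), θ h i (res E h (x k)) = if i = k then 1 else 0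
  cosec_eq : ∀ {V : Opens X} (h : V ≤ U) (m : Sec E V),
    cosec s V m = ∑ i, θ h i m * cosec s V (res E h (x i))

/-- The splitting is regular at `t`. -/
def Splitting.IsRegularAt {s : E ⟶ structureModule O} {U : Opens X} {d : ℕ} (σ : Splitting s U d)
    {t : X} (ht : t ∈ U) : Prop :=
  RingTheory.Sequence.IsWeaklyRegular (stalkRing O t)
    (List.ofFn fun i => germAt O ht (cosec s U (σ.x i)))

section Restrict

variable (O) in
/-- The stalks of the restriction to an open subset. -/
def stalkRestrict (U : Opens X) (t : (Opens.toTopCat X).obj U) :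
    stalkRing (restrictSheaf O U) t ≃+* stalkRing O t.1 :=
  (AlgebraicGeometry.PresheafedSpace.restrictStalkIso
    (⟨X, underlyingPresheaf O⟩ : AlgebraicGeometry.PresheafedSpace CommRingCat.{0})
    U.isOpenEmbedding t).commRingCatIsoToRingEquiv

/-- An open subset of `U`, as an open subset of `X`. -/
abbrev extend (U : Opens X) (V : Opens ((Opens.toTopCat X).obj U)) : Opens X :=
  U.isOpenEmbedding.isOpenMap.functor.obj V

theorem extend_le (U : Opens X) (V : Opens ((Opens.toTopCat X).obj U)) : extend U V ≤ U := by
  rintro _ ⟨x, _, rfl⟩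
  exact x.2

theorem extend_mono (U : Opens X) {V W : Opens ((Opens.toTopCat X).obj U)} (h : V ≤ W) :
    extend U V ≤ extend U W := Set.image_mono h

theorem mem_extend {U : Opens X} {V : Opens ((Opens.toTopCat X).obj U)}
    {t : (Opens.toTopCat X).obj U} (ht : t ∈ V) : t.1 ∈ extend U V := ⟨t, ht, rfl⟩

/-- The trace on `U` of an open subset. -/
abbrev cut (U V : Opens X) : Opens ((Opens.toTopCat X).obj U) := (Opens.map U.inclusion').obj V

theorem extend_cut_le (U V : Opens X) : extend U (cut U V) ≤ V := by
  rintro _ ⟨x, hx, rfl⟩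
  exact hx

theorem le_extend_cut {U V : Opens X} (h : V ≤ U) : V ≤ extend U (cut U V) :=
  fun x hx => ⟨⟨x, h hx⟩, hx, rfl⟩

theorem cut_mono (U : Opens X) {V W : Opens X} (h : V ≤ W) : cut U V ≤ cut U W := fun _ hx => h hx

theorem cut_le {U V : Opens X} {W : Opens ((Opens.toTopCat X).obj U)} (h : V ≤ extend U W) :
    cut U V ≤ W := by
  intro x hx
  obtain ⟨y, hy, e⟩ := h hx
  rwa [← Subtype.ext e]

theorem stalkRestrict_germAt {U : Opens X} {V : Opens ((Opens.toTopCat X).obj U)}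
    {t : (Opens.toTopCat X).obj U} (ht : t ∈ V) (a : Fn O (extend U V)) :
    stalkRestrict O U t (germAt (restrictSheaf O U) ht a) = germAt O (mem_extend ht) a :=
  congrArg (fun g => g.hom a) (AlgebraicGeometry.PresheafedSpace.restrictStalkIso_hom_eq_germ
    (⟨X, underlyingPresheaf O⟩ : AlgebraicGeometry.PresheafedSpace CommRingCat.{0})
    U.isOpenEmbedding V t ht)

variable {U : Opens X} {E' : ModuleSheaf (restrictSheaf O U)}

/-- The restriction of functions to the trace on `U`. -/
def cutFn (O : Sheaf (Opens.grothendieckTopology X) CommRingCat.{0}) (U V : Opens X) :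
    Fn O V →+* Fn (restrictSheaf O U) (cut U V) :=
  fres O (extend_cut_le U V)

/-- A morphism from a restriction to `U`, on sections over open subsets of `X`. -/
def appCut (π : (restr U).obj E ⟶ E') (V : Opens X) : Sec E V →ₛₗ[cutFn O U V]
    Sec E' (cut U V) where
  toFun m := app π (cut U V) (res E (extend_cut_le U V) m)
  map_add' a b := by
    rw [map_add]
    exact map_add (app π (cut U V)) _ _
  map_smul' a b := by
    rw [map_smulₛₗ]
    exact map_smul (app π (cut U V)) _ _

theorem appCut_res (π : (restr U).obj E ⟶ E') {V W : Opens X} (h : W ≤ V) (m : Sec E V) :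
    appCut π W (res E h m) = res E' (cut_mono U h) (appCut π V m) := by
  have h1 := app_res π (cut_mono U h) (res E (extend_cut_le U V) m)
  refine Eq.trans (congrArg (app π (cut U W)) ?_) h1
  exact (res_res _ _ _).trans (res_res (M := E) (extend_cut_le U V) (extend_mono U (cut_mono U h)) m).symm

theorem fres_fres_self {V W : Opens X} (h : W ≤ V) (k : V ≤ W) (a : Fn O V) :
    fres O k (fres O h a) = a := by
  rw [fres_fres, fres_self]

/-- The inverse of `cutFn`. -/
def uncutFn (O : Sheaf (Opens.grothendieckTopology X) CommRingCat.{0}) {U V : Opens X} (h : V ≤ U) :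
    Fn (restrictSheaf O U) (cut U V) →+* Fn O V :=
  fres O (le_extend_cut h)

theorem uncutFn_cutFn {V : Opens X} (h : V ≤ U) (a : Fn O V) :
    uncutFn O h (cutFn O U V a) = a :=
  fres_fres_self _ _ a

theorem uncutFn_injective {V : Opens X} (h : V ≤ U) : Function.Injective (uncutFn O h) :=
  Function.LeftInverse.injective (g := cutFn O U V) fun a =>
    fres_fres_self (le_extend_cut h) (extend_cut_le U V) a

theorem uncutFn_fres {V W : Opens X} (h : V ≤ U) (k : W ≤ V)
    (a : Fn (restrictSheaf O U) (cut U V)) :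
    uncutFn O (k.trans h) (fres (restrictSheaf O U) (cut_mono U k) a) = fres O k (uncutFn O h a) :=
  (fres_fres (O := O) (extend_mono U (cut_mono U k)) (le_extend_cut (k.trans h)) a).trans
    (fres_fres (O := O) (le_extend_cut h) k a).symm

theorem cosec_appCut {s : E ⟶ structureModule O} {π : (restr U).obj E ⟶ E'}
    {s' : E' ⟶ structureModule (restrictSheaf O U)} (hπ : π ≫ s' = restrCosection s U)
    (V : Opens X) (m : Sec E V) : cosec s' (cut U V) (appCut π V m) = cutFn O U V (cosec s V m) := by
  have h := congrArg (fun f => app f (cut U V) (res E (extend_cut_le U V) m)) hπ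
  exact h.trans (cosec_res s (extend_cut_le U V) m)

/-- The `x i` are lifts of the frame through `π`, and `θ i m` is the coordinate of `π m`. The common
kernel of the `θ i` is the kernel of `π`, whatever the frame; the `s(x i)` have the same germs as
the components of `s'`, which carries regularity over. -/
theorem exists_splitting {s : E ⟶ structureModule O} (π : (restr U).obj E ⟶ E') [Epi π]
    {s' : E' ⟶ structureModule (restrictSheaf O U)} (hπ : π ≫ s' = restrCosection s U)
    {V₀ : Opens ((Opens.toTopCat X).obj U)} {d : ℕ} {e : Fin d → Sec E' V₀}
    (he : IsLocalFrame E' V₀ e) {t : (Opens.toTopCat X).obj U} (ht : t ∈ V₀) {N : Opens X}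
    (hN : t.1 ∈ N) :
    ∃ (W : Opens X) (_ : W ≤ U) (_ : W ≤ N) (hW : t.1 ∈ W) (σ : Splitting s W d),
      (∀ {V : Opens X} (h : V ≤ W) (m : Sec E V), (∀ i, σ.θ h i m = 0) ↔ appCut π V m = 0) ∧
      ∀ i, germAt O hW (cosec s W (σ.x i)) =
        stalkRestrict O U t (germAt (restrictSheaf O U) ht (cosec s' V₀ (e i))) := by
  choose W' hW' a htW' ha using fun i => locSurj_of_epi π V₀ (e i) t ht
  have hfin : IsOpen (⋂ i, (W' i : Set ((Opens.toTopCat X).obj U))) :=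
    isOpen_iInter_of_finite fun i => (W' i).2
  let W₀ : Opens ((Opens.toTopCat X).obj U) := (V₀ ⊓ cut U N) ⊓ ⟨_, hfin⟩
  have hW₀ (i) : W₀ ≤ W' i := fun x hx => Set.mem_iInter.1 hx.2 i
  have hV₀ : W₀ ≤ V₀ := fun x hx => hx.1.1
  have ht₀ : t ∈ W₀ := ⟨⟨ht, hN⟩, Set.mem_iInter.2 htW'⟩
  let x (i) : Sec E (extend U W₀) := res E (extend_mono U (hW₀ i)) (a i)
  have hc {V : Opens X} (h : V ≤ extend U W₀) : cut U V ≤ V₀ := (cut_le h).trans hV₀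
  have hU {V : Opens X} (h : V ≤ extend U W₀) : V ≤ U := h.trans (extend_le U W₀)
  have hx {V : Opens X} (h : V ≤ extend U W₀) (i) :
      appCut π V (res E h (x i)) = frameBasis he (hc h) i := by
    rw [frameBasis_apply]
    have h1 := app_res π ((cut_le h).trans (hW₀ i)) (a i)
    rw [ha, res_res] at h1
    refine Eq.trans (congrArg (app π (cut U V)) ?_) h1
    exact (congrArg _ (res_res _ _ _)).trans (res_res _ _ _)
  let θ {V : Opens X} (h : V ≤ extend U W₀) (i : Fin d) : Sec E V →ₗ[Fn O V] Fn O V :=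
    { toFun := fun m => uncutFn O (hU h) ((frameBasis he (hc h)).repr (appCut π V m) i)
      map_add' := fun m n => by
        rw [map_add, map_add, Finsupp.add_apply, map_add]
      map_smul' := fun r m => by
        rw [map_smulₛₗ, map_smul, Finsupp.smul_apply, smul_eq_mul, map_mul, uncutFn_cutFn]
        rfl }
  refine ⟨extend U W₀, extend_le U W₀, ?_, mem_extend ht₀,
    { x := x
      θ := θ
      θ_res := fun h k i m => ?_
      θ_x := fun h i k => ?_
      cosec_eq := fun {V} h m => ?_ }, fun {V} h m => ?_, fun i => ?_⟩
  · rintro _ ⟨y, hy, rfl⟩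
    exact hy.1.2
  · change uncutFn O _ ((frameBasis he _).repr (appCut π _ _) i) = _
    rw [appCut_res, frameBasis_repr_res he (hc h), uncutFn_fres (hU h) k]
    rfl
  · change uncutFn O _ ((frameBasis he _).repr (appCut π _ _) i) = _
    rw [hx, Module.Basis.repr_self, Finsupp.single_apply]
    by_cases hik : i = k
    · rw [if_pos hik, if_pos hik.symm, map_one]
    · rw [if_neg hik, if_neg (Ne.symm hik), map_zero]
  · have h1 := cosec_appCut hπ V m
    rw [← (frameBasis he (hc h)).sum_repr (appCut π V m), map_sum] at h1
    rw [← uncutFn_cutFn (hU h) (cosec s V m), ← h1, map_sum]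
    refine Finset.sum_congr rfl fun i _ => ?_
    rw [map_smul, smul_eq_mul, map_mul, ← hx h, cosec_appCut hπ, uncutFn_cutFn]
    rfl
  · constructor
    · intro H
      refine (frameBasis he (hc h)).ext_elem fun i => ?_
      rw [map_zero, Finsupp.zero_apply]
      exact uncutFn_injective (hU h) ((H i).trans (map_zero _).symm)
    · intro H i
      change uncutFn O _ ((frameBasis he _).repr (appCut π _ _) i) = _
      rw [H, map_zero, Finsupp.zero_apply, map_zero]
  · rw [← germAt_fres hV₀ ht₀, ← cosec_res]
    have h1 : app π W₀ (x i : Sec ((restr U).obj E) W₀) = res E' hV₀ (e i) := by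
      have h1 := app_res π (hW₀ i) (a i)
      rw [ha, res_res] at h1
      exact h1
    have h2 : cosec s' W₀ (res E' hV₀ (e i)) = cosec s (extend U W₀) (x i) := by
      rw [← h1]
      exact congrArg (fun f => app f W₀ (x i)) hπ
    rw [h2]
    exact (stalkRestrict_germAt ht₀ (cosec s (extend U W₀) (x i))).symm

/-- The sections on which the linear forms of a regular splitting near a given point vanish. -/
theorem exists_regular_splitting {s : E ⟶ structureModule O} (hs : HasRegularFactorizations s)
    {y : X} (hy : y ∈ zeroLocus s) :
    ∃ (U : Opens X) (_ : y ∈ U) (d : ℕ) (σ : Splitting s U d), ∀ t ∈ zeroLocus s, t ∈ U →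
      ∃ (U' : Opens X) (h : U' ≤ U) (ht : t ∈ U') (d' : ℕ) (σ' : Splitting s U' d'),
        σ'.IsRegularAt ht ∧ ∀ {V : Opens X} (k : V ≤ U') (m : Sec E V),
          (∀ i, σ'.θ k i m = 0) → ∀ i, σ.θ (k.trans h) i m = 0 := by
  obtain ⟨U, hU, E', π, s', hE', hepi, hπ, hreg⟩ := hs y hy
  obtain ⟨V₀, hV₀, d, (e : Fin d → Sec E' V₀), he⟩ := hE' ⟨y, hU⟩
  obtain ⟨W, hWU, -, hyW, σ, hσ, -⟩ := exists_splitting π hπ he hV₀ (N := ⊤) trivial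
  refine ⟨W, hyW, d, σ, fun t htz htW => ?_⟩
  let t' : (Opens.toTopCat X).obj U := ⟨t, hWU htW⟩
  -- As `π` is locally surjective, a section on which `s'` has germ `1` would lift to one on which
  -- `s` has germ `1`.
  have ht' : t' ∈ zeroLocus s' := by
    intro h1
    obtain ⟨V, hV, m, hm⟩ := exists_of_mem_imageStalk s' (h1 ▸ Submodule.mem_top : (1 : stalkRing (restrictSheaf O U) t') ∈ imageStalk s' t')
    obtain ⟨V', k, m', hV', e'⟩ := locSurj_of_epi π V m t' hV
    have h2 : cosec s (extend U V') m' = fres (restrictSheaf O U) k (cosec s' V m) := by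
      rw [← cosec_res, ← e']
      exact (congrArg (fun f => app f V' m') hπ).symm
    have h3 : germAt O (mem_extend hV') (cosec s (extend U V') m') = 1 := by
      rw [h2]
      refine (stalkRestrict_germAt hV' (fres (restrictSheaf O U) k (cosec s' V m))).symm.trans ?_
      rw [germAt_fres, hm, map_one]
    exact htz ((Ideal.eq_top_iff_one _).2 (h3 ▸ germAt_cosec_mem s (mem_extend hV') m'))
  -- Regularity at `t` is given in some frame near `t`, not necessarily in `e`. That frame yields
  -- `σ'`, and the forms of `σ` and of `σ'` have the same common kernel, that of `π`.
  obtain ⟨V₁, hV₁, d', (e' : Fin d' → Sec E' V₁), he', hreg'⟩ := hreg t' ht'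
  obtain ⟨U', -, hU', htU', σ', hσ', hg⟩ := exists_splitting π hπ he' hV₁ (N := W) htW
  refine ⟨U', hU', htU', d', σ', ?_, fun {V} k m H => (hσ (k.trans hU') m).2 ((hσ' k m).1 H)⟩
  have h1 := hreg'.toIsWeaklyRegular
  let r := stalkRestrict O U t'
  rw [AddEquiv.isWeaklyRegular_congr (M₂ := stalkRing O t) (S := stalkRing O t)
    (e := r.toAddEquiv) (bs := (List.ofFn fun i => germAt O htU' (cosec s U' (σ'.x i))))] at h1
  · exact h1
  · rw [List.forall₂_iff_get]
    refine ⟨by simp, fun i h₁ h₂ x => ?_⟩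
    simp only [List.get_eq_getElem, List.getElem_ofFn, hg]
    exact map_mul r _ _

end Restrict

end Splitting

/-! ### Extending linear forms and projections along a ring homomorphism. -/

section Algebra

open Module

variable {A B : Type*} [CommRing A] [CommRing B] {φ : A →+* B}
  {M : Type*} [AddCommGroup M] [Module A M] {d : ℕ} {b : Basis (Fin d) A M}
  {l : M →ₛₗ[φ] (Fin d → B)}

/-- The linear form on `B^d` which extends a linear form on a free module over `A`. -/
def extendForm (b : Basis (Fin d) A M) (φ : A →+* B) (ψ : M →ₗ[A] A) : (Fin d → B) →ₗ[B] B :=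
  (Pi.basisFun B (Fin d)).constr B fun i => φ (ψ (b i))

theorem extendForm_apply (hl : ∀ i, l (b i) = Pi.basisFun B (Fin d) i) (ψ : M →ₗ[A] A) (m : M) :
    extendForm b φ ψ (l m) = φ (ψ m) := by
  have h1 : l m = ∑ i, φ (b.repr m i) • Pi.basisFun B (Fin d) i := by
    conv_lhs => rw [← b.sum_repr m]
    simp only [map_sum, map_smulₛₗ, hl]
  have h2 : ψ m = ∑ i, b.repr m i * ψ (b i) := by
    conv_lhs => rw [← b.sum_repr m]
    simp only [map_sum, map_smul, smul_eq_mul]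
  rw [h1, h2, map_sum, map_sum]
  refine Finset.sum_congr rfl fun i _ => ?_
  rw [map_smul, extendForm, Basis.constr_basis, map_mul, smul_eq_mul]

theorem form_ext {f g : (Fin d → B) →ₗ[B] B} (hl : ∀ i, l (b i) = Pi.basisFun B (Fin d) i)
    (h : ∀ m, f (l m) = g (l m)) : f = g :=
  (Pi.basisFun B (Fin d)).ext fun i => by rw [← hl, h]

variable {N : Type*} [AddCommGroup N] [Module B N] {f : M →ₛₗ[φ] N}

theorem extMap_projection {n : ℕ} {θ : Fin n → M →ₗ[A] A} {x : Fin n → M} {θ' : Fin n → N →ₗ[B] B}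
    {x' : Fin n → N} (hθ : ∀ i m, θ' i (f m) = φ (θ i m)) (hx : ∀ i, f (x i) = x' i) {p : ℕ}
    (z : ⋀[A]^p M) :
    extMap p f (extMap p (projection θ x) z) = extMap p (projection θ' x') (extMap p f z) := by
  let k : M →ₛₗ[φ] N := f.comp (projection θ x)
  rw [← extMap_comp p (RingHom.comp_id φ) k f (projection θ x) (fun m => rfl),
    ← extMap_comp p (RingHom.id_comp φ) k (projection θ' x') f (fun m => ?_)]
  change f (projection θ x m) = _
  simp only [projection_apply, map_sub, map_sum, map_smulₛₗ, hθ, hx]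

theorem IsKilled.extMap {s : M →ₗ[A] A} {t : N →ₗ[B] B} (h : ∀ m, t (f m) = φ (s m)) {p : ℕ}
    {z : ⋀[A]^p M} (hz : IsKilled s z) : IsKilled t (extMap p f z) := by
  cases p with
  | zero => exact isKilled_zero _ _
  | succ p =>
    rw [isKilled_succ] at hz ⊢
    rw [← extMap_contract s t f h, hz, map_zero]

end Algebra

/-! ### From stalks to neighbourhoods. -/

section Frame

open Module

variable {X : TopCat.{0}} {O : Sheaf (Opens.grothendieckTopology X) CommRingCat.{0}}
  {E : ModuleSheaf O} {U : Opens X} {d : ℕ} {e : Fin d → Sec E U} (he : IsLocalFrame E U e) {t : X}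

/-- The germs of the coordinates of sections. -/
abbrev germCoord {V : Opens X} (h : V ≤ U) (ht : t ∈ V) : Sec E V →ₛₗ[germAt O ht] (Fin d → stalkRing O t) :=
  frameCoord he h (germAt O ht)

theorem germCoord_res {V W : Opens X} (h : V ≤ U) (k : W ≤ V) (ht : t ∈ W) (m : Sec E V) :
    germCoord he (k.trans h) ht (res E k m) = germCoord he h (k ht) m := by
  funext i
  change germAt O ht ((frameBasis he _).repr _ i) = _
  rw [frameBasis_repr_res he h k, germAt_fres]
  rfl

theorem extMap_germCoord_res {p : ℕ} {V W : Opens X} (h : V ≤ U) (k : W ≤ V) (ht : t ∈ W)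
    (z : ⋀[Fn O V]^p (Sec E V)) :
    extMap p (germCoord he (k.trans h) ht) (extMap p (res E k) z) =
      extMap p (germCoord he h (k ht)) z :=
  (extMap_comp p (RingHom.ext fun a => germAt_fres k ht a) (germCoord he h (k ht))
    (germCoord he (k.trans h) ht) (res E k) (fun m => (germCoord_res he h k ht m).symm) z).symm

/-- The finitely many coordinates in the induced basis of `⋀^p` have zero germs, hence vanish on a
common neighbourhood. -/
theorem exists_extMap_res_eq_zero {p : ℕ} {V : Opens X} (h : V ≤ U) (ht : t ∈ V)
    (z : ⋀[Fn O V]^p (Sec E V)) (hz : extMap p (germCoord he h ht) z = 0) :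
    ∃ (W : Opens X) (k : W ≤ V), t ∈ W ∧ extMap p (res E k) z = 0 := by
  let B := (frameBasis he h).exteriorPower p
  have h0 (K) : germAt O ht (B.repr z K) = 0 := by
    rw [← extMap_repr (fun i => frameCoord_basis he h (germAt O ht) i), hz]
    simp
  choose W k hW e using fun K => exists_fres_eq_zero ht _ (h0 K)
  have hfin : IsOpen (⋂ K, (W K : Set X)) := isOpen_iInter_of_finite fun K => (W K).2
  let W' : Opens X := V ⊓ ⟨_, hfin⟩
  have hW' (K) : W' ≤ W K := fun x hx => Set.mem_iInter.1 hx.2 K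
  refine ⟨W', inf_le_left, ⟨ht, Set.mem_iInter.2 hW⟩, ?_⟩
  rw [← B.sum_repr z, map_sum]
  refine Finset.sum_eq_zero fun K _ => ?_
  rw [map_smulₛₗ, ← fres_fres (k K) (hW' K), e, map_zero, zero_smul]

theorem exists_extMap_germCoord {p : ℕ} (hU : t ∈ U) (w : ⋀[stalkRing O t]^p (Fin d → stalkRing O t)) :
    ∃ (W : Opens X) (h : W ≤ U) (ht : t ∈ W) (z : ⋀[Fn O W]^p (Sec E W)),
      extMap p (germCoord he h ht) z = w := by
  let B := (Pi.basisFun (stalkRing O t) (Fin d)).exteriorPower p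
  choose W hW a ha using fun K => exists_germAt (B.repr w K)
  have hfin : IsOpen (⋂ K, (W K : Set X)) := isOpen_iInter_of_finite fun K => (W K).2
  let W' : Opens X := U ⊓ ⟨_, hfin⟩
  have hW' (K) : W' ≤ W K := fun x hx => Set.mem_iInter.1 hx.2 K
  have h : W' ≤ U := inf_le_left
  have ht : t ∈ W' := ⟨hU, Set.mem_iInter.2 hW⟩
  let B' := (frameBasis he h).exteriorPower p
  refine ⟨W', h, ht, ∑ K, fres O (hW' K) (a K) • B' K, B.ext_elem fun K => ?_⟩
  rw [extMap_repr (fun i => frameCoord_basis he h (germAt O ht) i), Basis.repr_sum_self,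
    germAt_fres, ha]

theorem extendForm_res {V W : Opens X} (h : V ≤ U) (k : W ≤ V) (ht : t ∈ W)
    {ψ : Sec E V →ₗ[Fn O V] Fn O V} {ψ' : Sec E W →ₗ[Fn O W] Fn O W}
    (hψ : ∀ m, ψ' (res E k m) = fres O k (ψ m)) :
    extendForm (frameBasis he (k.trans h)) (germAt O ht) ψ' =
      extendForm (frameBasis he h) (germAt O (k ht)) ψ := by
  refine (Pi.basisFun (stalkRing O t) (Fin d)).ext fun i => ?_
  rw [extendForm, extendForm, Basis.constr_basis, Basis.constr_basis, ← frameBasis_res he h k, hψ,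
    germAt_fres]

variable {s : E ⟶ structureModule O}

/-- The germ at `t` of a splitting. -/
theorem Splitting.germ {n : ℕ} {U' : Opens X} (σ : Splitting s U' n) {V : Opens X} (h : V ≤ U)
    (k : V ≤ U') (ht : t ∈ V) :
    let b := frameBasis he h
    let x := fun i => germCoord he h ht (res E k (σ.x i))
    let S := extendForm b (germAt O ht) (cosec s V)
    let θ := fun i => extendForm b (germAt O ht) (σ.θ k i)
    (∀ i i', θ i (x i') = if i = i' then 1 else 0) ∧ (∀ m, S m = ∑ i, θ i m * S (x i)) ∧
      ∀ i, S (x i) = germAt O (k ht) (cosec s U' (σ.x i)) := by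
  intro b x S θ
  have hl (i) : germCoord he h ht (b i) = Pi.basisFun _ (Fin d) i := frameCoord_basis he h _ i
  refine ⟨fun i i' => ?_, fun m => ?_, fun i => ?_⟩
  · rw [extendForm_apply hl, σ.θ_x]
    split_ifs <;> simp
  · have : S = ∑ i, S (x i) • θ i := by
      refine form_ext hl fun m => ?_
      rw [extendForm_apply hl, σ.cosec_eq k, map_sum, LinearMap.sum_apply]
      refine Finset.sum_congr rfl fun i _ => ?_
      rw [map_mul, LinearMap.smul_apply, extendForm_apply hl, extendForm_apply hl, smul_eq_mul, mul_comm]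
    conv_lhs => rw [this]
    rw [LinearMap.sum_apply]
    exact Finset.sum_congr rfl fun i _ => mul_comm _ _
  · rw [extendForm_apply hl, cosec_res, germAt_fres]

/-- A regular splitting, and a cycle `z` near `t`: up to a boundary, `z` comes from the complement. -/
theorem exists_extMap_projection_eq_of_cycle (hE : IsVectorBundle E) {n : ℕ} {U' : Opens X}
    (σ : Splitting s U' n) {ht' : t ∈ U'} (hσ : σ.IsRegularAt ht') {p : ℕ} {V : Opens X}
    (hVU' : V ≤ U') (htV : t ∈ V) (z : ⋀[Fn O V]^p (Sec E V)) (hz : IsKilled (cosec s V) z) :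
    ∃ (W : Opens X) (k : W ≤ V) (w : ⋀[Fn O W]^(p + 1) (Sec E W)), t ∈ W ∧
      extMap p (projection (σ.θ (k.trans hVU')) fun i => res E (k.trans hVU') (σ.x i))
        (extMap p (res E k) z - contract (cosec s W) p w) =
      extMap p (res E k) z - contract (cosec s W) p w := by
  obtain ⟨U, hU, d, (e : Fin d → Sec E U), he⟩ := hE t
  have ht₁ : t ∈ V ⊓ U := ⟨htV, hU⟩
  have h₁ : V ⊓ U ≤ U := inf_le_right
  have k₁ : V ⊓ U ≤ V := inf_le_left
  obtain ⟨g₁, g₂, g₃⟩ := σ.germ he h₁ (k₁.trans hVU') ht₁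
  set b := frameBasis he h₁
  set S := extendForm b (germAt O ht₁) (cosec s (V ⊓ U)) with hS
  set θ := fun i => extendForm b (germAt O ht₁) (σ.θ (k₁.trans hVU') i) with hθ
  set x := fun i => germCoord he h₁ ht₁ (res E (k₁.trans hVU') (σ.x i)) with hx
  have hl {V : Opens X} (h : V ≤ U) (ht : t ∈ V) (i) :
      germCoord he h ht (frameBasis he h i) = Pi.basisFun _ (Fin d) i := frameCoord_basis he h _ i
  have hreg : RingTheory.Sequence.IsWeaklyRegular (stalkRing O t) (List.ofFn fun i => S (x i)) := by
    simp only [g₃]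
    exact hσ
  -- The equation is solved over the stalk, where the sequence is regular. The solution is then
  -- represented by an element `w₁` over a neighbourhood, and the identity, being one of germs,
  -- holds after shrinking.
  let zA := extMap p (germCoord he h₁ ht₁) (extMap p (res E k₁) z)
  have hzA : IsKilled S zA := (hz.extMap (fun m => cosec_res s k₁ m)).extMap
    (fun m => extendForm_apply (hl _ _) _ m)
  obtain ⟨wA, hwA⟩ := exists_extMap_projection_eq (Pi.basisFun (stalkRing O t) (Fin d)) g₁ g₂ hreg zA hzA
  obtain ⟨W₁, hW₁, htW₁, w₁, rfl⟩ := exists_extMap_germCoord he hU wA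
  have ht₂ : t ∈ (V ⊓ U) ⊓ W₁ := ⟨ht₁, htW₁⟩
  have k₂ : (V ⊓ U) ⊓ W₁ ≤ V ⊓ U := inf_le_left
  have k₃ : (V ⊓ U) ⊓ W₁ ≤ W₁ := inf_le_right
  have h₂ : (V ⊓ U) ⊓ W₁ ≤ U := k₂.trans h₁
  generalize (V ⊓ U) ⊓ W₁ = W₂ at *
  have hS₂ : extendForm (frameBasis he h₂) (germAt O ht₂) (cosec s W₂) = S :=
    extendForm_res he h₁ k₂ ht₂ fun m => cosec_res s k₂ m
  have hθ₂ (i) : extendForm (frameBasis he h₂) (germAt O ht₂)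
      (σ.θ (k₂.trans (k₁.trans hVU')) i) = θ i :=
    extendForm_res he h₁ k₂ ht₂ fun m => σ.θ_res (k₁.trans hVU') k₂ i m
  let Q := extMap p (res E (k₂.trans k₁)) z - contract (cosec s W₂) p (extMap (p + 1) (res E k₃) w₁)
  let P := projection (σ.θ (k₂.trans (k₁.trans hVU')))
    (fun i => res E (k₂.trans (k₁.trans hVU')) (σ.x i))
  have hQ : extMap p (germCoord he h₂ ht₂) Q =
      zA - contract S p (extMap (p + 1) (germCoord he hW₁ htW₁) w₁) := by
    rw [map_sub, extMap_contract (cosec s W₂) S (germCoord he h₂ ht₂)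
      (fun m => by rw [← hS₂]; exact extendForm_apply (hl _ _) _ m),
      extMap_germCoord_res he hW₁ k₃ ht₂, ← extMap_res_res k₁ k₂, extMap_germCoord_res he h₁ k₂ ht₂]
  obtain ⟨W, k, hW, H⟩ := exists_extMap_res_eq_zero he h₂ ht₂ (extMap p P Q - Q) (by
    rw [map_sub, extMap_projection (θ' := θ) (x' := x) (fun i m => by
        rw [← hθ₂]
        exact extendForm_apply (hl _ _) _ m) (fun i => by
        rw [← res_res (k₁.trans hVU') k₂, germCoord_res he h₁ k₂ ht₂]), hQ, hwA, sub_self])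
  refine ⟨W, k.trans (k₂.trans k₁), extMap (p + 1) (res E (k.trans k₃)) w₁, hW, ?_⟩
  rw [map_sub, sub_eq_zero, extMap_projection (θ' := σ.θ (k.trans (k₂.trans (k₁.trans hVU'))))
    (x' := fun i => res E (k.trans (k₂.trans (k₁.trans hVU'))) (σ.x i))
    (fun i m => σ.θ_res _ k i m) (fun i => res_res _ _ _)] at H
  have hres : extMap p (res E k) Q = extMap p (res E (k.trans (k₂.trans k₁))) z -
      contract (cosec s W) p (extMap (p + 1) (res E (k.trans k₃)) w₁) := by
    rw [map_sub, extMap_contract (cosec s W₂) (cosec s W) (res E k) (fun m => cosec_res s k m),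
      extMap_res_res, extMap_res_res]
  rw [hres] at H
  exact H

/-- On sections `m` with `s m = 0`, the linear forms of a regular splitting take values in the ideal. -/
theorem exists_cosec_eq_of_cosec_eq_zero (hE : IsVectorBundle E) {n : ℕ} {U' : Opens X}
    (σ : Splitting s U' n) {ht' : t ∈ U'} (hσ : σ.IsRegularAt ht') {V : Opens X}
    (hVU' : V ≤ U') (htV : t ∈ V) (m : Sec E V) (hm : cosec s V m = 0) (i : Fin n) :
    germAt O htV (σ.θ hVU' i m) ∈ imageStalk s t := by
  obtain ⟨U, hU, d, (e : Fin d → Sec E U), he⟩ := hE t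
  have ht₁ : t ∈ V ⊓ U := ⟨htV, hU⟩
  have h₁ : V ⊓ U ≤ U := inf_le_right
  have k₁ : V ⊓ U ≤ V := inf_le_left
  obtain ⟨g₁, g₂, g₃⟩ := σ.germ he h₁ (k₁.trans hVU') ht₁
  have hl (i) : germCoord he h₁ ht₁ (frameBasis he h₁ i) = Pi.basisFun _ (Fin d) i :=
    frameCoord_basis he h₁ _ i
  obtain ⟨c, hc⟩ := apply_mem_span_of_eq_zero (Pi.basisFun (stalkRing O t) (Fin d)) g₁ g₂
    (by simp only [g₃]; exact hσ) (m := germCoord he h₁ ht₁ (res E k₁ m))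
    (by rw [extendForm_apply hl, cosec_res, hm, map_zero, map_zero]) i
  rw [extendForm_apply hl, σ.θ_res hVU' k₁, germAt_fres] at hc
  -- An element in the range of the germ of `s` is a combination of the values of `s` on the frame,
  -- hence in `I_t`.
  rw [← hc, ← (Pi.basisFun _ (Fin d)).sum_repr c, map_sum]
  refine Submodule.sum_mem _ fun i _ => ?_
  rw [map_smul, ← hl, extendForm_apply hl]
  exact Submodule.smul_mem _ _ (germAt_cosec_mem s _ _)

end Frame

/-! ### Restriction of exterior powers and of the Koszul complex to the vanishing locus. -/

section Trace

variable {X : TopCat.{0}} {O : Sheaf (Opens.grothendieckTopology X) CommRingCat.{0}}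
  {E : ModuleSheaf O} (s : E ⟶ structureModule O)

theorem eq_zero_of_mem_idealMul {M N : Type*} [AddCommGroup M] [AddCommGroup N] {V : Opens X}
    [Module (Fn O V) M] [Module (Fn (vanishingSheaf s) (trace s V)) N]
    (f : M →ₛₗ[pullFn (incl s) (inclRingHom s) V] N) {x : M} (hx : x ∈ idealMul s (M := M) V) :
    f x = 0 := by
  refine Submodule.smul_induction_on hx ?_ ?_
  · rintro _ ⟨m, rfl⟩ n -
    rw [map_smulₛₗ, pullFn_cosec, zero_smul]
  · intro x y hx hy
    rw [map_add, hx, hy, add_zero]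

/-- Sections over the vanishing locus which agree near each point coming from `X` are equal. -/
theorem trace_sec_eq_zero {F : ModuleSheaf (vanishingSheaf s)} {V : Opens X}
    {a : Sec F (trace s V)}
    (H : ∀ t : VanishingLocus s, ∀ _ : t ∈ trace s V, ∃ (W : Opens X) (h : W ≤ V), t ∈ trace s W ∧
      res F (trace_mono s h) a = 0) : a = 0 :=
  sec_eq_zero fun t ht => by
    obtain ⟨W, h, hW, e⟩ := H t ht
    exact ⟨trace s W, trace_mono s h, hW, e⟩

theorem toTrace_res {M : ModuleSheaf O} {V W : Opens X} (h : W ≤ V) (m : Sec M V) :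
    toTrace s M W (res M h m) = res _ (trace_mono s h) (toTrace s M V m) :=
  eta_res _ _ h _ m

/-- Compatibility with restrictions of the maps on exterior powers given by a compatible family of maps
`M(V) → F(V ∩ T)`. -/
theorem extMap_extMap_res {p : ℕ} {M : ModuleSheaf O} {F : ModuleSheaf (vanishingSheaf s)}
    {V W : Opens X} (h : W ≤ V) {u : Sec M V →ₛₗ[pullFn (incl s) (inclRingHom s) V] Sec F (trace s V)}
    {u' : Sec M W →ₛₗ[pullFn (incl s) (inclRingHom s) W] Sec F (trace s W)}
    (hu : ∀ m, u' (res M h m) = res F (trace_mono s h) (u m)) (z : ⋀[Fn O V]^p (Sec M V)) :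
    extMap p u' (extMap p (res M h) z) = extMap p (res F (trace_mono s h)) (extMap p u z) := by
  let k : Sec M V →ₛₗ[(pullFn (incl s) (inclRingHom s) W).comp (fres O h)] Sec F (trace s W) :=
    { toFun := fun m => u' (res M h m)
      map_add' := fun a b => by rw [map_add, map_add]
      map_smul' := fun a b => by rw [map_smulₛₗ, map_smulₛₗ]; rfl }
  rw [← extMap_comp p rfl k u' (res M h) (fun m => rfl),
    ← extMap_comp p (RingHom.ext fun a => (pullFn_res _ _ h (trace_mono s h) a).symm) k
      (res _ (trace_mono s h)) u hu]

theorem extMap_toTrace_res {p : ℕ} {M : ModuleSheaf O} {V W : Opens X} (h : W ≤ V)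
    (z : ⋀[Fn O V]^p (Sec M V)) :
    extMap p (toTrace s M W) (extMap p (res M h) z) =
      extMap p (res _ (trace_mono s h)) (extMap p (toTrace s M V) z) :=
  extMap_extMap_res s h (fun m => toTrace_res s h m) z

/-- On the vanishing locus the cosection becomes the zero form, so the differential becomes
contraction with `0`. -/
theorem extMap_toTrace_contract {p : ℕ} {V : Opens X} (w : ⋀[Fn O V]^(p + 1) (Sec E V)) :
    extMap p (toTrace s E V) (contract (cosec s V) p w) = 0 := by
  rw [extMap_contract (cosec s V) 0 (toTrace s E V) (fun m => (pullFn_cosec s m).symm)]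
  suffices h : contract (0 : Sec ((restrictToT s).obj E) (trace s V) →ₗ[Fn (vanishingSheaf s) (trace s V)] _) p = 0 by
    rw [h, LinearMap.zero_apply]
  refine ext_semilinear fun m => ?_
  rw [contract_ιMulti]
  simp

/-- The morphism `⋀^p E → j_* ⋀^p j^* E`, on sections. -/
def tracePow (p : ℕ) (V : Opens X) : Sec ((extPow p).obj E) V →ₛₗ[pullFn (incl s) (inclRingHom s) V]
    Sec ((extPow p).obj ((restrictToT s).obj E)) (trace s V) :=
  appPush (incl s) (inclRingHom s)
    (extPowPush (incl s) (inclRingHom s) ((pullPushAdj (incl s) (inclRingHom s)).unit.app E) p) V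

theorem tracePow_toExt {p : ℕ} {V : Opens X} (x : ⋀[Fn O V]^p (Sec E V)) :
    tracePow s p V (toExt p E V x) = toExt p _ _ (extMap p (toTrace s E V) x) :=
  app_extPowPush (incl s) (inclRingHom s) _ p V x

theorem tracePow_res {p : ℕ} {V W : Opens X} (h : W ≤ V) (z : Sec ((extPow p).obj E) V) :
    tracePow s p W (res _ h z) = res _ (trace_mono s h) (tracePow s p V z) :=
  appPush_res _ _ _ h _ z

theorem app_pullExtPow_toTrace {p : ℕ} {V : Opens X} (z : Sec ((extPow p).obj E) V) :
    app (pullExtPow (incl s) (inclRingHom s) p E) _ (toTrace s _ V z) = tracePow s p V z :=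
  app_homEquiv_symm (incl s) (inclRingHom s) _ V z

set_option maxHeartbeats 1000000 in
/-- If the sections of `F` come locally from sections of `M` over open subsets of `U`, by a compatible
family of maps `M(V) → F(V ∩ T)`, then so do the elements of the exterior powers. -/
theorem exists_extMap_eq {p : ℕ} {M : ModuleSheaf O} {F : ModuleSheaf (vanishingSheaf s)}
    {U : Opens X} (u : ∀ {V : Opens X}, V ≤ U →
      (Sec M V →ₛₗ[pullFn (incl s) (inclRingHom s) V] Sec F (trace s V)))
    (hu : ∀ {V W : Opens X} (h : V ≤ U) (k : W ≤ V) (m : Sec M V),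
      u (k.trans h) (res M k m) = res F (trace_mono s k) (u h m))
    {t : VanishingLocus s} (htU : t ∈ trace s U)
    (hsurj : ∀ (W : Opens (VanishingLocus s)) (n : Sec F W), t ∈ W →
      ∃ (V : Opens X) (h : V ≤ U) (k : trace s V ≤ W) (m : Sec M V), t ∈ trace s V ∧
        u h m = res F k n)
    {W : Opens (VanishingLocus s)} (x : ⋀[Fn (vanishingSheaf s) W]^p (Sec F W)) (ht : t ∈ W) :
    ∃ (V : Opens X) (h : V ≤ U) (k : trace s V ≤ W) (z : ⋀[Fn O V]^p (Sec M V)), t ∈ trace s V ∧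
      extMap p (u h) z = extMap p (res F k) x := by
  have hx : x ∈ Submodule.span (Fn (vanishingSheaf s) W)
      (Set.range (exteriorPower.ιMulti (Fn (vanishingSheaf s) W) p (M := Sec F W))) := by
    rw [exteriorPower.ιMulti_span]
    trivial
  have hres {V W : Opens X} (h : V ≤ U) (k : W ≤ V) (z : ⋀[Fn O V]^p (Sec M V)) :
      extMap p (u (k.trans h)) (extMap p (res M k) z) =
        extMap p (res F (trace_mono s k)) (extMap p (u h) z) :=
    extMap_extMap_res s k (hu h k) z
  -- The factors of a decomposable element are lifted on a common neighbourhood, and scalars are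
  -- lifted by `exists_pullFn`.
  induction hx using Submodule.span_induction with
  | zero =>
    obtain ⟨V, rfl⟩ := exists_open_of_vanishingLocus s W
    exact ⟨V ⊓ U, inf_le_right, trace_mono s inf_le_left, 0, ⟨ht, htU⟩, by rw [map_zero, map_zero]⟩
  | mem x hx =>
    obtain ⟨m, rfl⟩ := hx
    choose V hVU hV b hb e using fun i => hsurj W (m i) ht
    have hfin : IsOpen (⋂ K, (V K : Set X)) := isOpen_iInter_of_finite fun K => (V K).2
    obtain ⟨V₀, rfl⟩ := exists_open_of_vanishingLocus s W
    let W' : Opens X := (U ⊓ V₀) ⊓ ⟨_, hfin⟩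
    have hW' (K) : W' ≤ V K := fun x hx => Set.mem_iInter.1 hx.2 K
    have hU : W' ≤ U := fun x hx => hx.1.1
    have hV₀ : W' ≤ V₀ := fun x hx => hx.1.2
    refine ⟨W', hU, trace_mono s hV₀, exteriorPower.ιMulti _ p fun i => res M (hW' i) (b i),
      ⟨⟨htU, ht⟩, Set.mem_iInter.2 hb⟩, ?_⟩
    rw [extMap_ιMulti, extMap_ιMulti]
    refine congrArg _ (funext fun i => ?_)
    change u hU (res M (hW' i) (b i)) = _
    rw [hu (hVU i) (hW' i), e, res_res]
    rfl
  | add x y _ _ hx hy =>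
    obtain ⟨V, hU, h, z, hV, e⟩ := hx
    obtain ⟨V', hU', h', z', hV', e'⟩ := hy
    have k : V ⊓ V' ≤ V := inf_le_left
    have k' : V ⊓ V' ≤ V' := inf_le_right
    refine ⟨V ⊓ V', k.trans hU, (trace_mono s k).trans h, extMap p (res M k) z +
      extMap p (res M k') z', ⟨hV, hV'⟩, ?_⟩
    rw [map_add, map_add, hres hU k, hres hU' k', e, e', extMap_res_res, extMap_res_res]
  | smul a x _ hx =>
    obtain ⟨V, hU, h, z, hV, e⟩ := hx
    obtain ⟨V', h', c, hV', e'⟩ := exists_pullFn s W a t ht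
    have k : V ⊓ V' ≤ V := inf_le_left
    have k' : V ⊓ V' ≤ V' := inf_le_right
    refine ⟨V ⊓ V', k.trans hU, (trace_mono s k).trans h, fres O k' c • extMap p (res M k) z,
      ⟨hV, hV'⟩, ?_⟩
    rw [map_smulₛₗ, map_smulₛₗ, hres hU k, pullFn_res _ _ k' (trace_mono s k'), e, e',
      extMap_res_res, fres_fres]

/-- The elements of `⋀^p` of the sections of `j^* M` come locally from `⋀^p M(V)`. -/
theorem exists_extMap_toTrace {p : ℕ} {M : ModuleSheaf O} {W : Opens (VanishingLocus s)}
    (x : ⋀[Fn (vanishingSheaf s) W]^p (Sec ((restrictToT s).obj M) W)) {t : VanishingLocus s}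
    (ht : t ∈ W) :
    ∃ (V : Opens X) (h : trace s V ≤ W) (z : ⋀[Fn O V]^p (Sec M V)), t ∈ trace s V ∧
      extMap p (toTrace s M V) z = extMap p (res _ h) x := by
  obtain ⟨V, -, H⟩ := exists_extMap_eq s (U := ⊤) (fun {V} _ => toTrace s M V)
    (fun _ k m => toTrace_res s k m) trivial (fun W n hW => by
      obtain ⟨V, h, m, hV, e⟩ := exists_toTrace s M n hW
      exact ⟨V, le_top, h, m, hV, e⟩) x ht
  exact ⟨V, H⟩

/-- The kernel of `⋀^p E → j_* ⋀^p j^* E` is locally `I ⋀^p E`. -/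
theorem exists_mem_idealMul_of_toExt_eq_zero (hE : IsVectorBundle E) {p : ℕ} {V : Opens X}
    (z : ⋀[Fn O V]^p (Sec E V))
    (hz : toExt p _ _ (extMap p (toTrace s E V) z) = 0) {t : VanishingLocus s}
    (ht : t ∈ trace s V) :
    ∃ (W : Opens X) (k : W ≤ V), t ∈ trace s W ∧
      extMap p (res E k) z ∈ idealMul s (M := ⋀[Fn O W]^p (Sec E W)) W := by
  obtain ⟨W, k, hW, e⟩ := toExt_eq_zero _ hz ht
  obtain ⟨V', rfl⟩ := exists_open_of_vanishingLocus s W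
  have k₁ : V' ⊓ V ≤ V := inf_le_right
  have k₂ : V' ⊓ V ≤ V' := inf_le_left
  obtain ⟨W', k', hW', e'⟩ := exists_mem_idealMul_of_extMap_toTrace_eq_zero s hE
    (extMap p (res E k₁) z) (by
      rw [extMap_toTrace_res, ← extMap_res_res k (trace_mono s k₂), e, map_zero]) (t := t) ⟨hW, ht⟩
  exact ⟨W', k'.trans k₁, hW', by rwa [← extMap_res_res k₁ k']⟩

/-- Sections of both sheaves come locally from `⋀^p E(V)`, which gives surjectivity. For
injectivity, an element of `⋀^p E(V)` which vanishes in `⋀^p j^* E` is locally in `I ⋀^p E`, and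
`j^*` kills this. -/
theorem isIso_pullExtPow (hE : IsVectorBundle E) (p : ℕ) :
    IsIso (pullExtPow (incl s) (inclRingHom s) p E) := by
  have : Epi (pullExtPow (incl s) (inclRingHom s) p E) := epi_of_locSurj fun W b t ht => by
    obtain ⟨W', k, x, hW', e⟩ := exists_toExt b ht
    obtain ⟨V, h, z, hV, e'⟩ := exists_extMap_toTrace s x hW'
    refine ⟨trace s V, h.trans k, toTrace s _ V (toExt p E V z), hV, ?_⟩
    rw [app_pullExtPow_toTrace, tracePow_toExt, e', ← res_toExt, e, res_res]
  have : Mono (pullExtPow (incl s) (inclRingHom s) p E) := mono_of_injective _ fun W a ha =>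
    sec_eq_zero fun t ht => by
      obtain ⟨V, h, b, hV, e⟩ := exists_toTrace s _ a ht
      obtain ⟨V', k, x, hV', e'⟩ := exists_toExt b (t := incl s t) hV
      have h0 : toExt p _ _ (extMap p (toTrace s E V') x) = 0 := by
        rw [← tracePow_toExt, e', ← app_pullExtPow_toTrace, toTrace_res, app_res, e, app_res, ha,
          map_zero, map_zero]
      obtain ⟨W', k', hW', e''⟩ := exists_mem_idealMul_of_toExt_eq_zero s hE x h0 hV'
      refine ⟨trace s W', (trace_mono s (k'.trans k)).trans h, hW', ?_⟩
      have h1 := eq_zero_of_mem_idealMul s ((toTrace s _ W').comp (toExt p E W')) e''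
      rw [LinearMap.comp_apply, ← res_toExt, e', res_res, toTrace_res, e, res_res] at h1
      exact h1
  exact isIso_of_mono_of_epi _

theorem pull_hom_ext {M : ModuleSheaf O} {G : ModuleSheaf (vanishingSheaf s)}
    {f g : (restrictToT s).obj M ⟶ G}
    (h : ∀ V (m : Sec M V), app f _ (toTrace s M V m) = app g _ (toTrace s M V m)) : f = g :=
  ((pullPushAdj (incl s) (inclRingHom s)).homEquiv _ _).injective (hom_ext_sections fun V m =>
    (app_homEquiv (incl s) (inclRingHom s) f V m).trans
      ((h V m).trans (app_homEquiv (incl s) (inclRingHom s) g V m).symm))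

theorem tracePow_koszulD {p : ℕ} {V : Opens X} (w : Sec ((extPow (p + 1)).obj E) V) :
    tracePow s p V (app (koszulD s p) V w) = 0 :=
  trace_sec_eq_zero s fun t ht => by
    obtain ⟨W, k, x, hW, e⟩ := exists_toExt w (t := incl s t) ht
    refine ⟨W, k, hW, ?_⟩
    rw [← tracePow_res s k, ← app_res, ← e, app_koszulD, tracePow_toExt, extMap_toTrace_contract, map_zero]

theorem koszul_d (p : ℕ) : (koszul s).d (p + 1) p = koszulD s p := ChainComplex.of_d (fun p => (extPow p).obj E) (koszulD s) p

/-- The restriction to the vanishing locus of the Koszul complex is `Sym(E|_T[1])`. -/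
def koszulOnTIso (hE : IsVectorBundle E) : koszulOnT s ≅ symShift ((restrictToT s).obj E) :=
  HomologicalComplex.Hom.isoOfComponents
    (fun p => @asIso _ _ _ _ (pullExtPow (incl s) (inclRingHom s) p E) (isIso_pullExtPow s hE p))
    (fun i j hij => by
      obtain rfl : j + 1 = i := hij
      -- The target has zero differentials, so commutation means that restricting a boundary to the
      -- locus gives zero.
      refine comp_zero.trans (Eq.symm ?_)
      change (restrictToT s).map ((koszul s).d (j + 1) j) ≫ pullExtPow (incl s) (inclRingHom s) j E = 0
      rw [koszul_d]
      refine pull_hom_ext s fun V w => ?_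
      refine Eq.trans ?_ (app_zero _ _).symm
      refine (app_comp _ _ _ _).trans ?_
      refine (congrArg _ (app_pull_map (incl s) (inclRingHom s) (koszulD s j) V w)).trans ?_
      exact (app_pullExtPow_toTrace s _).trans (tracePow_koszulD s w))

end Trace

/-! ### The projection to the excess bundle, and cycles modulo boundaries. -/

section Excess

variable {X : TopCat.{0}} {O : Sheaf (Opens.grothendieckTopology X) CommRingCat.{0}}
  {E : ModuleSheaf O} {s : E ⟶ structureModule O}

instance : Mono (excessInclusion s) := inferInstanceAs (Mono (kernel.ι (toConormal s)))

variable (s) in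
/-- The inclusion of the excess bundle, on sections. -/
def exIncl (W : Opens (VanishingLocus s)) :
    Sec (excess s) W →ₗ[Fn (vanishingSheaf s) W] Sec ((restrictToT s).obj E) W :=
  app (excessInclusion s) W

theorem exIncl_injective (W : Opens (VanishingLocus s)) : Function.Injective (exIncl s W) :=
  injective_of_mono (excessInclusion s) W

theorem exIncl_res {V W : Opens (VanishingLocus s)} (h : W ≤ V) (n : Sec (excess s) V) :
    exIncl s W (res _ h n) = res _ h (exIncl s V n) := app_res _ h n

theorem toConormal_exIncl {W : Opens (VanishingLocus s)} (n : Sec (excess s) W) :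
    app (toConormal s) W (exIncl s W n) = 0 :=
  congrArg (fun f => app f W n) (kernel.condition (toConormal s))

/-- The ideal sheaf is a subsheaf of `O`, so `m` is already zero in it, and a fortiori in the
conormal sheaf. -/
theorem exists_exIncl_eq {V : Opens X} (m : Sec E V) (hm : cosec s V m = 0) :
    ∃ n, exIncl s (trace s V) n = toTrace s E V m := by
  have h0 : app (factorThruImage s) V m = 0 := by
    refine injective_of_mono (image.ι s) V ?_
    rw [map_zero]
    exact (idealInclusion_factorThruImage s m).trans hm
  refine exists_kernel_section (toConormal s) _ ?_
  refine (app_pull_map (incl s) (inclRingHom s) (factorThruImage s) V m).trans ?_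
  rw [h0, map_zero]
  rfl

namespace Splitting

variable {U : Opens X} {d : ℕ} (σ : Splitting s U d) {V : Opens X} (h : V ≤ U)

/-- The projection to the common kernel of the linear forms. -/
def proj : Sec E V →ₗ[Fn O V] Sec E V := projection (σ.θ h) fun i => res E h (σ.x i)

theorem proj_apply (m : Sec E V) : σ.proj h m = m - ∑ i, σ.θ h i m • res E h (σ.x i) :=
  projection_apply _ _ _

theorem proj_res {W : Opens X} (k : W ≤ V) (m : Sec E V) :
    σ.proj (k.trans h) (res E k m) = res E k (σ.proj h m) := by
  simp only [proj_apply, map_sub, map_sum, map_smulₛₗ, σ.θ_res h k, res_res]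

theorem θ_proj (i : Fin d) (m : Sec E V) : σ.θ h i (σ.proj h m) = 0 := by
  rw [proj_apply, map_sub, map_sum]
  simp [σ.θ_x]

theorem cosec_proj (m : Sec E V) : cosec s V (σ.proj h m) = 0 := by
  rw [σ.cosec_eq h]
  simp [θ_proj]

theorem proj_eq_self {m : Sec E V} (hm : ∀ i, σ.θ h i m = 0) : σ.proj h m = m := by
  rw [proj_apply]
  simp [hm]

theorem proj_proj (m : Sec E V) : σ.proj h (σ.proj h m) = σ.proj h m :=
  σ.proj_eq_self h fun i => σ.θ_proj h i m

/-- The projection to the excess bundle. -/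
def toExcess : Sec E V →ₛₗ[pullFn (incl s) (inclRingHom s) V] Sec (excess s) (trace s V) where
  toFun m := (exists_exIncl_eq _ (σ.cosec_proj h m)).choose
  map_add' a b := exIncl_injective _ (by
    have H := fun m => (exists_exIncl_eq _ (σ.cosec_proj h m)).choose_spec
    rw [map_add (exIncl s _)]
    exact (H (a + b)).trans ((by rw [map_add, map_add] :
      toTrace s E V (σ.proj h (a + b)) = _).trans (congrArg₂ _ (H a).symm (H b).symm)))
  map_smul' a b := exIncl_injective _ (by
    have H := fun m => (exists_exIncl_eq _ (σ.cosec_proj h m)).choose_spec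
    rw [map_smul (exIncl s _)]
    exact (H (a • b)).trans ((by rw [map_smul, map_smulₛₗ] :
      toTrace s E V (σ.proj h (a • b)) = _).trans (congrArg _ (H b).symm)))

theorem exIncl_toExcess (m : Sec E V) :
    exIncl s _ (σ.toExcess h m) = toTrace s E V (σ.proj h m) :=
  (exists_exIncl_eq _ (σ.cosec_proj h m)).choose_spec

theorem toExcess_res {W : Opens X} (k : W ≤ V) (m : Sec E V) :
    σ.toExcess (k.trans h) (res E k m) = res _ (trace_mono s k) (σ.toExcess h m) :=
  exIncl_injective _ (by rw [exIncl_toExcess, proj_res, exIncl_res, exIncl_toExcess, toTrace_res])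

theorem toExcess_proj (m : Sec E V) : σ.toExcess h (σ.proj h m) = σ.toExcess h m :=
  exIncl_injective _ (by rw [exIncl_toExcess, exIncl_toExcess, proj_proj])

variable {p : ℕ} (z : ⋀[Fn O V]^p (Sec E V))

theorem extMap_exIncl_toExcess :
    extMap p (exIncl s _) (extMap p (σ.toExcess h) z) =
      extMap p (toTrace s E V) (extMap p (σ.proj h) z) := by
  let k := (toTrace s E V).comp (σ.proj h)
  rw [← extMap_comp p (RingHom.id_comp _) k (exIncl s _) (σ.toExcess h)
    (fun m => (σ.exIncl_toExcess h m).symm), ← extMap_comp p (RingHom.comp_id _) k (toTrace s E V)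
    (σ.proj h) (fun m => rfl)]

theorem extMap_toExcess_proj :
    extMap p (σ.toExcess h) (extMap p (σ.proj h) z) = extMap p (σ.toExcess h) z :=
  (extMap_comp p (RingHom.comp_id _) (σ.toExcess h) (σ.toExcess h) (σ.proj h)
    (fun m => (σ.toExcess_proj h m).symm) z).symm

theorem extMap_toExcess_res {W : Opens X} (k : W ≤ V) :
    extMap p (σ.toExcess (k.trans h)) (extMap p (res E k) z) =
      extMap p (res _ (trace_mono s k)) (extMap p (σ.toExcess h) z) :=
  extMap_extMap_res s k (fun m => σ.toExcess_res h k m) z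

theorem extMap_proj_res {W : Opens X} (k : W ≤ V) :
    extMap p (σ.proj (k.trans h)) (extMap p (res E k) z) =
      extMap p (res E k) (extMap p (σ.proj h) z) :=
  (extMap_projection (fun i m => σ.θ_res h k i m) (fun i => res_res h k (σ.x i)) z).symm

/-- The projection to the excess bundle carries `s` to the zero form. This is what makes its
exterior powers a morphism to a complex with zero differentials. -/
theorem extMap_toExcess_contract (w : ⋀[Fn O V]^(p + 1) (Sec E V)) :
    extMap p (σ.toExcess h) (contract (cosec s V) p w) = 0 := by
  rw [extMap_contract (cosec s V) 0 (σ.toExcess h) (fun m => (pullFn_cosec s m).symm)]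
  suffices h : contract (0 : Sec (excess s) (trace s V) →ₗ[Fn (vanishingSheaf s) (trace s V)] _) p = 0 by
    rw [h, LinearMap.zero_apply]
  refine ext_semilinear fun m => ?_
  rw [contract_ιMulti]
  simp

/-- The splitting shows that the ideal is generated by the finitely many `s(x i)`. -/
theorem exists_sum_of_mem_idealMul {M : Type*} [AddCommGroup M] [Module (Fn O V) M] {x : M}
    (hx : x ∈ idealMul s (M := M) V) :
    ∃ y : Fin d → M, x = ∑ i, cosec s V (res E h (σ.x i)) • y i := by
  refine Submodule.smul_induction_on hx ?_ ?_
  · rintro _ ⟨m, rfl⟩ n -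
    refine ⟨fun i => σ.θ h i m • n, ?_⟩
    rw [σ.cosec_eq h, Finset.sum_smul]
    exact Finset.sum_congr rfl fun i _ => by rw [smul_smul, mul_comm]
  · rintro _ _ ⟨y, rfl⟩ ⟨y', rfl⟩
    exact ⟨y + y', by simp [Finset.sum_add_distrib]⟩

theorem isKilled_extMap_proj : IsKilled (cosec s V) (extMap p (σ.proj h) z) := by
  have h0 : cosec s V ∘ₗ σ.proj h = 0 := LinearMap.ext fun m => σ.cosec_proj h m
  rw [IsKilled, coe_extMap, inner_map, h0]
  simp [inner]

end Splitting

theorem exists_isRegularAt (hs : HasRegularFactorizations s) {t : X} (ht : t ∈ zeroLocus s) :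
    ∃ (U : Opens X) (ht : t ∈ U) (d : ℕ) (σ : Splitting s U d), σ.IsRegularAt ht := by
  obtain ⟨U, hU, d, σ, H⟩ := exists_regular_splitting hs ht
  obtain ⟨U', h, ht', d', σ', hσ', -⟩ := H t ht hU
  exact ⟨U', ht', d', σ', hσ'⟩

/-- A cycle near a point of the vanishing locus is, up to a boundary, in the exterior power of the
kernel of the linear forms of a regular splitting. -/
theorem exists_decomposition (hE : IsVectorBundle E) {n : ℕ} {U : Opens X} (σ : Splitting s U n)
    {t : X} {htU : t ∈ U} (hσ : σ.IsRegularAt htU) {p : ℕ} {V : Opens X} (htV : t ∈ V)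
    (z : ⋀[Fn O V]^p (Sec E V)) (hz : IsKilled (cosec s V) z) :
    ∃ (W : Opens X) (k : W ≤ V) (h : W ≤ U) (w : ⋀[Fn O W]^(p + 1) (Sec E W))
      (z₀ : ⋀[Fn O W]^p (Sec E W)), t ∈ W ∧
      extMap p (res E k) z = contract (cosec s W) p w + z₀ ∧ extMap p (σ.proj h) z₀ = z₀ := by
  have ht : t ∈ V ⊓ U := ⟨htV, htU⟩
  have k₁ : V ⊓ U ≤ V := inf_le_left
  have k₂ : V ⊓ U ≤ U := inf_le_right
  obtain ⟨W, k, w, hW, e⟩ := exists_extMap_projection_eq_of_cycle hE σ hσ k₂ ht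
    (extMap p (res E k₁) z) (hz.extMap fun m => cosec_res s k₁ m)
  exact ⟨W, k.trans k₁, k.trans k₂, w, _, hW,
    by rw [← extMap_res_res k₁ k, add_sub_cancel], e⟩

theorem exists_cosec_eq_one {x : X} (hx : x ∉ zeroLocus s) :
    ∃ (V : Opens X) (m : Sec E V), x ∈ V ∧ cosec s V m = 1 := by
  have h1 : (1 : stalkRing O x) ∈ imageStalk s x := by
    have : imageStalk s x = ⊤ := not_not.1 hx
    rw [this]
    trivial
  obtain ⟨V, hV, m, e⟩ := exists_of_mem_imageStalk s h1
  obtain ⟨W, k, k', hW, e'⟩ := exists_fres_eq hV hV (cosec s V m) 1 (e.trans (map_one _).symm)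
  exact ⟨W, res E k m, hW, by rw [cosec_res, e', map_one]⟩

/-- Away from the vanishing locus, cycles are boundaries. -/
theorem exists_contract_eq_of_notMem {x : X} (hx : x ∉ zeroLocus s) {p : ℕ} {V : Opens X}
    (hV : x ∈ V) (z : ⋀[Fn O V]^p (Sec E V)) (hz : IsKilled (cosec s V) z) :
    ∃ (W : Opens X) (k : W ≤ V) (w : ⋀[Fn O W]^(p + 1) (Sec E W)), x ∈ W ∧
      contract (cosec s W) p w = extMap p (res E k) z := by
  obtain ⟨V', m, hV', e⟩ := exists_cosec_eq_one hx
  have k : V ⊓ V' ≤ V := inf_le_left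
  have k' : V ⊓ V' ≤ V' := inf_le_right
  refine ⟨V ⊓ V', k, wedge p (res E k' m) (extMap p (res E k) z), ⟨hV, hV'⟩, ?_⟩
  rw [contract_wedge _ _ _ (hz.extMap fun m => cosec_res s k m), cosec_res, e, map_one, one_smul]

/-- Cycles whose restriction to the vanishing locus is zero are locally boundaries. -/
theorem exists_contract_eq_of_toTrace_eq_zero (hE : IsVectorBundle E)
    (hs : HasRegularFactorizations s) {x : X} {p : ℕ} {V : Opens X} (hV : x ∈ V)
    (z : ⋀[Fn O V]^p (Sec E V)) (hz : IsKilled (cosec s V) z)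
    (hz' : toExt p _ _ (extMap p (toTrace s E V) z) = 0) :
    ∃ (W : Opens X) (k : W ≤ V) (w : ⋀[Fn O W]^(p + 1) (Sec E W)), x ∈ W ∧
      contract (cosec s W) p w = extMap p (res E k) z := by
  by_cases hx : x ∈ zeroLocus s
  swap
  · exact exists_contract_eq_of_notMem hx hV z hz
  obtain ⟨U, hU, d, σ, hσ⟩ := exists_isRegularAt hs hx
  obtain ⟨W, k, h, w, z₀, hW, e, e₀⟩ := exists_decomposition hE σ hσ hV z hz
  -- Boundaries vanish on the locus, so `z₀` vanishes there too and is locally in `I ⋀^p E`. As it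
  -- is fixed by the projection, `exists_contract_eq` makes it a boundary.
  have h0 : toExt p _ _ (extMap p (toTrace s E W) z₀) = 0 := by
    replace e := sub_eq_iff_eq_add'.2 e
    rw [← e, map_sub, map_sub, extMap_toTrace_res, ← res_toExt, hz', extMap_toTrace_contract]
    simp
  obtain ⟨W', k', hW', h1⟩ := exists_mem_idealMul_of_toExt_eq_zero s hE z₀ h0
    (t := ⟨x, hx⟩) hW
  obtain ⟨y, hy⟩ := σ.exists_sum_of_mem_idealMul (k'.trans h) h1
  obtain ⟨w', hw'⟩ := exists_contract_eq (fun m => σ.cosec_eq (k'.trans h) m)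
    ((σ.extMap_proj_res h z₀ k').trans (congrArg _ e₀)) y hy
  refine ⟨W', k'.trans k, extMap (p + 1) (res E k') w + w', hW', ?_⟩
  rw [map_add, hw', ← extMap_contract (cosec s W) (cosec s W') (res E k')
    (fun m => cosec_res s k' m), ← map_add, ← e, extMap_res_res]

/-- The restriction to the vanishing locus of a cycle locally comes from the excess bundle. -/
theorem exists_excess_of_isKilled (hE : IsVectorBundle E)
    (hs : HasRegularFactorizations s) {x : X} {p : ℕ} {V : Opens X} (hV : x ∈ V)
    (z : ⋀[Fn O V]^p (Sec E V)) (hz : IsKilled (cosec s V) z) :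
    ∃ (W : Opens X) (k : W ≤ V) (n : Sec ((extPow p).obj (excess s)) (trace s W)), x ∈ W ∧
      app ((extPow p).map (excessInclusion s)) _ n =
        toExt p _ _ (extMap p (toTrace s E W) (extMap p (res E k) z)) := by
  by_cases hx : x ∈ zeroLocus s
  swap
  · obtain ⟨W, k, w, hW, e⟩ := exists_contract_eq_of_notMem hx hV z hz
    exact ⟨W, k, 0, hW, by rw [← e, extMap_toTrace_contract, map_zero, map_zero]⟩
  obtain ⟨U, hU, d, σ, hσ⟩ := exists_isRegularAt hs hx
  obtain ⟨W, k, h, w, z₀, hW, e, e₀⟩ := exists_decomposition hE σ hσ hV z hz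
  -- On the locus only `z₀` survives, and being fixed by the projection it is the image of its own
  -- projection to the excess bundle.
  refine ⟨W, k, toExt p _ _ (extMap p (σ.toExcess h) z₀), hW, ?_⟩
  rw [app_extPow_map, e, map_add, extMap_toTrace_contract, zero_add]
  conv_rhs => rw [← e₀]
  exact congrArg _ (σ.extMap_exIncl_toExcess h z₀)

end Excess

/-! ### Exterior powers of the excess bundle. -/

section Excess

variable {X : TopCat.{0}} {O : Sheaf (Opens.grothendieckTopology X) CommRingCat.{0}}
  {E : ModuleSheaf O} {s : E ⟶ structureModule O}

/-- Sections of the excess bundle locally come from the kernel of the linear forms of a regular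
splitting. -/
theorem exists_toExcess (hE : IsVectorBundle E) {n : ℕ} {U : Opens X} (σ : Splitting s U n)
    {t : VanishingLocus s} {htU : incl s t ∈ U} (hσ : σ.IsRegularAt htU)
    (W : Opens (VanishingLocus s)) (a : Sec (excess s) W) (ht : t ∈ W) :
    ∃ (V : Opens X) (h : V ≤ U) (k : trace s V ≤ W) (m : Sec E V), t ∈ trace s V ∧
      σ.toExcess h m = res _ k a := by
  obtain ⟨V₁, k₁, m₁, hV₁, e₁⟩ := exists_toTrace s E (exIncl s W a) ht
  have h0 : app (toConormal s) _ (toTrace s E V₁ m₁) = 0 := by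
    rw [e₁, app_res, toConormal_exIncl, map_zero]
  obtain ⟨V₂, k₂, m', hV₂, hm', e₂⟩ := exists_of_toConormal_eq_zero s m₁ h0 hV₁
  have k₃ : V₂ ⊓ U ≤ V₂ := inf_le_left
  have h₃ : V₂ ⊓ U ≤ U := inf_le_right
  have hV₃ : incl s t ∈ V₂ ⊓ U := ⟨hV₂, htU⟩
  generalize V₂ ⊓ U = V₃ at k₃ h₃ hV₃
  -- Subtracting `m'`, which lies in `I E`, does not change the restriction to the locus, but makes
  -- `s` vanish exactly and not only modulo `I²`.
  let m₂ := res E k₃ (res E k₂ m₁ - m')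
  have hm₂ : cosec s V₃ m₂ = 0 := by
    rw [cosec_res, map_sub, e₂, sub_self, map_zero]
  -- By regularity, `s m₂ = 0` puts the `θ i m₂` in the ideal. So `m₂` and its projection agree on
  -- the locus.
  have hg (i) : traceGerm s (t := t) hV₃ (σ.θ h₃ i m₂) = 0 := by
    refine (stalkMap_germAt s (t := t) hV₃ _).symm.trans ?_
    rw [← RingHom.mem_ker, ker_stalkMap]
    exact exists_cosec_eq_of_cosec_eq_zero hE σ hσ h₃ hV₃ m₂ hm₂ i
  obtain ⟨V, k, hV, hθ⟩ := exists_cosec_of_finite s (t := t) hV₃ _ hg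
  have h1 : toTrace s E V (res E k m₂) = res _ (trace_mono s (k.trans (k₃.trans k₂)))
      (toTrace s E V₁ m₁) := by
    have : toTrace s E V₂ m' = 0 := eq_zero_of_mem_idealMul s (toTrace s E V₂) hm'
    rw [toTrace_res, toTrace_res, map_sub, this, sub_zero, toTrace_res, res_res, res_res]
  have h2 : toTrace s E V (σ.proj (k.trans h₃) (res E k m₂)) = toTrace s E V (res E k m₂) := by
    rw [Splitting.proj_apply, map_sub, sub_eq_self, map_sum]
    refine Finset.sum_eq_zero fun i _ => ?_
    obtain ⟨c, hc⟩ := hθ i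
    rw [σ.θ_res h₃ k, ← hc, map_smulₛₗ, pullFn_cosec, zero_smul]
  refine ⟨V, k.trans h₃, (trace_mono s (k.trans (k₃.trans k₂))).trans k₁, res E k m₂, hV,
    exIncl_injective _ ?_⟩
  rw [σ.exIncl_toExcess, h2, h1, e₁, res_res, exIncl_res]

theorem exists_extMap_toExcess (hE : IsVectorBundle E) {n p : ℕ} {U : Opens X}
    (σ : Splitting s U n) {t : VanishingLocus s} {htU : incl s t ∈ U} (hσ : σ.IsRegularAt htU)
    {W : Opens (VanishingLocus s)} (x : ⋀[Fn (vanishingSheaf s) W]^p (Sec (excess s) W))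
    (ht : t ∈ W) :
    ∃ (V : Opens X) (h : V ≤ U) (k : trace s V ≤ W) (z : ⋀[Fn O V]^p (Sec E V)), t ∈ trace s V ∧
      extMap p (σ.toExcess h) z = extMap p (res _ k) x :=
  exists_extMap_eq s (fun h => σ.toExcess h) (fun h k m => σ.toExcess_res h k m) htU
    (exists_toExcess hE σ hσ) x ht

/-- A section of `⋀^p N` comes locally from some `z` in `⋀^p E(V)`, and its image in `⋀^p j^* E` is
the restriction of the projection of `z`. If this vanishes, the projection of `z` is locally in `I
⋀^p E`, so its image in `⋀^p N`, which is the given section, is zero. -/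
theorem mono_extPow_excessInclusion (hE : IsVectorBundle E) (hs : HasRegularFactorizations s)
    (p : ℕ) : Mono ((extPow p).map (excessInclusion s)) := by
  refine mono_of_injective _ fun W a ha => sec_eq_zero fun t ht => ?_
  obtain ⟨U, hU, d, σ, hσ⟩ := exists_isRegularAt hs t.2
  obtain ⟨W₁, k₁, x, hW₁, e₁⟩ := exists_toExt a ht
  obtain ⟨V, h, k, z, hV, e⟩ := exists_extMap_toExcess hE σ (t := t) hσ x hW₁
  have h0 : toExt p _ _ (extMap p (toTrace s E V) (extMap p (σ.proj h) z)) = 0 := by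
    rw [← σ.extMap_exIncl_toExcess, e]
    refine (app_extPow_map (excessInclusion s) p _ _).symm.trans ?_
    rw [← res_toExt, e₁, app_res, app_res, ha, map_zero, map_zero]
  obtain ⟨V', k', hV', h1⟩ := exists_mem_idealMul_of_toExt_eq_zero s hE _ h0 hV
  have h2 := eq_zero_of_mem_idealMul s (extMap p (σ.toExcess (k'.trans h))) h1
  rw [σ.extMap_toExcess_res h _ k', σ.extMap_toExcess_proj, e, extMap_res_res] at h2
  refine ⟨trace s V', ((trace_mono s k').trans k).trans k₁, hV', ?_⟩
  rw [← res_res k₁ ((trace_mono s k').trans k), ← e₁, res_toExt, h2, map_zero]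

/-- Sections of the exterior powers of the excess bundle locally come from cycles. -/
theorem exists_isKilled_of_excess (hE : IsVectorBundle E) (hs : HasRegularFactorizations s)
    {p : ℕ} {W : Opens (VanishingLocus s)} (a : Sec ((extPow p).obj (excess s)) W)
    {t : VanishingLocus s} (ht : t ∈ W) :
    ∃ (V : Opens X) (k : trace s V ≤ W) (z : ⋀[Fn O V]^p (Sec E V)), t ∈ trace s V ∧
      IsKilled (cosec s V) z ∧ app ((extPow p).map (excessInclusion s)) _ (res _ k a) =
        toExt p _ _ (extMap p (toTrace s E V) z) := by
  obtain ⟨U, hU, d, σ, hσ⟩ := exists_isRegularAt hs t.2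
  obtain ⟨W₁, k₁, x, hW₁, e₁⟩ := exists_toExt a ht
  obtain ⟨V, h, k, z, hV, e⟩ := exists_extMap_toExcess hE σ (t := t) hσ x hW₁
  refine ⟨V, k.trans k₁, extMap p (σ.proj h) z, hV, σ.isKilled_extMap_proj h z, ?_⟩
  rw [← res_res k₁ k, ← e₁, res_toExt, app_extPow_map, ← e]
  exact congrArg _ (σ.extMap_exIncl_toExcess h z)

/-- Where `s` takes the value `1`, the sections over the vanishing locus are zero. -/
theorem eq_zero_of_cosec_eq_one {V : Opens X} {m : Sec E V} (hm : cosec s V m = 1)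
    {F : ModuleSheaf (vanishingSheaf s)} (a : Sec F (trace s V)) : a = 0 := by
  have h := pullFn_cosec s m
  rw [hm, map_one] at h
  rw [← one_smul (Fn (vanishingSheaf s) (trace s V)) a]
  exact (congrArg (· • a) h).trans (zero_smul _ _)

end Excess

/-! ### The homology sheaves of the Koszul complex. -/

section Cycles

variable {X : TopCat.{0}} {O : Sheaf (Opens.grothendieckTopology X) CommRingCat.{0}}
  {E : ModuleSheaf O} {s : E ⟶ structureModule O}

theorem isCycle_toExt {p : ℕ} {V : Opens X} {z : ⋀[Fn O V]^p (Sec E V)}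
    (hz : IsKilled (cosec s V) z) : IsCycle (koszul s) p (toExt p E V z) := by
  intro q
  by_cases h : q + 1 = p
  · subst h
    rw [koszul_d]
    refine (app_koszulD s q V z).trans ?_
    rw [(isKilled_succ _ _).1 hz, map_zero]
    rfl
  · rw [(koszul s).shape p q h]
    rfl

/-- The representative in `⋀^p E(W)` of a sheaf cycle has a differential that is zero only after
sheafification, hence the second shrinking. -/
theorem exists_isKilled_of_isCycle {p : ℕ} {V : Opens X} {a : Sec ((extPow p).obj E) V}
    (ha : IsCycle (koszul s) p a) {x : X} (hx : x ∈ V) :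
    ∃ (W : Opens X) (k : W ≤ V) (z : ⋀[Fn O W]^p (Sec E W)), x ∈ W ∧ IsKilled (cosec s W) z ∧
      toExt p E W z = res ((extPow p).obj E) k a := by
  obtain ⟨W, k, z, hW, e⟩ := exists_toExt (M := E) a hx
  cases p with
  | zero => exact ⟨W, k, z, hW, isKilled_zero _ _, e⟩
  | succ p =>
    have h0 : toExt p E W (contract (cosec s W) p z) = 0 := by
      have h1 := ha p
      rw [koszul_d] at h1
      rw [← app_koszulD, e, app_res]
      exact (congrArg (res _ k) h1).trans (map_zero _)
    obtain ⟨W', k', hW', e'⟩ := toExt_eq_zero _ h0 hW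
    refine ⟨W', k'.trans k, extMap (p + 1) (res E k') z, hW', (isKilled_succ _ _).2 ?_, ?_⟩
    · rw [← extMap_contract (cosec s W) (cosec s W') (res E k') (fun m => cosec_res s k' m), e']
    · rw [← res_toExt, e, res_res]

theorem koszul_d_toExt {p : ℕ} {V : Opens X} (w : ⋀[Fn O V]^(p + 1) (Sec E V)) :
    app ((koszul s).d (p + 1) p) V (toExt (p + 1) E V w) = toExt p E V (contract (cosec s V) p w) := by
  rw [koszul_d]
  exact app_koszulD s p V w

theorem cyclesComparison_iCycles {C D : Type*} [Category* C] [Category* D] [Abelian C] [Abelian D]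
    {L : C ⥤ D} [L.Additive] {ι : Type*} {c : ComplexShape ι} (K : HomologicalComplex C c) (p : ι) :
    cyclesComparison (L := L) K p ≫ ((L.mapHomologicalComplex c).obj K).iCycles p =
      L.map (K.iCycles p) :=
  HomologicalComplex.liftCycles_i _ _ _ _ _

theorem homologyπ_zeroDifferentialHomology {C : Type*} [Category* C] [Abelian C] (A : ℕ → C)
    (p : ℕ) : (zeroDifferential A).homologyπ p ≫ (zeroDifferentialHomology A p).hom =
      (zeroDifferential A).iCycles p := by
  have h : (zeroDifferential A).homologyπ p ≫ ((zeroDifferential A).isoHomologyπ _ p rfl rfl).inv =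
      𝟙 _ := HomologicalComplex.isoHomologyπ_hom_inv_id _ _ _ _ _
  exact (Category.assoc _ _ _).symm.trans ((congrArg (fun g => CategoryStruct.comp g ((zeroDifferential A).iCycles p)) h).trans
    (Category.id_comp _))

/-- Each comparison in `homologyRestriction` is compatible with the projection from cycles, so the
class of a cycle is sent to the restriction of the cycle itself. -/
theorem map_homologyπ_homologyRestriction (Φ : koszulOnT s ≅ symShift ((restrictToT s).obj E))
    (p : ℕ) : (restrictToT s).map ((koszul s).homologyπ p) ≫ homologyRestriction s Φ p =
      (restrictToT s).map ((koszul s).iCycles p) ≫ Φ.hom.f p := by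
  rw [homologyRestriction, ← Category.assoc, map_homologyπ_homologyComparison, Category.assoc,
    ← cyclesComparison_iCycles]
  refine Eq.trans ?_ (Category.assoc _ _ _).symm
  refine congrArg (CategoryStruct.comp (cyclesComparison (koszul s) p)) ?_
  refine (HomologicalComplex.homologyπ_naturality_assoc Φ.hom p _).trans ?_
  refine (congrArg _ (homologyπ_zeroDifferentialHomology _ p)).trans ?_
  exact HomologicalComplex.cyclesMap_i Φ.hom p

/-- The class of a cycle, restricted to the vanishing locus. -/
theorem app_homologyRestriction {Φ : koszulOnT s ≅ symShift ((restrictToT s).obj E)} {p : ℕ}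
    (hΦ : Φ.hom.f p = pullExtPow (incl s) (inclRingHom s) p E) {V : Opens X}
    (z : Sec ((koszul s).cycles p) V) :
    app (homologyRestriction s Φ p) _ (toTrace s _ V (app ((koszul s).homologyπ p) V z)) =
      tracePow s p V (app ((koszul s).iCycles p) V z) := by
  have h := congrArg (fun f => app f _ (toTrace s _ V z)) (map_homologyπ_homologyRestriction Φ p)
  rw [hΦ] at h
  refine (congrArg _ (app_pull_map (incl s) (inclRingHom s) ((koszul s).homologyπ p) V z)).symm.trans ?_
  refine h.trans ?_
  refine (congrArg (app (pullExtPow (incl s) (inclRingHom s) p E) _)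
    (app_pull_map (incl s) (inclRingHom s) ((koszul s).iCycles p) V z)).trans ?_
  exact app_pullExtPow_toTrace s _

theorem exists_homologyπ_eq {p : ℕ} {V : Opens X} (y : Sec ((koszul s).homology p) V) {x : X}
    (hx : x ∈ V) : ∃ (W : Opens X) (k : W ≤ V) (z : ⋀[Fn O W]^p (Sec E W))
      (c : Sec ((koszul s).cycles p) W), x ∈ W ∧ IsKilled (cosec s W) z ∧
      app ((koszul s).iCycles p) W c = toExt p E W z ∧
      app ((koszul s).homologyπ p) W c = res _ k y := by
  obtain ⟨W, k, c, hW, e⟩ := locSurj_of_epi ((koszul s).homologyπ p) V y x hx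
  obtain ⟨W', k', z, hW', hz, e'⟩ := exists_isKilled_of_isCycle (isCycle_iCycles _ p c) hW
  exact ⟨W', k'.trans k, z, res _ k' c, hW', hz, by rw [app_res]; exact e'.symm,
    by rw [app_res, e, res_res]⟩

variable {Φ : koszulOnT s ≅ symShift ((restrictToT s).obj E)} {p : ℕ}

theorem app_homologyRestriction_eq (hΦ : Φ.hom.f p = pullExtPow (incl s) (inclRingHom s) p E)
    {W V : Opens X} {k : W ≤ V} {y : Sec ((koszul s).homology p) V} {z : ⋀[Fn O W]^p (Sec E W)}
    {c : Sec ((koszul s).cycles p) W} (hc : app ((koszul s).iCycles p) W c = toExt p E W z)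
    (hy : app ((koszul s).homologyπ p) W c = res _ k y) :
    app (homologyRestriction s Φ p) _ (toTrace s _ W (res _ k y)) =
      toExt p _ _ (extMap p (toTrace s E W) z) := by
  rw [← hy]
  refine (app_homologyRestriction hΦ c).trans ?_
  rw [hc]
  exact tracePow_toExt s z

variable (s Φ p) in
/-- The morphism `H_p(K) → j_* ⋀^p j^* E` adjoint to the restriction. -/
def homologyToPush : (koszul s).homology p ⟶ (pushFromT s).obj ((extPow p).obj ((restrictToT s).obj E)) :=
  (pullPushAdj (incl s) (inclRingHom s)).homEquiv _ _ (homologyRestriction s Φ p)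

theorem app_homologyToPush (V : Opens X) (y : Sec ((koszul s).homology p) V) :
    app (homologyToPush s Φ p) V y = app (homologyRestriction s Φ p) _ (toTrace s _ V y) :=
  app_homEquiv (incl s) (inclRingHom s) (homologyRestriction s Φ p) V y

/-- A class is locally that of a cycle `z` in `⋀^p E(W)`. If it is sent to zero then `z` restricts
to zero on the locus, so it is locally a boundary. -/
theorem mono_homologyToPush (hE : IsVectorBundle E) (hs : HasRegularFactorizations s)
    (hΦ : Φ.hom.f p = pullExtPow (incl s) (inclRingHom s) p E) : Mono (homologyToPush s Φ p) := by
  refine mono_of_injective _ fun V y hy => sec_eq_zero fun x hx => ?_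
  obtain ⟨W, k, z, c, hW, hz, hc, e⟩ := exists_homologyπ_eq y hx
  have h0 : toExt p _ _ (extMap p (toTrace s E W) z) = 0 := by
    rw [← app_homologyRestriction_eq hΦ hc e]
    refine (app_homologyToPush W _).symm.trans ?_
    rw [app_res, hy, map_zero]
    rfl
  refine ⟨W, k, hW, ?_⟩
  rw [← e]
  refine homologyπ_eq_zero_of_boundary _ _ _ fun x hx => ?_
  obtain ⟨W', k', w, hW', e'⟩ := exists_contract_eq_of_toTrace_eq_zero hE hs hx z hz h0
  refine ⟨W', k', toExt (p + 1) E W' w, hW', ?_⟩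
  rw [koszul_d_toExt, e', hc]
  exact (res_toExt k' z).symm

/-- Two monomorphisms to `j_* ⋀^p j^* E` are compared, from `H_p` and from `j_* ⋀^p N`. Cycles
restrict locally to the excess part, and every section of the excess part comes locally from a
cycle. So each one lifts through the other, and the lifts are mutually inverse. -/
theorem exists_homology_iso (hE : IsVectorBundle E) (hs : HasRegularFactorizations s)
    (hΦ : Φ.hom.f p = pullExtPow (incl s) (inclRingHom s) p E) :
    ∃ e : (koszul s).homology p ≅ (pushFromT s).obj ((extPow p).obj (excess s)),
      e.hom ≫ (pushFromT s).map ((extPow p).map (excessInclusion s)) = homologyToPush s Φ p := by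
  have := mono_homologyToPush hE hs hΦ
  have := mono_extPow_excessInclusion hE hs p
  have : Mono ((pushFromT s).map ((extPow p).map (excessInclusion s))) :=
    mono_of_injective _ fun V a ha => injective_of_mono ((extPow p).map (excessInclusion s)) _
      (ha.trans (map_zero _).symm)
  obtain ⟨l, hl⟩ := exists_lift_of_locally_mem (homologyToPush s Φ p)
    ((pushFromT s).map ((extPow p).map (excessInclusion s))) fun V y x hx => by
      obtain ⟨W, k, z, c, hW, hz, hc, e⟩ := exists_homologyπ_eq y hx
      obtain ⟨W', k', b, hW', e'⟩ := exists_excess_of_isKilled hE hs hW z hz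
      refine ⟨W', k'.trans k, b, hW', ?_⟩
      refine e'.trans ?_
      rw [← res_res k k', app_res, extMap_toTrace_res, ← res_toExt,
        ← app_homologyRestriction_eq hΦ hc e]
      exact congrArg _ (app_homologyToPush W _).symm
  obtain ⟨l', hl'⟩ := exists_lift_of_locally_mem
    ((pushFromT s).map ((extPow p).map (excessInclusion s))) (homologyToPush s Φ p) fun V a x hx => by
      by_cases hxs : x ∈ zeroLocus s
      · obtain ⟨V', k, z, hV', hz, e⟩ := exists_isKilled_of_excess hE hs (W := trace s V) a
          (t := ⟨x, hxs⟩) hx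
        have k₁ : V' ⊓ V ≤ V' := inf_le_left
        have k₂ : V' ⊓ V ≤ V := inf_le_right
        obtain ⟨c, hc⟩ := exists_cycle _ p _ (isCycle_toExt (hz.extMap fun m => cosec_res s k₁ m))
        refine ⟨V' ⊓ V, k₂, app ((koszul s).homologyπ p) _ c, ⟨hV', hx⟩, ?_⟩
        have h1 := app_homologyRestriction_eq (k := le_rfl) hΦ hc (res_self le_rfl _).symm
        rw [res_self, extMap_toTrace_res, ← res_toExt, ← e, ← app_res] at h1
        exact (app_homologyToPush _ _).trans (h1.trans
          (congrArg _ (res_res (M := (extPow p).obj (excess s)) k (trace_mono s k₁) a)))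
      -- Off the zero locus the direct image has no nonzero section, so the class `0` will do.
      · obtain ⟨W, m, hW, hm⟩ := exists_cosec_eq_one hxs
        refine ⟨W ⊓ V, inf_le_right, 0, ⟨hW, hx⟩, ?_⟩
        have hm' : cosec s (W ⊓ V) (res E inf_le_left m) = 1 := by rw [cosec_res, hm, map_one]
        refine (map_zero _).trans (Eq.symm ?_)
        exact eq_zero_of_cosec_eq_one hm' _
  refine ⟨⟨l, l', ?_, ?_⟩, hl⟩
  · rw [← cancel_mono (homologyToPush s Φ p), Category.assoc, hl', hl, Category.id_comp]
  · rw [← cancel_mono ((pushFromT s).map ((extPow p).map (excessInclusion s))), Category.assoc, hl,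
      hl', Category.id_comp]

/-- Sections of `F` over a trace are sections of `j_* F`, that is of `M`, and sections of `j^* M`
come locally from `M`. In effect `j^* j_* F ≅ F` for the closed immersion `j`. -/
theorem isIso_homEquiv_symm_of_iso {M : ModuleSheaf O} {F : ModuleSheaf (vanishingSheaf s)}
    (e : M ≅ (pushFromT s).obj F) :
    IsIso (((pullPushAdj (incl s) (inclRingHom s)).homEquiv M F).symm e.hom) := by
  set g := ((pullPushAdj (incl s) (inclRingHom s)).homEquiv M F).symm e.hom with hg
  have H (V : Opens X) (m : Sec M V) : app g _ (toTrace s M V m) = app e.hom V m :=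
    app_homEquiv_symm (incl s) (inclRingHom s) e.hom V m
  have : Epi g := epi_of_locSurj fun W b t ht => by
    obtain ⟨V, rfl⟩ := exists_open_of_vanishingLocus s W
    refine ⟨trace s V, le_rfl, toTrace s M V (app e.inv V b), ht, ?_⟩
    rw [H, res_self]
    exact congrArg (fun f => app f V b) e.inv_hom_id
  have : Mono g := mono_of_injective _ fun W a ha => sec_eq_zero fun t ht => by
    obtain ⟨V, h, m, hV, e'⟩ := exists_toTrace s M a ht
    refine ⟨trace s V, h, hV, ?_⟩
    have h0 : app e.hom V m = 0 := by
      rw [← H, e']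
      refine (app_res g h a).trans ?_
      rw [ha, map_zero]
      rfl
    refine e'.symm.trans ?_
    rw [injective_of_mono e.hom V (h0.trans (map_zero _).symm), map_zero]
  exact isIso_of_mono_of_epi _

/-- The restriction of classes is an isomorphism followed by the inclusion of `⋀^p N`, which gives
injectivity and the equality of images. Uniqueness holds because that inclusion is mono and the
adjunction is bijective. -/
theorem homologyRestriction_spec (hE : IsVectorBundle E) (hs : HasRegularFactorizations s)
    (hΦ : Φ.hom.f p = pullExtPow (incl s) (inclRingHom s) p E) :
    Mono (homologyRestriction s Φ p) ∧ Mono ((extPow p).map (excessInclusion s)) ∧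
      imageSubobject (homologyRestriction s Φ p) =
        imageSubobject ((extPow p).map (excessInclusion s)) ∧
      ∃! e : (koszul s).homology p ≅ (pushFromT s).obj ((extPow p).obj (excess s)),
        ((pullPushAdj (incl s) (inclRingHom s)).homEquiv _ _).symm e.hom ≫
          (extPow p).map (excessInclusion s) = homologyRestriction s Φ p := by
  have hm := mono_extPow_excessInclusion hE hs p
  obtain ⟨e, he⟩ := exists_homology_iso hE hs hΦ
  have key (e : (koszul s).homology p ≅ (pushFromT s).obj ((extPow p).obj (excess s))) :
      ((pullPushAdj (incl s) (inclRingHom s)).homEquiv _ _).symm e.hom ≫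
        (extPow p).map (excessInclusion s) = ((pullPushAdj (incl s) (inclRingHom s)).homEquiv _ _).symm
          (e.hom ≫ (pushFromT s).map ((extPow p).map (excessInclusion s))) :=
    ((pullPushAdj (incl s) (inclRingHom s)).homEquiv_naturality_right_symm _ _).symm
  have he' : ((pullPushAdj (incl s) (inclRingHom s)).homEquiv _ _).symm e.hom ≫
      (extPow p).map (excessInclusion s) = homologyRestriction s Φ p := by
    rw [key, he]
    exact Equiv.symm_apply_apply _ _
  have := isIso_homEquiv_symm_of_iso e
  refine ⟨?_, hm, ?_, e, he', fun e₁ h₁ => ?_⟩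
  · rw [← he']
    exact mono_comp _ _
  · rw [← he']
    exact imageSubobject_iso_comp _ _
  · refine Iso.ext (((pullPushAdj (incl s) (inclRingHom s)).homEquiv _ _).symm.injective ?_)
    exact (cancel_mono _).1 (h₁.trans he'.symm)

end Cycles

/-! ### Morphisms defined by their graphs, and a criterion for quasi-isomorphisms. -/

section QuasiIso

variable {X : TopCat.{0}} {O : Sheaf (Opens.grothendieckTopology X) CommRingCat.{0}}

/-- A morphism of sheaves of modules can be given by a relation which is locally defined and
single-valued. -/
theorem exists_hom_of_relation {M N : ModuleSheaf O}
    (R : ∀ V, Submodule (Fn O V) (Sec M V × Sec N V))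
    (hR : ∀ {V W : Opens X} (h : W ≤ V) (a : Sec M V) (b : Sec N V), (a, b) ∈ R V →
      (res M h a, res N h b) ∈ R W)
    (htot : ∀ V (a : Sec M V), ∀ x ∈ V, ∃ (W : Opens X) (k : W ≤ V) (b : Sec N W),
      x ∈ W ∧ (res M k a, b) ∈ R W)
    (hzero : ∀ V (b : Sec N V), (0, b) ∈ R V → b = 0) :
    ∃ f : M ⟶ N, ∀ V (a : Sec M V) (b : Sec N V), (a, b) ∈ R V → app f V a = b := by
  let i (V : Opens X) : (Sec M V × Sec N V) →ₗ[Fn O V] Sec (M ⊞ N) V :=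
    (app biprod.inl V).coprod (app biprod.inr V)
  -- In the quotient of `M ⊞ N` by the relation, `N` stays embedded because the relation is
  -- single-valued, and sections of `M` lie locally in `N` because it is locally total. There `(a,
  -- b)` becomes zero, so `M` maps to `N` by minus the wanted morphism.
  obtain ⟨C, q, h0, h1⟩ := exists_quotient (M ⊞ N) (fun V => (R V).map (i V)) (by
    rintro V W h _ ⟨⟨a, b⟩, hab, rfl⟩
    refine ⟨_, hR h a b hab, ?_⟩
    rw [LinearMap.coprod_apply, LinearMap.coprod_apply, map_add, app_res, app_res])
  have hfst {V : Opens X} (a : Sec M V) (b : Sec N V) : app biprod.fst V (i V (a, b)) = a := by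
    rw [LinearMap.coprod_apply, map_add, ← app_comp, ← app_comp, biprod.inl_fst, biprod.inr_fst,
      app_zero, add_zero]
    rfl
  have hsnd {V : Opens X} (a : Sec M V) (b : Sec N V) : app biprod.snd V (i V (a, b)) = b := by
    rw [LinearMap.coprod_apply, map_add, ← app_comp, ← app_comp, biprod.inl_snd, biprod.inr_snd,
      app_zero, zero_add]
    rfl
  have hmono : Mono (biprod.inr ≫ q) := mono_of_injective _ fun V b hb => sec_eq_zero fun x hx => by
    obtain ⟨W, k, hW, ⟨a, b'⟩, hab, e⟩ := h1 V _ hb x hx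
    refine ⟨W, k, hW, ?_⟩
    have e' : res (M ⊞ N) k (app biprod.inr V b) = i W (0, res N k b) := by
      rw [LinearMap.coprod_apply, map_zero, zero_add, app_res]
    replace e := e.trans e'
    have e₁ := congrArg (app biprod.fst W) e
    have e₂ := congrArg (app biprod.snd W) e
    rw [hfst, hfst] at e₁
    rw [hsnd, hsnd] at e₂
    exact hzero W _ (e₁ ▸ e₂ ▸ hab)
  have key {V : Opens X} (a : Sec M V) (b : Sec N V) (hab : (a, b) ∈ R V) :
      app (biprod.inr ≫ q) V (-b) = app (biprod.inl ≫ q) V a := by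
    have h := h0 V _ ⟨_, hab, rfl⟩
    rw [LinearMap.coprod_apply, map_add, add_eq_zero_iff_eq_neg] at h
    rw [map_neg]
    exact h.symm
  obtain ⟨l, hl⟩ := exists_lift_of_locally_mem (biprod.inl ≫ q) (biprod.inr ≫ q)
    fun V a x hx => by
      obtain ⟨W, k, b, hW, hab⟩ := htot V a x hx
      exact ⟨W, k, -b, hW, key _ _ hab⟩
  refine ⟨-l, fun V a b hab => ?_⟩
  have h2 : app l V a = -b := injective_of_mono (biprod.inr ≫ q) V (by
    rw [key a b hab, ← hl]
    rfl)
  change -app l V a = b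
  rw [h2, neg_neg]

/-- A criterion for a morphism to a complex with zero differentials to be a quasi-isomorphism. -/
theorem quasiIso_of_zero_differential {K L : ChainComplex (ModuleSheaf O) ℕ} (f : K ⟶ L)
    (hL : ∀ i j, L.d i j = 0)
    (hinj : ∀ p V (z : Sec (K.X p) V), IsCycle K p z → app (f.f p) V z = 0 → ∀ x ∈ V,
      ∃ (W : Opens X) (k : W ≤ V) (w : Sec (K.X (p + 1)) W), x ∈ W ∧
        app (K.d (p + 1) p) W w = res _ k z)
    (hsurj : ∀ p V (b : Sec (L.X p) V), ∀ x ∈ V, ∃ (W : Opens X) (k : W ≤ V)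
      (z : Sec (K.X p) W), x ∈ W ∧ IsCycle K p z ∧ app (f.f p) W z = res _ k b) : QuasiIso f := by
  have hi {p : ℕ} {V : Opens X} (c : Sec (K.cycles p) V) :
      app (L.iCycles p) V (app (HomologicalComplex.cyclesMap f p) V c) =
        app (f.f p) V (app (K.iCycles p) V c) :=
    congrArg (fun g => app g V c) (HomologicalComplex.cyclesMap_i f p)
  have hπ {p : ℕ} {V : Opens X} (c : Sec (K.cycles p) V) :
      app (HomologicalComplex.homologyMap f p) V (app (K.homologyπ p) V c) =
        app (L.homologyπ p) V (app (HomologicalComplex.cyclesMap f p) V c) :=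
    congrArg (fun g => app g V c) (HomologicalComplex.homologyπ_naturality f p)
  refine ⟨fun p => ?_⟩
  rw [quasiIsoAt_iff_isIso_homologyMap]
  have : Mono (HomologicalComplex.homologyMap f p) := mono_of_injective _ fun V y hy =>
    sec_eq_zero fun x hx => by
      obtain ⟨W, k, c, hW, e⟩ := locSurj_of_epi (K.homologyπ p) V y x hx
      have h1 : app (L.homologyπ p) W (app (HomologicalComplex.cyclesMap f p) W c) = 0 := by
        rw [← hπ, e, app_res, hy, map_zero]
      -- The target has no nonzero boundaries, so a cycle with zero class there is zero.
      have h2 : app (f.f p) W (app (K.iCycles p) W c) = 0 := sec_eq_zero fun x' hx' => by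
        obtain ⟨W', k', w, hW', e'⟩ := boundary_of_homologyπ_eq_zero L p _ h1 hx'
        refine ⟨W', k', hW', ?_⟩
        rw [← hi, ← e', hL, app_zero]
      refine ⟨W, k, hW, ?_⟩
      rw [← e]
      exact homologyπ_eq_zero_of_boundary K p c (hinj p W _ (isCycle_iCycles K p c) h2)
  have : Epi (HomologicalComplex.homologyMap f p) := epi_of_locSurj fun V y x hx => by
    obtain ⟨W, k, c', hW, e⟩ := locSurj_of_epi (L.homologyπ p) V y x hx
    obtain ⟨W', k', z, hW', hz, e'⟩ := hsurj p W (app (L.iCycles p) W c') x hW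
    obtain ⟨c, rfl⟩ := exists_cycle K p z hz
    refine ⟨W', k'.trans k, app (K.homologyπ p) W' c, hW', ?_⟩
    have h1 : app (HomologicalComplex.cyclesMap f p) W' c = res _ k' c' :=
      injective_of_mono (L.iCycles p) W' (by rw [hi, e', app_res])
    rw [hπ, h1, app_res, e, res_res]
  exact isIso_of_mono_of_epi _

end QuasiIso

/-! ### The local quasi-isomorphism. -/

section Local

variable {X : TopCat.{0}} {O : Sheaf (Opens.grothendieckTopology X) CommRingCat.{0}}
  {E : ModuleSheaf O} {s : E ⟶ structureModule O}

/-- The splitting is dominated, near each point of the vanishing locus, by a regular one. -/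
def Splitting.IsLocallyRegular {U : Opens X} {d : ℕ} (σ : Splitting s U d) : Prop :=
  ∀ t ∈ zeroLocus s, t ∈ U → ∃ (U' : Opens X) (h : U' ≤ U) (ht : t ∈ U') (d' : ℕ)
    (σ' : Splitting s U' d'), σ'.IsRegularAt ht ∧ ∀ {V : Opens X} (k : V ≤ U') (m : Sec E V),
      (∀ i, σ'.θ k i m = 0) → ∀ i, σ.θ (k.trans h) i m = 0

theorem exists_isLocallyRegular (hs : HasRegularFactorizations s) (y : X) :
    ∃ (U : Opens X) (_ : y ∈ U) (d : ℕ) (σ : Splitting s U d), σ.IsLocallyRegular := by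
  by_cases hy : y ∈ zeroLocus s
  · exact exists_regular_splitting hs hy
  -- Where `s m = 1`, the single pair of `m` and `s` itself is a splitting; there is no zero in `U`,
  -- so the regularity condition is void.
  obtain ⟨U, m, hU, hm⟩ := exists_cosec_eq_one hy
  refine ⟨U, hU, 1,
    { x := fun _ => m
      θ := fun {V} _ _ => cosec s V
      θ_res := fun _ k _ a => cosec_res s k a
      θ_x := fun h i k => by rw [if_pos (Subsingleton.elim i k), cosec_res, hm, map_one]
      cosec_eq := fun h a => by simp [cosec_res, hm] }, fun t ht htU => ?_⟩
  refine absurd ((Ideal.eq_top_iff_one _).2 ?_) ht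
  have := germAt_cosec_mem s htU m
  rwa [hm, map_one] at this

namespace Splitting

variable {U : Opens X} {d : ℕ} {σ : Splitting s U d}

/-- On cycles, the projection to the excess bundle is compatible with the restriction. -/
theorem toExt_toTrace_eq (hE : IsVectorBundle E) (hσ : σ.IsLocallyRegular) {p : ℕ} {V : Opens X}
    (h : V ≤ U) (z : ⋀[Fn O V]^p (Sec E V)) (hz : IsKilled (cosec s V) z) :
    toExt p _ _ (extMap p (toTrace s E V) z) =
      app ((extPow p).map (excessInclusion s)) _ (toExt p _ _ (extMap p (σ.toExcess h) z)) := by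
  rw [← sub_eq_zero]
  refine trace_sec_eq_zero s fun t ht => ?_
  obtain ⟨U', h', htU', d', σ', hreg, hker⟩ := hσ (incl s t) t.2 (h ht)
  obtain ⟨W, k, hW', w, z₀, hW, e, e₀⟩ := exists_decomposition hE σ' hreg (V := V) ht z hz
  -- The projection of `σ` fixes the image of that of `σ'`, since the forms of `σ` vanish wherever
  -- those of `σ'` do. So regularity of `σ'` is enough.
  have e₁ : extMap p (σ.proj (hW'.trans h')) z₀ = z₀ := by
    conv_lhs => rw [← e₀]
    conv_rhs => rw [← e₀]
    exact (extMap_comp p (RingHom.id_comp _) (σ'.proj hW') (σ.proj (hW'.trans h')) (σ'.proj hW')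
      (fun m => (σ.proj_eq_self _ (hker hW' _ fun i => σ'.θ_proj hW' i m)).symm) z₀).symm
  refine ⟨W, k, hW, ?_⟩
  rw [map_sub, sub_eq_zero, ← app_res]
  refine (res_toExt _ _).trans (Eq.trans ?_ (congrArg _ (res_toExt _ _).symm))
  rw [← extMap_toTrace_res s k, ← σ.extMap_toExcess_res h z k, e,
    map_add (extMap p (toTrace s E W)), map_add (extMap p (σ.toExcess _)),
    extMap_toTrace_contract, σ.extMap_toExcess_contract, zero_add, zero_add, app_extPow_map]
  conv_lhs => rw [← e₁]
  exact congrArg _ (σ.extMap_exIncl_toExcess _ z₀).symm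

/-- Sections of `⋀^p E` come only locally from `⋀^p E(V)`, so the morphism is given by its graph. It
is single-valued because an element that dies in the sheaf is locally zero, and `toExcess` commutes
with restrictions. -/
theorem exists_hom_toExcess (σ : Splitting s U d) (p : ℕ) :
    ∃ f : (restr U).obj ((extPow p).obj E) ⟶
      (restr U).obj ((pushFromT s).obj ((extPow p).obj (excess s))),
      ∀ V (z : ⋀[Fn O (extend U V)]^p (Sec E (extend U V))),
        app f V (toExt p E (extend U V) z) =
          toExt p (excess s) (trace s (extend U V)) (extMap p (σ.toExcess (extend_le U V)) z) := by
  let R (V : Opens ((Opens.toTopCat X).obj U)) : Submodule (Fn (restrictSheaf O U) V)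
      (Sec ((restr U).obj ((extPow p).obj E)) V ×
        Sec ((restr U).obj ((pushFromT s).obj ((extPow p).obj (excess s)))) V) :=
    { carrier := {a | ∃ z : ⋀[Fn O (extend U V)]^p (Sec E (extend U V)),
        a.1 = toExt p E (extend U V) z ∧ a.2 =
          toExt p (excess s) (trace s (extend U V)) (extMap p (σ.toExcess (extend_le U V)) z)}
      zero_mem' := ⟨0, (map_zero _).symm, by rw [map_zero, map_zero]; rfl⟩
      add_mem' := by
        rintro _ _ ⟨z, h₁, h₂⟩ ⟨z', h₁', h₂'⟩
        refine ⟨z + z', ?_, ?_⟩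
        · rw [map_add, Prod.fst_add, h₁, h₁']
          rfl
        · rw [map_add, map_add, Prod.snd_add, h₂, h₂']
          rfl
      smul_mem' := by
        rintro c _ ⟨z, h₁, h₂⟩
        let c' : Fn O (extend U V) := c
        refine ⟨c' • z, ?_, ?_⟩
        · exact (congrArg (fun y : Sec ((restr U).obj ((extPow p).obj E)) V => c • y) h₁).trans
            (map_smul (toExt p E (extend U V)) c' z).symm
        · rw [map_smulₛₗ, map_smul]
          exact congrArg (fun y : Sec ((restr U).obj ((pushFromT s).obj
            ((extPow p).obj (excess s)))) V => c • y) h₂ }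
  obtain ⟨f, hf⟩ := exists_hom_of_relation R (by
    rintro V W h a b ⟨z, h₁, h₂⟩
    refine ⟨extMap p (res E (extend_mono U h)) z, ?_, ?_⟩
    · exact (congrArg (res ((extPow p).obj E) (extend_mono U h)) h₁).trans (res_toExt _ z)
    · rw [σ.extMap_toExcess_res (extend_le U V) z (extend_mono U h), ← res_toExt]
      exact congrArg (res ((extPow p).obj (excess s)) (trace_mono s (extend_mono U h))) h₂) (by
    intro V a x hx
    obtain ⟨W, k, z, hW, e⟩ := exists_toExt (M := E) (V := extend U V) a (mem_extend hx)
    have k' := extend_cut_le U W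
    refine ⟨cut U W, cut_le k, _, hW, extMap p (res E k') z, ?_, rfl⟩
    rw [← res_toExt, e]
    exact (res_res (M := (extPow p).obj E) k k' a).symm) (by
    rintro V b ⟨z, h₁, h₂⟩
    refine h₂.trans (trace_sec_eq_zero s fun t ht => ?_)
    obtain ⟨W, k, hW, e⟩ := toExt_eq_zero z h₁.symm (t := incl s t) ht
    refine ⟨W, k, hW, ?_⟩
    rw [res_toExt, ← σ.extMap_toExcess_res (extend_le U V) z k, e, map_zero, map_zero])
  exact ⟨f, fun V z => hf V _ _ ⟨z, rfl, rfl⟩⟩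

end Splitting

/-- The morphism is `⋀^p` of the projection to the excess bundle. On cycles, followed by the
inclusion in `⋀^p j^* E`, it is restriction to the locus (`toExt_toTrace_eq`). So a cycle sent to
zero is locally a boundary; and a cycle lifting a section of `⋀^p N` after that inclusion already
lifts it before, the inclusion being mono. -/
theorem locallyQuasiIso_koszul (hE : IsVectorBundle E) (hs : HasRegularFactorizations s) :
    LocallyQuasiIso (koszul s) (pushSymExcess s) := by
  intro y
  obtain ⟨U, hU, d, σ, hσ⟩ := exists_isLocallyRegular hs y
  choose f hf using fun p => σ.exists_hom_toExcess p
  have hzero (p : ℕ) (V : Opens ((Opens.toTopCat X).obj U))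
      (w : Sec ((extPow (p + 1)).obj E) (extend U V)) :
      app (f p) V (app ((koszul s).d (p + 1) p) (extend U V) w) = 0 :=
    sec_eq_zero (M := (restr U).obj ((pushFromT s).obj ((extPow p).obj (excess s)))) fun x hx => by
      obtain ⟨W, k, z, hW, e⟩ := exists_toExt w (mem_extend hx)
      have k' := extend_cut_le U W
      refine ⟨cut U W, cut_le k, hW, ?_⟩
      refine (app_res (f p) (cut_le k) _).symm.trans ?_
      have h1 : res ((extPow p).obj E) (extend_mono U (cut_le k))
          (app ((koszul s).d (p + 1) p) (extend U V) w) =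
          toExt p E _ (contract (cosec s _) p (extMap (p + 1) (res E k') z)) := by
        rw [← koszul_d_toExt, ← res_toExt, e]
        refine (app_res ((koszul s).d (p + 1) p) _ w).symm.trans (congrArg _ ?_)
        exact (res_res (M := (extPow (p + 1)).obj E) k k' w).symm
      refine (congrArg (app (f p) (cut U W)) h1).trans ((hf p _ _).trans ?_)
      rw [σ.extMap_toExcess_contract, map_zero]
      rfl
  let g : ((restr U).mapHomologicalComplex _).obj (koszul s) ⟶
      ((restr U).mapHomologicalComplex _).obj (pushSymExcess s) :=
    { f := f
      comm' := by
        intro i j hij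
        obtain rfl : j + 1 = i := hij
        refine hom_ext_sections fun V w => ?_
        exact (hzero j V w).symm }
  refine ⟨U, hU, g, quasiIso_of_zero_differential g (fun i j => rfl)
    (fun p V a ha h0 x hx => ?_) fun p V b x hx => ?_⟩
  · obtain ⟨W, k, z, hW, hz, e⟩ := exists_isKilled_of_isCycle (V := extend U V) (a := a) ha
      (mem_extend hx)
    have k' := extend_cut_le U W
    have hz' : IsKilled (cosec s (extend U (cut U W))) (extMap p (res E k') z) :=
      hz.extMap fun m => cosec_res s k' m
    have e' : toExt p E (extend U (cut U W)) (extMap p (res E k') z) =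
        res ((extPow p).obj E) (extend_mono U (cut_le k)) a := by
      rw [← res_toExt, e]
      exact res_res (M := (extPow p).obj E) k k' a
    have h1 : app (f p) (cut U W) (toExt p E (extend U (cut U W)) (extMap p (res E k') z)) = 0 := by
      rw [e']
      refine (app_res (f p) (cut_le k) a).trans ((congrArg _ h0).trans (map_zero _))
    have h2 := σ.toExt_toTrace_eq hE hσ (extend_le U (cut U W)) _ hz'
    rw [(hf p _ _).symm.trans h1] at h2
    obtain ⟨W', l, w, hW', e₁⟩ := exists_contract_eq_of_toTrace_eq_zero hE hs
      (mem_extend (V := cut U W) hW) _ hz' (h2.trans (map_zero _))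
    have l' := extend_cut_le U W'
    refine ⟨cut U W', (cut_le l).trans (cut_le k), toExt (p + 1) E _ (extMap (p + 1) (res E l') w),
      hW', ?_⟩
    refine (koszul_d_toExt _).trans ?_
    rw [← extMap_contract (cosec s W') (cosec s _) (res E l') (fun m => cosec_res s l' m), e₁,
      ← res_toExt, ← res_toExt, e', res_res]
    exact res_res (M := (extPow p).obj E) _ _ a
  · by_cases hxs : x.1 ∈ zeroLocus s
    · obtain ⟨V', k, z, hV', hz, e⟩ := exists_isKilled_of_excess hE hs
        (W := trace s (extend U V)) b (t := ⟨x.1, hxs⟩) (mem_extend hx)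
      have k₁ : extend U (cut U V' ⊓ V) ≤ V' :=
        (extend_mono U inf_le_left).trans (extend_cut_le U V')
      have hz' : IsKilled (cosec s (extend U (cut U V' ⊓ V))) (extMap p (res E k₁) z) :=
        hz.extMap fun m => cosec_res s k₁ m
      refine ⟨cut U V' ⊓ V, inf_le_right, toExt p E _ (extMap p (res E k₁) z), ⟨hV', hx⟩,
        fun q => isCycle_toExt hz' q, (hf p _ _).trans ?_⟩
      have := mono_extPow_excessInclusion hE hs p
      refine injective_of_mono ((extPow p).map (excessInclusion s)) _ ?_
      rw [← σ.toExt_toTrace_eq hE hσ _ _ hz', extMap_toTrace_res, ← res_toExt, ← e, ← app_res]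
      exact congrArg _ (res_res (M := (extPow p).obj (excess s)) k (trace_mono s k₁) b)
    -- Off the zero locus the target vanishes, and the cycle `0` is a preimage.
    · obtain ⟨W, m, hW, hm⟩ := exists_cosec_eq_one hxs
      have k₁ : extend U (cut U W ⊓ V) ≤ W := (extend_mono U inf_le_left).trans (extend_cut_le U W)
      refine ⟨cut U W ⊓ V, inf_le_right, 0, ⟨hW, hx⟩, fun q => map_zero _, ?_⟩
      have hm' : cosec s (extend U (cut U W ⊓ V)) (res E k₁ m) = 1 := by
        rw [cosec_res, hm, map_one]
      exact (map_zero _).trans (eq_zero_of_cosec_eq_one (F := (extPow p).obj (excess s)) hm' _).symm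

end Local

end Koszul

end

theorem proposition2p3 {n r : ℕ} (Y : Type) [TopologicalSpace Y] [T2Space Y] [ConnectedSpace Y]
    [ChartedSpace (EuclideanSpace ℂ (Fin n)) Y]
    [IsManifold 𝓘(ℂ, EuclideanSpace ℂ (Fin n)) ω Y]
    (E : ModuleSheaf (holomorphicSheaf n Y)) (hE : IsVectorBundleOfRank E r)
    (s : E ⟶ structureModule (holomorphicSheaf n Y)) (hs : IsWeaklyRegular s) :
    ∃ Φ : koszulOnT s ≅ symShift ((restrictToT s).obj E),
      (∀ p : ℕ, Φ.hom.f p = pullExtPow (incl s) (inclRingHom s) p E) ∧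
      LocallyQuasiIso (koszul s) (pushSymExcess s) ∧
      ∀ p : ℕ,
        Mono (homologyRestriction s Φ p) ∧
        Mono ((extPow p).map (excessInclusion s)) ∧
        imageSubobject (homologyRestriction s Φ p) =
          imageSubobject ((extPow p).map (excessInclusion s)) ∧
        ∃! e : (koszul s).homology p ≅ (pushFromT s).obj ((extPow p).obj (excess s)),
          ((pullPushAdj (incl s) (inclRingHom s)).homEquiv _ _).symm e.hom ≫
            (extPow p).map (excessInclusion s) = homologyRestriction s Φ p := by
  have hE' : IsVectorBundle E := fun x => by
    obtain ⟨U, hU, e, he⟩ := hE x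
    exact ⟨U, hU, r, e, he⟩
  exact ⟨koszulOnTIso s hE', fun p => rfl, locallyQuasiIso_koszul hE' hs.2,
    fun p => homologyRestriction_spec hE' hs.2 rfl⟩
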